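/- Let $\mathcal O_2$ be the ring of germs at $0\in\mathbb C^2$ of holomorphic functions, and let $\mathcal F$ be the germ of (possibly singular) holomorphic foliation at $0\in\mathbb C^2$ defined by a germ of holomorphic $1$-form $\omega=A\,dx+B\,dy$ whose coefficients have no common zero in a punctured neighbourhood of $0$. A germ of curve at $0$ with reduced equation $f=0$ (that is, $f\in\mathcal O_2$ is squarefree and $f(0)=0$; the curve need not be irreducible) is *invariant* by $\mathcal F$ if the $2$-form $\omega\wedge df$ is divisible by $f$, and $\mathcal F$ is *non-dicritical* if only finitely many irreducible germs of curves at $0$ are invariant by $\mathcal F$. A germ of meromorphic $1$-form $\Omega$ at a point of a complex surface is *logarithmic* if $\Omega$ and $d\Omega$ have at most simple poles along the pole divisor of $\Omega$; equivalently, if there is a squarefree holomorphic germ $h$ such that $h\,\Omega$ and $h\,d\Omega$ are holomorphic. Suppose that $\mathcal F$ is non-dicritical and that $S$ is a germ of curve at $0$, invariant by $\mathcal F$, with reduced equation $f=0$. Let $\sigma$ be the blow-up of the origin of $\mathbb C^2$, given in its two standard charts by $(x,t)\mapsto(x,tx)$ and $(s,y)\mapsto(sy,y)$. Then the meromorphic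 $1$-form $\sigma^*\!\left(\frac{\omega}{f}\right)$ is logarithmic: its germ at every point of the exceptional divisor $\sigma^{-1}(0)$ is logarithmic. -/

import Mathlib

open Filter
open scoped Topology

namespace HolFol

/-- The ring of germs at `p` of holomorphic functions on `ℂ²`. -/
def HolGerm (p : ℂ × ℂ) : Subring (Germ (𝓝 p) ℂ) where
  carrier := {g | ∃ f : ℂ × ℂ → ℂ, AnalyticAt ℂ f p ∧ (f : Germ (𝓝 p) ℂ) = g}
  mul_mem' := by
    rintro _ _ ⟨f, hf, rfl⟩ ⟨g, hg, rfl⟩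
    exact ⟨f * g, hf.mul hg, rfl⟩
  one_mem' := ⟨1, analyticAt_const, rfl⟩
  add_mem' := by
    rintro _ _ ⟨f, hf, rfl⟩ ⟨g, hg, rfl⟩
    exact ⟨f + g, hf.add hg, rfl⟩
  zero_mem' := ⟨0, analyticAt_const, rfl⟩
  neg_mem' := by
    rintro _ ⟨f, hf, rfl⟩
    exact ⟨-f, hf.neg, rfl⟩

/-- The germ at `p` of a function that is holomorphic near `p`. -/
noncomputable def germOf {p : ℂ × ℂ} (f : ℂ × ℂ → ℂ) (hf : AnalyticAt ℂ f p) : HolGerm p :=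
  ⟨(f : Germ (𝓝 p) ℂ), f, hf, rfl⟩

/-- The derivative of a holomorphic germ in the direction `v`. -/
noncomputable def dirDeriv {p : ℂ × ℂ} (v : ℂ × ℂ) (g : HolGerm p) : HolGerm p :=
  ⟨Germ.map' (fun f z => fderiv ℂ f z v)
      (fun _ _ h => (h.fderiv (𝕜 := ℂ)).mono fun _ hz => congrArg (fun L => L v) hz) (g : Germ (𝓝 p) ℂ), by
    obtain ⟨_, f, hf, rfl⟩ := g
    exact ⟨fun z => fderiv ℂ f z v,
      ((ContinuousLinearMap.apply ℂ ℂ v).analyticAt _).comp hf.fderiv, rfl⟩⟩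

/-- Partial derivative with respect to the first coordinate. -/
noncomputable def d₁ {p : ℂ × ℂ} (g : HolGerm p) : HolGerm p := dirDeriv (1, 0) g

/-- Partial derivative with respect to the second coordinate. -/
noncomputable def d₂ {p : ℂ × ℂ} (g : HolGerm p) : HolGerm p := dirDeriv (0, 1) g

/-- The germ at `p` of a holomorphic `1`-form `A dx + B dy`, where `x`, `y` are the two
coordinates of `ℂ²`. -/
structure OneForm (p : ℂ × ℂ) where
  A : HolGerm p
  B : HolGerm p

/-- The coefficient of `dx ∧ dy` in `df ∧ ω`. -/
noncomputable def dWedge {p : ℂ × ℂ} (f : HolGerm p) (ω : OneForm p) : HolGerm p :=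
  d₁ f * ω.B - d₂ f * ω.A

/-- The coefficient of `dx ∧ dy` in the exterior derivative `dω`. -/
noncomputable def extDeriv {p : ℂ × ℂ} (ω : OneForm p) : HolGerm p := d₁ ω.B - d₂ ω.A

/-- Pullback of function germs by a holomorphic map germ `φ : (ℂ², p) → (ℂ², q)`. -/
noncomputable def pullback {p q : ℂ × ℂ} (φ : ℂ × ℂ → ℂ × ℂ) (hφ : AnalyticAt ℂ φ p) (hq : φ p = q)
    (g : HolGerm q) : HolGerm p :=
  ⟨(g : Germ (𝓝 q) ℂ).compTendsto φ (hq ▸ hφ.continuousAt), by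
    subst hq
    obtain ⟨_, f, hf, rfl⟩ := g
    exact ⟨f ∘ φ, hf.comp hφ, rfl⟩⟩

/-- Pullback of `1`-forms: `φ^*(A dx + B dy) = (A ∘ φ) dφ₁ + (B ∘ φ) dφ₂`. -/
noncomputable def OneForm.pullback {p q : ℂ × ℂ} (φ : ℂ × ℂ → ℂ × ℂ) (hφ : AnalyticAt ℂ φ p)
    (hq : φ p = q) (ω : OneForm q) : OneForm p :=
  let φ₁ : HolGerm p := germOf (fun z => (φ z).1) (analyticAt_fst.comp hφ)
  let φ₂ : HolGerm p := germOf (fun z => (φ z).2) (analyticAt_snd.comp hφ)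
  { A := HolFol.pullback φ hφ hq ω.A * d₁ φ₁ + HolFol.pullback φ hφ hq ω.B * d₁ φ₂
    B := HolFol.pullback φ hφ hq ω.A * d₂ φ₁ + HolFol.pullback φ hφ hq ω.B * d₂ φ₂ }

/-- `ω` has no zero in a punctured neighbourhood of `p`: it defines a germ of (possibly singular)
foliation at `p`, and every germ of foliation at `p` is defined by such an `ω`, which is unique up
to multiplication by a unit. -/
def OneForm.HasIsolatedZero {p : ℂ × ℂ} (ω : OneForm p) : Prop :=
  ∃ a b : ℂ × ℂ → ℂ, (a : Germ (𝓝 p) ℂ) = ω.A ∧ (b : Germ (𝓝 p) ℂ) = ω.B ∧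
    ∀ᶠ z in 𝓝[≠] p, ¬ (a z = 0 ∧ b z = 0)

/-- `f = 0` is a reduced equation of a germ of curve at `p`. -/
def IsReducedEquation {p : ℂ × ℂ} (f : HolGerm p) : Prop :=
  (f : Germ (𝓝 p) ℂ).value = 0 ∧ Squarefree f

/-- The curve with reduced equation `f = 0` is invariant by the foliation defined by `ω`:
the `2`-form `df ∧ ω` is divisible by `f`. -/
def IsInvariant {p : ℂ × ℂ} (ω : OneForm p) (f : HolGerm p) : Prop := f ∣ dWedge f ω

/-- The separatrices of the foliation defined by `ω`, i.e. its irreducible invariant curve germs,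
each of them given by its ideal. -/
def separatrices {p : ℂ × ℂ} (ω : OneForm p) : Set (Ideal (HolGerm p)) :=
  {I | ∃ g : HolGerm p, Irreducible g ∧ IsInvariant ω g ∧ I = Ideal.span {g}}

/-- The foliation defined by `ω` has only finitely many separatrices. -/
def NonDicritical {p : ℂ × ℂ} (ω : OneForm p) : Prop := (separatrices ω).Finite

/-- The germ of meromorphic `1`-form `Ω = η / g` is logarithmic: `Ω` and
`dΩ = (g dη - dg ∧ η) / g²` have at most simple poles along one and the same reduced divisor
`h = 0`, i.e. `h Ω` and `h dΩ` are holomorphic. -/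
def IsLogarithmic {p : ℂ × ℂ} (η : OneForm p) (g : HolGerm p) : Prop :=
  g ≠ 0 ∧ ∃ h : HolGerm p, Squarefree h ∧ g ∣ h * η.A ∧ g ∣ h * η.B ∧
    g ^ 2 ∣ h * (g * extDeriv η - dWedge g η)

/-- The blow-up of the origin in its first standard chart, `(x, t) ↦ (x, t x)`; the exceptional
divisor is `x = 0`. -/
def blowUp₁ (z : ℂ × ℂ) : ℂ × ℂ := (z.1, z.2 * z.1)

/-- The blow-up of the origin in its second standard chart, `(s, y) ↦ (s y, y)`; the exceptional
divisor is `y = 0`. -/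
def blowUp₂ (z : ℂ × ℂ) : ℂ × ℂ := (z.1 * z.2, z.2)

theorem analyticAt_blowUp₁ (p : ℂ × ℂ) : AnalyticAt ℂ blowUp₁ p :=
  analyticAt_fst.prod (analyticAt_snd.mul analyticAt_fst)

theorem analyticAt_blowUp₂ (p : ℂ × ℂ) : AnalyticAt ℂ blowUp₂ p :=
  (analyticAt_fst.mul analyticAt_snd).prod analyticAt_snd

theorem blowUp₁_exceptional (t : ℂ) : blowUp₁ (0, t) = 0 := by simp [blowUp₁]

theorem blowUp₂_exceptional (s : ℂ) : blowUp₂ (s, 0) = 0 := by simp [blowUp₂]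

/-- The pullback of the germ `ω / f` at the origin by the blow-up of the origin is logarithmic:
its germ at each point of the exceptional divisor is, the two standard charts covering this
divisor. -/
def BlowUpIsLogarithmic (ω : OneForm 0) (f : HolGerm 0) : Prop :=
  (∀ t : ℂ, IsLogarithmic
    (ω.pullback blowUp₁ (analyticAt_blowUp₁ (0, t)) (blowUp₁_exceptional t))
    (pullback blowUp₁ (analyticAt_blowUp₁ (0, t)) (blowUp₁_exceptional t) f)) ∧
  (∀ s : ℂ, IsLogarithmic
    (ω.pullback blowUp₂ (analyticAt_blowUp₂ (s, 0)) (blowUp₂_exceptional s))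
    (pullback blowUp₂ (analyticAt_blowUp₂ (s, 0)) (blowUp₂_exceptional s) f))

end HolFol

/-! Let m be the order of f at the origin and n that of ω, the smaller of the orders of its
coefficients. In the first chart f ∘ σ = x^m φ and σ*ω = x^n ((α + tβ) dx + xβ dt), so σ*(ω/f) =
x^(n+1-m) ((α + tβ) dx + xβ dt) / (xφ). If m ≤ n + 1, the numerator ζ is holomorphic; h = xφ is
squarefree, because the strict transform of a reduced curve is reduced, and h = 0 is invariant by ζ.
From dh ∧ ζ = hW one gets d(ζ/h) = (dζ - W)/h, hence ζ/h is logarithmic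
(`isLogarithmic_of_invariant`, `isLogarithmic_blowUp₁`). The second chart follows by exchanging the
coordinates.

Everything thus rests on m ≤ n + 1 (`exists_homogRep_le`). Let r be the leading form of f and Q =
xAₙ + yBₙ the tangent cone of ω, both written in t = y/x. If Q were zero, σ*ω would be divisible by
x^(n+1), with a quotient transverse to the exceptional divisor at all but finitely many points, and
there would be infinitely many separatrices (`manySols_of_dicritical`). So Q is a nonzero form of
degree n + 1, and it suffices to bound the multiplicity of r by that of Q at each point of the
projective line (`rootMultiplicity_le`, `le_of_rootMultiplicity_le`).

At t = l the multiplicity of r is the order of φ(0, l + ·). By Puiseux, after x = u^N, φ has that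
many smooth branches as factors, pairwise distinct because f is squarefree (`HasBlow.exists_roots`).
They solve an equation a + b s' = 0 with b = 0 on u = 0, where a(0, ·) has order the multiplicity of
Q at l. The counting lemma `manySols_or_card_le` says that such an equation has either infinitely
many solutions or at most ord a(0, ·). It is proved by blowing up, by induction on the contact
between the solutions: they are distributed among the roots of a tangent cone, whose degree is one
less than expected because the vertical axis is invariant.

Infinitely many solutions give infinitely many arcs (u^N, z(u)) tangent to ω. Each arc has a prime
equation G, the norm of y - z(u) under the rotations of u. G is invariant, and only finitely many
arcs with the same N can lie on one G, so ω would be dicritical (`not_nonDicritical_of_arcs`). -/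

namespace HolFol

/-! ### Double power series -/

/-- The homogeneous form `z ↦ z₁ ^ k₁ z₂ ^ k₂` as a multilinear map. -/
noncomputable def monomialForm (n : ℕ) (k : ℕ) :
    ContinuousMultilinearMap ℂ (fun _ : Fin n => ℂ × ℂ) ℂ :=
  (ContinuousMultilinearMap.mkPiAlgebraFin ℂ n ℂ).compContinuousLinearMap
    fun i => if i.val < k then ContinuousLinearMap.fst ℂ ℂ ℂ else ContinuousLinearMap.snd ℂ ℂ ℂ

theorem norm_monomialForm_le (n k : ℕ) : ‖monomialForm n k‖ ≤ 1 := by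
  refine (ContinuousMultilinearMap.norm_compContinuousLinearMap_le _ _).trans ?_
  rw [ContinuousMultilinearMap.norm_mkPiAlgebraFin, one_mul]
  refine Finset.prod_le_one (fun _ _ => norm_nonneg _) fun i _ => ?_
  split_ifs
  · exact ContinuousLinearMap.norm_fst_le ℂ ℂ ℂ
  · exact ContinuousLinearMap.norm_snd_le ℂ ℂ ℂ

theorem monomialForm_apply_diag (i j : ℕ) (z : ℂ × ℂ) :
    monomialForm (i + j) i (fun _ => z) = z.1 ^ i * z.2 ^ j := by
  simp [monomialForm, List.prod_ofFn, Fin.prod_univ_add]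

/-- The sum of an absolutely convergent double power series is holomorphic. -/
theorem analyticAt_of_double_series {c : ℕ × ℕ → ℂ} {ρ : ℝ} (hρ : 0 < ρ)
    (hc : Summable fun k => ‖c k‖ * ρ ^ (k.1 + k.2)) {f : ℂ × ℂ → ℂ}
    (hf : ∀ᶠ z in 𝓝 (0 : ℂ × ℂ), HasSum (fun k => c k * (z.1 ^ k.1 * z.2 ^ k.2)) (f z)) :
    AnalyticAt ℂ f 0 := by
  -- The terms need not be symmetric: only their values on the diagonal enter the sum. The
  -- coordinate projections have norm at most 1, so `p n` has norm at most the sum of the ‖c k‖ over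
  -- the antidiagonal.
  let p : FormalMultilinearSeries ℂ (ℂ × ℂ) ℂ := fun n =>
    ∑ k ∈ Finset.HasAntidiagonal.antidiagonal n, c k • monomialForm n k.1
  have hs := (Finset.HasAntidiagonal.sigmaAntidiagonalEquivProd (A := ℕ)).summable_iff.2 hc
  have hs' : Summable fun n => ∑ k ∈ Finset.HasAntidiagonal.antidiagonal n, ‖c k‖ * ρ ^ n := by
    have := hs.sigma
    refine this.congr fun n => ?_
    rw [tsum_fintype, ← Finset.sum_coe_sort (Finset.HasAntidiagonal.antidiagonal n)]
    refine Finset.sum_congr rfl fun k _ => ?_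
    have := Finset.HasAntidiagonal.mem_antidiagonal.1 k.2
    simp [Finset.HasAntidiagonal.sigmaAntidiagonalEquivProd, this]
  obtain ⟨r, hr, hrf⟩ := Metric.eventually_nhds_iff.1 hf
  let R : NNReal := ⟨min ρ r, (lt_min hρ hr).le⟩
  have hR : (0 : ℝ) < R := lt_min hρ hr
  have hle : (R : ENNReal) ≤ p.radius := by
    refine p.le_radius_of_summable_norm (Summable.of_nonneg_of_le (fun _ => by positivity)
      (fun n => ?_) hs')
    rw [← Finset.sum_mul]
    refine mul_le_mul ((norm_sum_le _ _).trans (Finset.sum_le_sum fun k _ => ?_))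
      (pow_le_pow_left₀ hR.le (min_le_left _ _) _) (by positivity) (by positivity)
    rw [norm_smul]
    exact mul_le_of_le_one_right (norm_nonneg _) (norm_monomialForm_le _ _)
  refine ⟨p, R, hle, by exact_mod_cast hR, fun {y} hy => ?_⟩
  have hy' : dist y 0 < r := by
    have : ‖y‖ < R := by simpa [Metric.mem_eball, edist_zero_right, enorm, ← NNReal.coe_lt_coe] using hy
    rw [dist_zero_right]
    exact this.trans_le (min_le_right _ _)
  have h := hrf hy'
  rw [← (Finset.HasAntidiagonal.sigmaAntidiagonalEquivProd (A := ℕ)).hasSum_iff] at h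
  rw [zero_add]
  refine h.sigma fun n => ?_
  have : p n (fun _ => y) = ∑ k : Finset.HasAntidiagonal.antidiagonal n, c k * (y.1 ^ k.1.1 * y.2 ^ k.1.2) := by
    rw [Finset.sum_coe_sort (Finset.HasAntidiagonal.antidiagonal n) fun k => c k * (y.1 ^ k.1 * y.2 ^ k.2)]
    simp only [p, _root_.sum_apply, _root_.smul_apply]
    refine Finset.sum_congr rfl fun k hk => ?_
    obtain ⟨i, j⟩ := k
    rw [Finset.HasAntidiagonal.mem_antidiagonal] at hk
    subst hk
    rw [monomialForm_apply_diag, smul_eq_mul]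
  rw [this]
  exact hasSum_fintype _

/-- A holomorphic function of two variables is the sum of an absolutely convergent double power
series. -/
theorem exists_double_series {f : ℂ × ℂ → ℂ} (hf : AnalyticAt ℂ f 0) :
    ∃ (c : ℕ × ℕ → ℂ) (ρ : ℝ), 0 < ρ ∧ (Summable fun k => ‖c k‖ * ρ ^ (k.1 + k.2)) ∧
      ∀ᶠ z in 𝓝 (0 : ℂ × ℂ), HasSum (fun k => c k * (z.1 ^ k.1 * z.2 ^ k.2)) (f z) := by
  obtain ⟨p, r, hp⟩ := hf
  let e₁ : ℂ × ℂ := (1, 0)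
  let e₂ : ℂ × ℂ := (0, 1)
  let q (n : ℕ) (s : Finset (Fin n)) : ℂ := p n (s.piecewise (fun _ => e₁) fun _ => e₂)
  -- Expanding `p n` at z₁ e₁ + z₂ e₂ by multilinearity gives one term per set of slots filled with
  -- e₁; `c k` collects the sets with k₁ elements.
  let c : ℕ × ℕ → ℂ := fun k => ∑ s ∈ Finset.powersetCard k.1 Finset.univ, q (k.1 + k.2) s
  have hq (n s) : ‖q n s‖ ≤ ‖p n‖ := by
    refine (ContinuousMultilinearMap.le_opNorm _ _).trans
      (mul_le_of_le_one_right (norm_nonneg _) (Finset.prod_le_one (fun _ _ => norm_nonneg _)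
        fun i _ => ?_))
    by_cases hi : i ∈ s <;> simp [hi, e₁, e₂, Prod.norm_def]
  have hc (k : ℕ × ℕ) : ‖c k‖ ≤ (k.1 + k.2).choose k.1 * ‖p (k.1 + k.2)‖ := by
    refine (norm_sum_le _ _).trans ((Finset.sum_le_sum fun s _ => hq _ s).trans ?_)
    simp
  obtain ⟨R, hR0, hR⟩ := ENNReal.lt_iff_exists_nnreal_btwn.1 (hp.r_pos.trans_le hp.r_le)
  have hR0' : (0 : ℝ) < R := by exact_mod_cast hR0
  have hsR := p.summable_norm_mul_pow hR
  have hpos : (0 : ℝ) < R / 2 := by positivity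
  have h0 (k : ℕ × ℕ) : 0 ≤ ‖c k‖ * (R / 2 : ℝ) ^ (k.1 + k.2) := by positivity
  -- The binomial coefficients bounding ‖c k‖ add up to 2 ^ n over an antidiagonal; halving the
  -- radius absorbs this factor.
  have hsum : Summable fun k : ℕ × ℕ => ‖c k‖ * (R / 2 : ℝ) ^ (k.1 + k.2) := by
    rw [← (Finset.HasAntidiagonal.sigmaAntidiagonalEquivProd (A := ℕ)).summable_iff,
      summable_sigma_of_nonneg (f := (fun k : ℕ × ℕ => ‖c k‖ * (R / 2 : ℝ) ^ (k.1 + k.2)) ∘ _)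
        (fun _ => h0 _)]
    refine ⟨fun n => Summable.of_finite, ?_⟩
    refine Summable.of_nonneg_of_le (fun n => tsum_nonneg fun _ => h0 _) (fun n => ?_) hsR
    rw [tsum_fintype]
    have h1 (k : Finset.HasAntidiagonal.antidiagonal n) : ‖c k.1‖ * (R / 2 : ℝ) ^ (k.1.1 + k.1.2) ≤
        n.choose k.1.1 * (‖p n‖ * (R / 2 : ℝ) ^ n) := by
      have hk := Finset.HasAntidiagonal.mem_antidiagonal.1 k.2
      have := hc k.1
      rw [hk] at this ⊢
      rw [← mul_assoc]
      gcongr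
    refine (Finset.sum_le_sum fun k _ => h1 k).trans (le_of_eq ?_)
    rw [← Finset.sum_mul, Finset.sum_coe_sort (Finset.HasAntidiagonal.antidiagonal n) fun k => (n.choose k.1 : ℝ),
      Finset.Nat.sum_antidiagonal_eq_sum_range_succ_mk]
    have : (∑ k ∈ Finset.range n.succ, (n.choose k : ℝ)) = 2 ^ n := by
      exact_mod_cast Nat.sum_range_choose n
    simp only [this, div_pow]
    field_simp
  refine ⟨c, R / 2, hpos, hsum, ?_⟩
  have hball : ∀ᶠ z in 𝓝 (0 : ℂ × ℂ), z ∈ Metric.eball 0 r := Metric.eball_mem_nhds _ hp.r_pos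
  filter_upwards [hball, Metric.ball_mem_nhds (0 : ℂ × ℂ) hpos] with z hz hz'
  have hz2 : ‖z.1‖ ≤ R / 2 ∧ ‖z.2‖ ≤ R / 2 := by
    have : ‖z‖ < R / 2 := by simpa using hz'
    exact ⟨(norm_fst_le z).trans this.le, (norm_snd_le z).trans this.le⟩
  have hS : Summable fun k => c k * (z.1 ^ k.1 * z.2 ^ k.2) := by
    refine Summable.of_norm_bounded hsum fun k => ?_
    rw [norm_mul, norm_mul, norm_pow, norm_pow, pow_add]
    have := hz2.1; have := hz2.2
    gcongr
  have hH := hS.hasSum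
  have h2 := (Finset.HasAntidiagonal.sigmaAntidiagonalEquivProd (A := ℕ)).hasSum_iff.2 hH
  have h3 : HasSum (fun n => p n fun _ => z) (∑' k, c k * (z.1 ^ k.1 * z.2 ^ k.2)) := by
    refine h2.sigma fun n => ?_
    have : (p n fun _ => z) = ∑ k : Finset.HasAntidiagonal.antidiagonal n, c k * (z.1 ^ k.1.1 * z.2 ^ k.1.2) := by
      rw [Finset.sum_coe_sort (Finset.HasAntidiagonal.antidiagonal n) fun k => c k * (z.1 ^ k.1 * z.2 ^ k.2),
        Finset.Nat.sum_antidiagonal_eq_sum_range_succ_mk]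
      have hz0 : (fun _ : Fin n => z) = (fun _ => z.1 • e₁) + fun _ => z.2 • e₂ := by
        funext i
        simp [e₁, e₂]
      have hs (s : Finset (Fin n)) :
          p n (s.piecewise (fun _ => z.1 • e₁) fun _ => z.2 • e₂) =
            z.1 ^ s.card * z.2 ^ (n - s.card) * q n s := by
        have h := (p n).toMultilinearMap.map_smul_univ (s.piecewise (fun _ => z.1) fun _ => z.2)
          (s.piecewise (fun _ => e₁) fun _ => e₂)
        have h' : (fun i => s.piecewise (fun _ => z.1) (fun _ => z.2) i •
            s.piecewise (fun _ => e₁) (fun _ => e₂) i) =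
            s.piecewise (fun _ => z.1 • e₁) fun _ => z.2 • e₂ := by
          funext i
          by_cases hi : i ∈ s <;> simp [hi]
        rw [h'] at h
        refine h.trans ?_
        rw [smul_eq_mul, Finset.prod_piecewise]
        simp [q, Finset.card_sdiff]
      rw [hz0, ContinuousMultilinearMap.map_add_univ, Finset.sum_congr rfl fun s _ => hs s,
        ← Finset.sum_fiberwise_of_maps_to (t := Finset.range n.succ) (g := Finset.card)
          (fun s _ => Finset.mem_range_succ_iff.2 (card_finset_fin_le s))]
      refine Finset.sum_congr rfl fun k hk => ?_
      have hk' : k + (n - k) = n := Nat.add_sub_cancel' (Finset.mem_range_succ_iff.1 hk)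
      have hcc : c (k, n - k) = ∑ s ∈ Finset.powersetCard k Finset.univ, q n s := by
        simp only [c]
        rw [hk']
      rw [hcc, Finset.sum_mul]
      refine Finset.sum_congr ?_ fun s hs => ?_
      · ext s
        simp [Finset.mem_powersetCard]
      · rw [(Finset.mem_powersetCard.1 hs).2]
        ring
    rw [this]
    exact hasSum_fintype _
  have h4 := hp.hasSum hz
  rw [zero_add] at h4
  rwa [h4.unique h3]

/-- Hadamard's lemma: division of `f - f(·, 0)` by the second coordinate. -/
theorem exists_eq_add_snd_mul {f : ℂ × ℂ → ℂ} (hf : AnalyticAt ℂ f 0) :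
    ∃ g : ℂ × ℂ → ℂ, AnalyticAt ℂ g 0 ∧ ∀ᶠ z in 𝓝 (0 : ℂ × ℂ), f z = f (z.1, 0) + z.2 * g z := by
  obtain ⟨c, ρ, hρ, hc, hfc⟩ := exists_double_series hf
  let φ : ℕ × ℕ → ℕ × ℕ := fun k => (k.1, k.2 + 1)
  have hφ : Function.Injective φ := fun a b h => by
    simp only [φ, Prod.mk.injEq, Nat.add_right_cancel_iff] at h
    exact Prod.ext h.1 h.2
  have hs : Summable fun k : ℕ × ℕ => ‖c (φ k)‖ * ρ ^ (k.1 + k.2) := by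
    refine ((hc.comp_injective hφ).mul_right ρ⁻¹).congr fun k => ?_
    simp only [φ, Function.comp, ← add_assoc, pow_succ]
    field_simp
  have hproj : ∀ᶠ z in 𝓝 (0 : ℂ × ℂ),
      HasSum (fun k => c k * (z.1 ^ k.1 * 0 ^ k.2)) (f (z.1, 0)) := by
    have : Tendsto (fun z : ℂ × ℂ => (z.1, (0 : ℂ))) (𝓝 0) (𝓝 0) :=
      Continuous.tendsto' (by fun_prop) _ _ rfl
    exact this.eventually hfc
  have hgs : ∀ᶠ z in 𝓝 (0 : ℂ × ℂ), Summable fun k => c (φ k) * (z.1 ^ k.1 * z.2 ^ k.2) := by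
    filter_upwards [Metric.ball_mem_nhds (0 : ℂ × ℂ) hρ] with z hz
    have hz' : ‖z‖ < ρ := by simpa using hz
    have h1 := (norm_fst_le z).trans hz'.le
    have h2 := (norm_snd_le z).trans hz'.le
    refine Summable.of_norm_bounded hs fun k => ?_
    rw [norm_mul, norm_mul, norm_pow, norm_pow, pow_add]
    gcongr
  refine ⟨fun z => ∑' k, c (φ k) * (z.1 ^ k.1 * z.2 ^ k.2),
    analyticAt_of_double_series hρ hs (hgs.mono fun z hz => hz.hasSum), ?_⟩
  filter_upwards [hfc, hproj, hgs] with z h1 h2 h3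
  rw [← sub_eq_iff_eq_add']
  have h4 := h1.sub h2
  refine h4.unique ?_
  rw [← hφ.hasSum_iff]
  · refine (h3.hasSum.mul_left z.2).congr_fun fun k => ?_
    simp only [φ, Function.comp, pow_succ]
    ring
  · intro k hk
    rcases k with ⟨i, _ | j⟩
    · simp
    · exact absurd ⟨(i, j), rfl⟩ hk

theorem analyticAt_comp_swap {f : ℂ × ℂ → ℂ} (hf : AnalyticAt ℂ f 0) :
    AnalyticAt ℂ (f ∘ Prod.swap) 0 :=
  AnalyticAt.comp (g := f) (f := Prod.swap) hf (analyticAt_snd.prod analyticAt_fst)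

/-- Hadamard's lemma for the first coordinate. -/
theorem exists_eq_add_fst_mul {f : ℂ × ℂ → ℂ} (hf : AnalyticAt ℂ f 0) :
    ∃ g : ℂ × ℂ → ℂ, AnalyticAt ℂ g 0 ∧ ∀ᶠ z in 𝓝 (0 : ℂ × ℂ), f z = f (0, z.2) + z.1 * g z := by
  obtain ⟨g, hg, h⟩ := exists_eq_add_snd_mul (analyticAt_comp_swap hf)
  refine ⟨g ∘ Prod.swap, analyticAt_comp_swap hg, ?_⟩
  have : Tendsto Prod.swap (𝓝 (0 : ℂ × ℂ)) (𝓝 0) := Continuous.tendsto' (by fun_prop) _ _ rfl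
  filter_upwards [this.eventually h] with z hz
  simpa using hz

/-- A holomorphic function that is invariant under the rotations of order `N` of the first
coordinate is a function of the `N`-th power of the first coordinate. -/
theorem exists_descent {N : ℕ} (hN : N ≠ 0) {ζ : ℂ} (hζ : IsPrimitiveRoot ζ N) {f : ℂ × ℂ → ℂ}
    (hf : AnalyticAt ℂ f 0)
    (hinv : ∀ k : ℕ, ∀ᶠ z in 𝓝 (0 : ℂ × ℂ), f (ζ ^ k * z.1, z.2) = f z) :
    ∃ g : ℂ × ℂ → ℂ, AnalyticAt ℂ g 0 ∧ ∀ᶠ z in 𝓝 (0 : ℂ × ℂ), f z = g (z.1 ^ N, z.2) := by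
  obtain ⟨c, ρ, hρ, hc, hfc⟩ := exists_double_series hf
  let φ : ℕ × ℕ → ℕ × ℕ := fun k => (N * k.1, k.2)
  have hφ : Function.Injective φ := fun a b h => by
    simp only [φ, Prod.mk.injEq, mul_eq_mul_left_iff, hN, or_false] at h
    exact Prod.ext h.1 h.2
  -- The bound needed is r ^ (i + j) ≤ ρ ^ (N i + j). Capping ρ at 1 makes the larger exponent N (i
  -- + j) harmless.
  let r : ℝ := min ρ 1 ^ N
  have hm : 0 < min ρ 1 := lt_min hρ one_pos
  have hr : 0 < r := by positivity
  have hs : Summable fun k : ℕ × ℕ => ‖c (φ k)‖ * r ^ (k.1 + k.2) := by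
    refine Summable.of_nonneg_of_le (fun k => by positivity) (fun k => ?_)
      (hc.comp_injective hφ)
    simp only [Function.comp, φ]
    refine mul_le_mul_of_nonneg_left ?_ (norm_nonneg _)
    calc r ^ (k.1 + k.2) = min ρ 1 ^ (N * (k.1 + k.2)) := by rw [pow_mul]
      _ ≤ min ρ 1 ^ (N * k.1 + k.2) := by
          refine pow_le_pow_of_le_one hm.le (min_le_right _ _) ?_
          have := Nat.pos_of_ne_zero hN
          nlinarith
      _ ≤ ρ ^ (N * k.1 + k.2) := pow_le_pow_left₀ hm.le (min_le_left _ _) _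
  have hgs : ∀ᶠ z in 𝓝 (0 : ℂ × ℂ), Summable fun k => c (φ k) * (z.1 ^ k.1 * z.2 ^ k.2) := by
    filter_upwards [Metric.ball_mem_nhds (0 : ℂ × ℂ) hr] with z hz
    have hz' : ‖z‖ < r := by simpa using hz
    have h1 := (norm_fst_le z).trans hz'.le
    have h2 := (norm_snd_le z).trans hz'.le
    refine Summable.of_norm_bounded hs fun k => ?_
    rw [norm_mul, norm_mul, norm_pow, norm_pow, pow_add]
    gcongr
  refine ⟨fun z => ∑' k, c (φ k) * (z.1 ^ k.1 * z.2 ^ k.2),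
    analyticAt_of_double_series hr hs (hgs.mono fun z hz => hz.hasSum), ?_⟩
  have hrot (k : ℕ) : ∀ᶠ z in 𝓝 (0 : ℂ × ℂ),
      HasSum (fun l => c l * ((ζ ^ k * z.1) ^ l.1 * z.2 ^ l.2)) (f z) := by
    have : Tendsto (fun z : ℂ × ℂ => (ζ ^ k * z.1, z.2)) (𝓝 0) (𝓝 0) :=
      Continuous.tendsto' (by fun_prop) _ _ (by simp)
    filter_upwards [this.eventually hfc, hinv k] with z h1 h2
    rwa [h2] at h1
  have hall : ∀ᶠ z in 𝓝 (0 : ℂ × ℂ), ∀ k ∈ Finset.range N,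
      HasSum (fun l => c l * ((ζ ^ k * z.1) ^ l.1 * z.2 ^ l.2)) (f z) :=
    (Finset.eventually_all _).2 fun k _ => hrot k
  have hpow : Tendsto (fun z : ℂ × ℂ => (z.1 ^ N, z.2)) (𝓝 0) (𝓝 0) :=
    Continuous.tendsto' (by fun_prop) _ _ (by simp [hN])
  filter_upwards [hall, hpow.eventually hgs] with z h1 h2
  -- Averaging over the N rotations keeps the monomials whose first exponent is a multiple of N and
  -- kills the others.
  have h3 := (hasSum_sum h1).div_const (N : ℂ)
  have hN' : (N : ℂ) ≠ 0 := Nat.cast_ne_zero.2 hN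
  rw [Finset.sum_const, Finset.card_range, nsmul_eq_mul, mul_div_cancel_left₀ _ hN'] at h3
  refine h3.unique ?_
  rw [← hφ.hasSum_iff]
  · refine h2.hasSum.congr_fun fun k => ?_
    have : ∀ i, (ζ ^ i) ^ (N * k.1) = 1 := fun i => by
      rw [← pow_mul, mul_left_comm, pow_mul, hζ.pow_eq_one, one_pow]
    have h4 : ∀ i, (ζ ^ i * z.1) ^ (N * k.1) = (z.1 ^ N) ^ k.1 := fun i => by
      rw [mul_pow, this, one_mul, pow_mul]
    simp only [φ, Function.comp, h4, Finset.sum_const, Finset.card_range, nsmul_eq_mul,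
      mul_div_cancel_left₀ _ hN']
  · intro k hk
    have hk' : ¬ N ∣ k.1 := fun ⟨i, hi⟩ => hk ⟨(i, k.2), Prod.ext hi.symm rfl⟩
    have : ∑ i ∈ Finset.range N, (ζ ^ i) ^ k.1 = 0 := by
      have h1 : ζ ^ k.1 ≠ 1 := fun h => hk' ((hζ.pow_eq_one_iff_dvd _).1 h)
      have h2 : ∑ i ∈ Finset.range N, (ζ ^ i) ^ k.1 = ∑ i ∈ Finset.range N, (ζ ^ k.1) ^ i :=
        Finset.sum_congr rfl fun i _ => by rw [← pow_mul, ← pow_mul, mul_comm]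
      rw [h2, geom_sum_eq h1, ← pow_mul, mul_comm, pow_mul, hζ.pow_eq_one, one_pow, sub_self,
        zero_div]
    have h4 : ∑ i ∈ Finset.range N, c k * ((ζ ^ i * z.1) ^ k.1 * z.2 ^ k.2) =
        (∑ i ∈ Finset.range N, (ζ ^ i) ^ k.1) * (c k * z.1 ^ k.1 * z.2 ^ k.2) := by
      rw [Finset.sum_mul]
      exact Finset.sum_congr rfl fun i _ => by ring
    rw [h4, this, zero_mul, zero_div]

/-! ### Order at the origin and blow-up of a function -/

/-- `A = ∑ x ^ (n - i) y ^ i aᵢ` with `aᵢ` holomorphic. -/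
def HomogRep (A : ℂ × ℂ → ℂ) (n : ℕ) (a : ℕ → ℂ × ℂ → ℂ) : Prop :=
  (∀ i, AnalyticAt ℂ (a i) 0) ∧
    ∀ᶠ z in 𝓝 (0 : ℂ × ℂ), A z = ∑ i ∈ Finset.range (n + 1), z.1 ^ (n - i) * z.2 ^ i * a i z

/-- `α` is the quotient of `A (x, t x)` by `x ^ n`, and `p` is its restriction to `x = 0`. -/
structure HasBlow (A : ℂ × ℂ → ℂ) (n : ℕ) (α : ℂ × ℂ → ℂ) (p : Polynomial ℂ) : Prop where
  analyticAt : ∀ t, AnalyticAt ℂ α (0, t)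
  eq : ∀ t, ∀ᶠ z in 𝓝 ((0 : ℂ), t), A (blowUp₁ z) = z.1 ^ n * α z
  eval : ∀ t, α (0, t) = p.eval t
  natDegree_le : p.natDegree ≤ n

/-- The restriction to `x = 1` of the leading form of `∑ x ^ (n - i) y ^ i aᵢ`. -/
noncomputable def leadPoly (n : ℕ) (a : ℕ → ℂ × ℂ → ℂ) : Polynomial ℂ :=
  ∑ i ∈ Finset.range (n + 1), Polynomial.monomial i (a i 0)

theorem coeff_leadPoly (n : ℕ) (a : ℕ → ℂ × ℂ → ℂ) (i : ℕ) :
    (leadPoly n a).coeff i = if i ≤ n then a i 0 else 0 := by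
  simp [leadPoly, Polynomial.coeff_monomial]

theorem tendsto_blowUp₁ (t : ℂ) : Tendsto blowUp₁ (𝓝 (0, t)) (𝓝 0) := by
  have := (analyticAt_blowUp₁ (0, t)).continuousAt.tendsto
  rwa [blowUp₁_exceptional] at this

theorem HomogRep.hasBlow {A : ℂ × ℂ → ℂ} {n : ℕ} {a : ℕ → ℂ × ℂ → ℂ} (h : HomogRep A n a) :
    HasBlow A n (fun z => ∑ i ∈ Finset.range (n + 1), z.2 ^ i * a i (blowUp₁ z)) (leadPoly n a) where
  analyticAt t := by
    refine Finset.analyticAt_fun_sum _ fun i _ => (analyticAt_snd.pow i).mul ?_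
    refine AnalyticAt.comp ?_ (analyticAt_blowUp₁ _)
    rw [blowUp₁_exceptional]
    exact h.1 i
  eq t := by
    filter_upwards [(tendsto_blowUp₁ t).eventually h.2] with z hz
    rw [hz, Finset.mul_sum]
    refine Finset.sum_congr rfl fun i hi => ?_
    have : z.1 ^ n = z.1 ^ (n - i) * z.1 ^ i := by
      rw [← pow_add, Nat.sub_add_cancel (Finset.mem_range_succ_iff.1 hi)]
    rw [this]
    simp only [blowUp₁, mul_pow]
    ring
  eval t := by
    simp only [leadPoly, blowUp₁_exceptional, Polynomial.eval_finsetSum, Polynomial.eval_monomial]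
    exact Finset.sum_congr rfl fun i _ => mul_comm _ _
  natDegree_le := Polynomial.natDegree_le_iff_coeff_eq_zero.2 fun i hi => by
    rw [coeff_leadPoly, if_neg (by omega)]

/-- Gives access to the direction x = 0, the one point of the exceptional divisor missing from the
first chart. -/
theorem HomogRep.swap {A : ℂ × ℂ → ℂ} {n : ℕ} {a : ℕ → ℂ × ℂ → ℂ} (h : HomogRep A n a) :
    HomogRep (A ∘ Prod.swap) n fun i => a (n - i) ∘ Prod.swap := by
  refine ⟨fun i => analyticAt_comp_swap (h.1 _), ?_⟩
  have : Tendsto Prod.swap (𝓝 (0 : ℂ × ℂ)) (𝓝 0) := Continuous.tendsto' (by fun_prop) _ _ rfl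
  filter_upwards [this.eventually h.2] with z hz
  rw [Function.comp, hz, ← Finset.sum_range_reflect]
  refine Finset.sum_congr rfl fun i hi => ?_
  have hi' := Finset.mem_range_succ_iff.1 hi
  have h1 : n + 1 - 1 - i = n - i := by omega
  have h2 : n - (n - i) = i := by omega
  simp only [Function.comp, h1, h2, Prod.fst_swap, Prod.snd_swap]
  ring

theorem HomogRep.eventually_fst_zero {A : ℂ × ℂ → ℂ} {n : ℕ} {a : ℕ → ℂ × ℂ → ℂ}
    (h : HomogRep A n a) : ∀ᶠ y in 𝓝 (0 : ℂ), A (0, y) = y ^ n * a n (0, y) := by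
  have : Tendsto (fun y : ℂ => ((0 : ℂ), y)) (𝓝 0) (𝓝 0) := Continuous.tendsto' (by fun_prop) _ _ rfl
  filter_upwards [this.eventually h.2] with y hy
  rw [hy, Finset.sum_range_succ, Finset.sum_eq_zero]
  · simp
  · intro i hi
    have : n - i ≠ 0 := by have := Finset.mem_range.1 hi; omega
    simp [this]

/-- By Hadamard's lemma each aᵢ is x bᵢ + y cᵢ; regrouping, the coefficient of x ^ (n + 1 - i) y ^ i
is bᵢ + cᵢ₋₁, with the missing terms at both ends set to 0. -/
theorem HomogRep.succ {A : ℂ × ℂ → ℂ} {n : ℕ} {a : ℕ → ℂ × ℂ → ℂ} (h : HomogRep A n a)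
    (h0 : ∀ i ≤ n, a i 0 = 0) : ∃ b, HomogRep A (n + 1) b := by
  have hd (i : ℕ) : ∃ b c : ℂ × ℂ → ℂ, AnalyticAt ℂ b 0 ∧ AnalyticAt ℂ c 0 ∧
      (i ≤ n → ∀ᶠ z in 𝓝 (0 : ℂ × ℂ), a i z = z.1 * b z + z.2 * c z) := by
    obtain ⟨c, hc, hac⟩ := exists_eq_add_snd_mul (h.1 i)
    have hp : AnalyticAt ℂ (fun z : ℂ × ℂ => a i (z.1, 0)) 0 := by
      refine AnalyticAt.fun_comp (g := a i) (f := fun z : ℂ × ℂ => (z.1, (0 : ℂ))) (h.1 i)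
        (analyticAt_fst.prod analyticAt_const)
    obtain ⟨b, hb, hab⟩ := exists_eq_add_fst_mul hp
    refine ⟨b, c, hb, hc, fun hi => ?_⟩
    filter_upwards [hac, hab] with z h1 h2
    have h3 : a i (0, 0) = 0 := h0 i hi
    rw [h1, h2, h3, zero_add]
  choose b c hb hc hbc using hd
  have hall : ∀ᶠ z in 𝓝 (0 : ℂ × ℂ), ∀ i ∈ Finset.range (n + 1), a i z = z.1 * b i z + z.2 * c i z :=
    (Finset.eventually_all _).2 fun i hi => hbc i (Finset.mem_range_succ_iff.1 hi)
  refine ⟨fun i z => (if i ≤ n then b i z else 0) + if i = 0 then 0 else c (i - 1) z,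
    fun i => ?_, ?_⟩
  · refine AnalyticAt.add ?_ ?_
    · split_ifs
      exacts [hb i, analyticAt_const]
    · split_ifs
      exacts [analyticAt_const, hc _]
  · filter_upwards [h.2, hall] with z h1 h2
    rw [h1]
    simp only [mul_add]
    rw [Finset.sum_add_distrib, Finset.sum_range_succ _ (n + 1),
      Finset.sum_range_succ' (fun i => z.1 ^ (n + 1 - i) * z.2 ^ i * ite (i = 0) _ _) (n + 1)]
    simp only [Nat.add_sub_cancel, if_true, mul_zero, add_zero, Nat.succ_ne_zero, if_false,
      Nat.not_succ_le_self]
    rw [← Finset.sum_add_distrib]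
    refine Finset.sum_congr rfl fun i hi => ?_
    have hi' := Finset.mem_range_succ_iff.1 hi
    rw [h2 i hi, if_pos hi', Nat.add_sub_add_right, Nat.sub_add_comm hi', pow_succ]
    ring

theorem homogRep_zero {A : ℂ × ℂ → ℂ} (hA : AnalyticAt ℂ A 0) : HomogRep A 0 fun _ => A :=
  ⟨fun _ => hA, Eventually.of_forall fun z => by simp⟩

/-- A holomorphic function that vanishes to infinite order at the origin vanishes near it. -/
theorem eventually_eq_zero_of_homogRep {A : ℂ × ℂ → ℂ} (hA : AnalyticAt ℂ A 0)
    (h : ∀ n, ∃ a, HomogRep A n a) : ∀ᶠ z in 𝓝 (0 : ℂ × ℂ), A z = 0 := by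
  obtain ⟨r, hr, hAr⟩ := Metric.eventually_nhds_iff.1 hA.eventually_analyticAt
  filter_upwards [Metric.ball_mem_nhds (0 : ℂ × ℂ) hr] with z hz
  have hz' : ‖z‖ < r := by simpa using hz
  rcases eq_or_ne z 0 with rfl | hz0
  · obtain ⟨a, ha⟩ := h 1
    rw [ha.2.self_of_nhds]
    simp [Finset.sum_range_succ]
  have hzp : 0 < ‖z‖ := norm_pos_iff.2 hz0
  -- On the complex line through z, the restriction of A is analytic on a disc containing the
  -- parameter 1; a zero of infinite order at 0 makes it vanish there.
  have hline : AnalyticOnNhd ℂ (fun s : ℂ => A (s • z)) (Metric.ball 0 (r / ‖z‖)) := fun s hs => by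
    have hs' : ‖s‖ < r / ‖z‖ := by simpa using hs
    have : dist (s • z) 0 < r := by
      rw [dist_zero_right, norm_smul]
      exact (lt_div_iff₀ hzp).1 hs'
    exact AnalyticAt.fun_comp (f := fun s : ℂ => s • z) (hAr this) (by fun_prop)
  have h0 : AnalyticAt ℂ (fun s : ℂ => A (s • z)) 0 :=
    hline 0 (Metric.mem_ball_self (by positivity))
  have htop : analyticOrderAt (fun s : ℂ => A (s • z)) 0 = ⊤ := by
    refine ENat.eq_top_iff_forall_ge.2 fun n => ?_
    obtain ⟨a, ha⟩ := h n
    refine (natCast_le_analyticOrderAt h0).2 ⟨fun s => ∑ i ∈ Finset.range (n + 1),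
      z.1 ^ (n - i) * z.2 ^ i * a i (s • z), ?_, ?_⟩
    · refine Finset.analyticAt_fun_sum _ fun i _ => analyticAt_const.mul ?_
      refine AnalyticAt.fun_comp (f := fun s : ℂ => s • z) ?_ (by fun_prop)
      rw [zero_smul]
      exact ha.1 i
    · have : Tendsto (fun s : ℂ => s • z) (𝓝 0) (𝓝 0) :=
        Continuous.tendsto' (by fun_prop) _ _ (by simp)
      filter_upwards [this.eventually ha.2] with s hs
      rw [hs, sub_zero, smul_eq_mul, Finset.mul_sum]
      refine Finset.sum_congr rfl fun i hi => ?_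
      have : s ^ n = s ^ (n - i) * s ^ i := by
        rw [← pow_add, Nat.sub_add_cancel (Finset.mem_range_succ_iff.1 hi)]
      rw [this]
      simp only [Prod.smul_fst, Prod.smul_snd, smul_eq_mul, mul_pow]
      ring
  have h1 := hline.eqOn_zero_of_preconnected_of_eventuallyEq_zero
    (convex_ball _ _).isPreconnected (Metric.mem_ball_self (by positivity))
    (analyticOrderAt_eq_top.1 htop)
  have h2 : (1 : ℂ) ∈ Metric.ball (0 : ℂ) (r / ‖z‖) := by
    simpa using (one_lt_div hzp).2 hz'
  simpa using h1 h2

/-- Leading forms of a pair of functions, with respect to the smaller of their orders. -/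
theorem exists_homogRep {A B : ℂ × ℂ → ℂ} (hA : AnalyticAt ℂ A 0) (hB : AnalyticAt ℂ B 0)
    (h : ¬ ((∀ᶠ z in 𝓝 (0 : ℂ × ℂ), A z = 0) ∧ ∀ᶠ z in 𝓝 (0 : ℂ × ℂ), B z = 0)) :
    ∃ n a b, HomogRep A n a ∧ HomogRep B n b ∧ (leadPoly n a ≠ 0 ∨ leadPoly n b ≠ 0) := by
  by_contra! hcon
  -- As long as both leading polynomials vanish, `HomogRep.succ` raises the order; if this never
  -- stopped, A and B would both be zero.
  have key : ∀ n, ∃ a b, HomogRep A n a ∧ HomogRep B n b := by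
    intro n
    induction n with
    | zero => exact ⟨_, _, homogRep_zero hA, homogRep_zero hB⟩
    | succ n ih =>
      obtain ⟨a, b, ha, hb⟩ := ih
      have h0 := hcon n a b ha hb
      have hz {c : ℕ → ℂ × ℂ → ℂ} (hc : leadPoly n c = 0) : ∀ i ≤ n, c i 0 = 0 := fun i hi => by
        have := coeff_leadPoly n c i
        rwa [hc, if_pos hi, Polynomial.coeff_zero, eq_comm] at this
      obtain ⟨a', ha'⟩ := ha.succ (hz h0.1)
      obtain ⟨b', hb'⟩ := hb.succ (hz h0.2)
      exact ⟨a', b', ha', hb'⟩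
  refine h ⟨eventually_eq_zero_of_homogRep hA fun n => ?_,
    eventually_eq_zero_of_homogRep hB fun n => ?_⟩
  · obtain ⟨a, _, ha, _⟩ := key n
    exact ⟨a, ha⟩
  · obtain ⟨_, b, _, hb⟩ := key n
    exact ⟨b, hb⟩

theorem exists_homogRep_single {A : ℂ × ℂ → ℂ} (hA : AnalyticAt ℂ A 0)
    (h : ¬ ∀ᶠ z in 𝓝 (0 : ℂ × ℂ), A z = 0) :
    ∃ n a, HomogRep A n a ∧ leadPoly n a ≠ 0 := by
  obtain ⟨n, a, b, ha, hb, hab⟩ := exists_homogRep hA hA fun h' => h h'.1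
  rcases hab with h | h
  exacts [⟨n, a, ha, h⟩, ⟨n, b, hb, h⟩]

theorem HasBlow.eventually_line_ne_zero {A : ℂ × ℂ → ℂ} {n : ℕ} {α : ℂ × ℂ → ℂ} {p : Polynomial ℂ}
    (h : HasBlow A n α p) {t : ℂ} (ht : p.eval t ≠ 0) :
    ∀ᶠ x in 𝓝[≠] (0 : ℂ), A (blowUp₁ (x, t)) ≠ 0 := by
  have hc : Tendsto (fun x : ℂ => (x, t)) (𝓝[≠] 0) (𝓝 (0, t)) :=
    (Continuous.tendsto' (by fun_prop) _ _ rfl).mono_left nhdsWithin_le_nhds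
  have hne : ∀ᶠ z in 𝓝 ((0 : ℂ), t), α z ≠ 0 :=
    (h.analyticAt t).continuousAt.eventually_ne (by rwa [h.eval])
  filter_upwards [hc.eventually (h.eq t), hc.eventually hne, self_mem_nhdsWithin] with x h1 h2 h3
  rw [h1]
  exact mul_ne_zero (pow_ne_zero _ h3) h2

/-- Germs of holomorphic functions form a domain. -/
theorem eventually_eq_zero_or_of_mul {A B : ℂ × ℂ → ℂ} (hA : AnalyticAt ℂ A 0)
    (hB : AnalyticAt ℂ B 0) (h : ∀ᶠ z in 𝓝 (0 : ℂ × ℂ), A z * B z = 0) :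
    (∀ᶠ z in 𝓝 (0 : ℂ × ℂ), A z = 0) ∨ ∀ᶠ z in 𝓝 (0 : ℂ × ℂ), B z = 0 := by
  by_contra hcon
  rw [not_or] at hcon
  obtain ⟨n, a, ha, ha0⟩ := exists_homogRep_single hA hcon.1
  obtain ⟨m, b, hb, hb0⟩ := exists_homogRep_single hB hcon.2
  -- A slope at which neither leading form vanishes: on the line y = t x both functions are nonzero
  -- near, but not at, the origin.
  obtain ⟨t, ht⟩ : ∃ t, (leadPoly n a * leadPoly m b).eval t ≠ 0 := by
    by_contra! h0
    exact mul_ne_zero ha0 hb0 (Polynomial.funext fun t => by simpa using h0 t)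
  rw [Polynomial.eval_mul] at ht
  have h1 := ha.hasBlow.eventually_line_ne_zero (left_ne_zero_of_mul ht)
  have h2 := hb.hasBlow.eventually_line_ne_zero (right_ne_zero_of_mul ht)
  have hc : Tendsto (fun x : ℂ => blowUp₁ (x, t)) (𝓝[≠] 0) (𝓝 0) :=
    (tendsto_blowUp₁ t).comp
      ((Continuous.tendsto' (by fun_prop) _ _ rfl).mono_left nhdsWithin_le_nhds)
  obtain ⟨x, ⟨h3, h4⟩, h5⟩ := ((h1.and h2).and (hc.eventually h)).exists
  exact mul_ne_zero h3 h4 h5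

/-! ### Holomorphic ordinary differential equations -/

/-- Existence of a holomorphic solution of `t' = F (x, t)`, `t 0 = 0`. -/
theorem exists_solution_explicit {F : ℂ × ℂ → ℂ} (hF : AnalyticAt ℂ F 0) :
    ∃ t : ℂ → ℂ, AnalyticAt ℂ t 0 ∧ t 0 = 0 ∧ ∀ᶠ x in 𝓝 (0 : ℂ), deriv t x = F (x, t x) := by
  obtain ⟨K, s, hs, hK⟩ := (hF.contDiffAt (n := 1)).exists_lipschitzOnWith
  obtain ⟨R, hR, hball⟩ := Metric.mem_nhds_iff.1
    (inter_mem (inter_mem hs hF.eventually_analyticAt)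
      (hF.continuousAt.norm.eventually_le_const (lt_add_one ‖F 0‖)))
  set M := ‖F 0‖ + 1 with hM
  have hM0 : 0 < M := by positivity
  -- The first two bounds keep the graphs of the iterates inside the ball of radius R; the last one
  -- makes the Picard operator contract by 1/2.
  obtain ⟨r, hr0, hrR, hrM, hrK⟩ : ∃ r : ℝ, 0 < r ∧ r < R ∧ M * r < R ∧ K * r ≤ 1 / 2 := by
    have h (c d : ℝ) (hd : 0 < d) : ∀ᶠ r in 𝓝[>] (0 : ℝ), c * r < d := by
      have : Tendsto (fun r : ℝ => c * r) (𝓝[>] 0) (𝓝 0) :=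
        (Continuous.tendsto' (by fun_prop) _ _ (by simp)).mono_left nhdsWithin_le_nhds
      exact this.eventually_lt_const hd
    obtain ⟨r, ⟨⟨h1, h2⟩, h3⟩, h4⟩ :=
      (((h 1 R hR).and (h M R hR)).and (h K (1 / 2) (by norm_num))).and self_mem_nhdsWithin |>.exists
    exact ⟨r, h4, by simpa using h1, h2, h3.le⟩
  let S : Set (ℂ → ℂ) := {φ | DifferentiableOn ℂ φ (Metric.ball 0 r) ∧ φ 0 = 0 ∧
    ∀ x ∈ Metric.ball (0 : ℂ) r, ‖φ x‖ ≤ M * r}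
  have hmem {φ} (hφ : φ ∈ S) {x} (hx : x ∈ Metric.ball (0 : ℂ) r) :
      (x, φ x) ∈ Metric.ball (0 : ℂ × ℂ) R := by
    have h1 : ‖x‖ < r := by simpa using hx
    rw [mem_ball_zero_iff, Prod.norm_def]
    exact max_lt (h1.trans hrR) ((hφ.2.2 x hx).trans_lt hrM)
  have h0r : (0 : ℂ) ∈ Metric.ball (0 : ℂ) r := Metric.mem_ball_self hr0
  -- The Picard operator: the primitive of x ↦ F (x, φ x) vanishing at 0, which exists because a
  -- disc has holomorphic primitives.
  have step (φ : S) : ∃ ψ : S, ∀ x ∈ Metric.ball (0 : ℂ) r, HasDerivAt ψ.1 (F (x, φ.1 x)) x := by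
    have hd : DifferentiableOn ℂ (fun x => F (x, φ.1 x)) (Metric.ball 0 r) := fun x hx => by
      have h1 : DifferentiableAt ℂ F (x, φ.1 x) := (hball (hmem φ.2 hx)).1.2.differentiableAt
      have h2 : DifferentiableAt ℂ φ.1 x := φ.2.1.differentiableAt (Metric.isOpen_ball.mem_nhds hx)
      exact (h1.comp x (differentiableAt_id.prodMk h2)).differentiableWithinAt
    obtain ⟨ψ, hψ0, hψ⟩ := hd.isExactOn_ball.with_val_at 0 0
    refine ⟨⟨ψ, fun x hx => (hψ x hx).differentiableAt.differentiableWithinAt, hψ0, fun x hx => ?_⟩, hψ⟩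
    have h := (convex_ball (0 : ℂ) r).norm_image_sub_le_of_norm_hasDerivWithin_le (C := M)
      (fun y hy => (hψ y hy).hasDerivWithinAt) (fun y hy => (hball (hmem φ.2 hy)).2) h0r hx
    rw [hψ0, sub_zero, sub_zero] at h
    have h1 : ‖x‖ < r := by simpa using hx
    exact h.trans (by gcongr)
  choose T hT using step
  let φ₀ : S := ⟨fun _ => 0, differentiableOn_const _, rfl, fun x _ => by
    rw [norm_zero]; positivity⟩
  let φ : ℕ → S := fun n => T^[n] φ₀
  have hφ (n : ℕ) : φ (n + 1) = T (φ n) := Function.iterate_succ_apply' T n φ₀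
  have hgeo (n : ℕ) : ∀ x ∈ Metric.ball (0 : ℂ) r,
      dist ((φ n).1 x) ((φ (n + 1)).1 x) ≤ 2 * (M * r) * (1 / 2) ^ n := by
    induction n with
    | zero =>
      intro x hx
      rw [dist_eq_norm, pow_zero, mul_one]
      exact (norm_sub_le _ _).trans (by
        linarith [(φ 0).2.2.2 x hx, (φ (0 + 1)).2.2.2 x hx])
    | succ n ih =>
      intro x hx
      have hd : ∀ y ∈ Metric.ball (0 : ℂ) r, HasDerivAt (fun y => (φ (n + 1)).1 y - (φ (n + 2)).1 y)
          (F (y, (φ n).1 y) - F (y, (φ (n + 1)).1 y)) y := fun y hy => by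
        rw [hφ (n + 1), hφ n]
        have := hT (T (φ n)) y hy
        exact (hT (φ n) y hy).sub this
      have h := (convex_ball (0 : ℂ) r).norm_image_sub_le_of_norm_hasDerivWithin_le
        (C := K * (2 * (M * r) * (1 / 2) ^ n))
        (fun y hy => (hd y hy).hasDerivWithinAt) (fun y hy => ?_) h0r hx
      · have e1 := (φ (n + 1)).2.2.1
        have e2 := (φ (n + 2)).2.2.1
        have h1 : ‖x‖ < r := by simpa using hx
        simp only [e1, e2, sub_zero] at h
        rw [dist_eq_norm]
        refine h.trans ?_
        calc K * (2 * (M * r) * (1 / 2) ^ n) * ‖x‖ ≤ K * (2 * (M * r) * (1 / 2) ^ n) * r := by gcongr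
          _ = K * r * (2 * (M * r) * (1 / 2) ^ n) := by ring
          _ ≤ 1 / 2 * (2 * (M * r) * (1 / 2) ^ n) := by gcongr
          _ = _ := by ring
      · have h1 := hK.dist_le_mul _ (hball (hmem (φ n).2 hy)).1.1 _ (hball (hmem (φ (n + 1)).2 hy)).1.1
        rw [← dist_eq_norm]
        refine h1.trans (mul_le_mul_of_nonneg_left ?_ K.2)
        rw [Prod.dist_eq, dist_self]
        exact max_le (by positivity) (ih y hy)
  have hlim (x : ℂ) : ∃ y, x ∈ Metric.ball (0 : ℂ) r → Tendsto (fun n => (φ n).1 x) atTop (𝓝 y) := by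
    by_cases hx : x ∈ Metric.ball (0 : ℂ) r
    · obtain ⟨y, hy⟩ := cauchySeq_tendsto_of_complete
        (cauchySeq_of_le_geometric (1 / 2) (2 * (M * r)) (by norm_num) fun n => hgeo n x hx)
      exact ⟨y, fun _ => hy⟩
    · exact ⟨0, fun h => absurd h hx⟩
  choose t ht using hlim
  have hunif : TendstoUniformlyOn (fun n => (φ n).1) t atTop (Metric.ball 0 r) := by
    rw [Metric.tendstoUniformlyOn_iff]
    intro ε hε
    have : Tendsto (fun n : ℕ => 2 * (M * r) * (1 / 2 : ℝ) ^ n / (1 - 1 / 2)) atTop (𝓝 0) := by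
      have := ((tendsto_pow_atTop_nhds_zero_of_lt_one (r := (1 / 2 : ℝ)) (by norm_num)
        (by norm_num)).const_mul (2 * (M * r))).div_const (1 - 1 / 2)
      simpa using this
    filter_upwards [this.eventually_lt_const hε] with n hn x hx
    rw [dist_comm]
    exact (dist_le_of_le_geometric_of_tendsto (1 / 2) (2 * (M * r)) (by norm_num)
      (fun n => hgeo n x hx) (ht x hx) n).trans_lt hn
  have hdn : ∀ᶠ n in atTop, DifferentiableOn ℂ (φ n).1 (Metric.ball 0 r) :=
    Eventually.of_forall fun n => (φ n).2.1
  -- Weierstrass: the uniform limit is holomorphic and the derivatives converge as well, so the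
  -- equation passes to the limit.
  have hdiff : DifferentiableOn ℂ t (Metric.ball 0 r) :=
    hunif.tendstoLocallyUniformlyOn.differentiableOn hdn Metric.isOpen_ball
  have hder := hunif.tendstoLocallyUniformlyOn.deriv hdn Metric.isOpen_ball
  refine ⟨t, hdiff.analyticAt (Metric.ball_mem_nhds _ hr0),
    tendsto_nhds_unique (ht 0 h0r) (tendsto_const_nhds.congr fun n => (φ n).2.2.1.symm), ?_⟩
  filter_upwards [Metric.ball_mem_nhds (0 : ℂ) hr0] with x hx
  have h1 : Tendsto (fun n => deriv (φ (n + 1)).1 x) atTop (𝓝 (deriv t x)) :=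
    (hder.tendsto_at hx).comp (tendsto_add_atTop_nat 1)
  have h2 (n : ℕ) : deriv (φ (n + 1)).1 x = F (x, (φ n).1 x) := by
    rw [hφ]
    exact (hT (φ n) x hx).deriv
  simp only [h2] at h1
  have htx : ‖t x‖ ≤ M * r :=
    le_of_tendsto (ht x hx).norm (Eventually.of_forall fun n => (φ n).2.2.2 x hx)
  have htb : (x, t x) ∈ Metric.ball (0 : ℂ × ℂ) R := by
    have h1 : ‖x‖ < r := by simpa using hx
    rw [mem_ball_zero_iff, Prod.norm_def]
    exact max_lt (h1.trans hrR) (htx.trans_lt hrM)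
  have h3 : Tendsto (fun n => F (x, (φ n).1 x)) atTop (𝓝 (F (x, t x))) :=
    ((hball htb).1.2.continuousAt.tendsto).comp (tendsto_const_nhds.prodMk_nhds (ht x hx))
  exact tendsto_nhds_unique h1 h3

/-! ### Smooth solutions of a singular differential equation -/

/-- Serves to cancel powers of the variable: divide away from 0, then extend by continuity. -/
theorem eventually_of_punctured {f : ℂ → ℂ} (hf : ContinuousAt f 0)
    (h : ∀ᶠ x in 𝓝[≠] (0 : ℂ), f x = 0) : ∀ᶠ x in 𝓝 (0 : ℂ), f x = 0 := by
  have h0 : f 0 = 0 := tendsto_nhds_unique (hf.tendsto.mono_left nhdsWithin_le_nhds)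
    (tendsto_const_nhds.congr' (h.mono fun x hx => hx.symm))
  filter_upwards [eventually_nhdsWithin_iff.1 h] with x hx
  rcases eq_or_ne x 0 with rfl | h1
  exacts [h0, hx h1]

theorem analyticAt_comp_graph {F : ℂ × ℂ → ℂ} {u y : ℂ → ℂ} {c : ℂ × ℂ} (hF : AnalyticAt ℂ F c)
    (hu : AnalyticAt ℂ u 0) (hy : AnalyticAt ℂ y 0) (hc : (u 0, y 0) = c) :
    AnalyticAt ℂ (fun x => F (u x, y x)) 0 :=
  AnalyticAt.fun_comp (f := fun x => (u x, y x)) (by rwa [hc]) (hu.prod hy)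

theorem tendsto_graph {u y : ℂ → ℂ} {c : ℂ × ℂ} (hu : AnalyticAt ℂ u 0) (hy : AnalyticAt ℂ y 0)
    (hc : (u 0, y 0) = c) : Tendsto (fun x => (u x, y x)) (𝓝 0) (𝓝 c) := by
  rw [← hc]
  exact hu.continuousAt.tendsto.prodMk_nhds hy.continuousAt.tendsto

theorem analyticAt_translate {F : ℂ × ℂ → ℂ} {l : ℂ} (hF : AnalyticAt ℂ F (0, l)) :
    AnalyticAt ℂ (fun z : ℂ × ℂ => F (z.1, l + z.2)) 0 := by
  refine AnalyticAt.fun_comp (f := fun z : ℂ × ℂ => (z.1, l + z.2)) ?_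
    (analyticAt_fst.prod (analyticAt_const.add analyticAt_snd))
  simpa using hF

/-- `y` is a germ of holomorphic solution of `A (x, y) + B (x, y) y' = 0` through the origin. -/
def IsSol (A B : ℂ × ℂ → ℂ) (y : ℂ → ℂ) : Prop :=
  AnalyticAt ℂ y 0 ∧ y 0 = 0 ∧ ∀ᶠ x in 𝓝 (0 : ℂ), A (x, y x) + B (x, y x) * deriv y x = 0

/-- The equation `A (x, y) + B (x, y) y' = 0` has infinitely many solution germs at the origin. -/
def ManySols (A B : ℂ × ℂ → ℂ) : Prop :=
  ∃ y : ℕ → ℂ → ℂ, (∀ i, IsSol A B (y i)) ∧ ∀ i j, i ≠ j → ¬ y i =ᶠ[𝓝 0] y j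

/-- The coefficient of `dx` in the blow-up of `A dx + B dy`, recentered at `(0, l)`. -/
def blowA (α β : ℂ × ℂ → ℂ) (l : ℂ) (z : ℂ × ℂ) : ℂ :=
  α (z.1, l + z.2) + (l + z.2) * β (z.1, l + z.2)

/-- The coefficient of `dt` in the blow-up of `A dx + B dy`, recentered at `(0, l)`. -/
def blowB (β : ℂ × ℂ → ℂ) (l : ℂ) (z : ℂ × ℂ) : ℂ := z.1 * β (z.1, l + z.2)

/-! ### One blow-up of a differential equation. -/

section

variable {A B α β : ℂ × ℂ → ℂ} {n : ℕ} {p q : Polynomial ℂ}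

theorem HasBlow.analyticAt_blowA (hA : HasBlow A n α p) (hB : HasBlow B n β q) (l : ℂ) :
    AnalyticAt ℂ (blowA α β l) 0 :=
  (analyticAt_translate (hA.analyticAt l)).add
    ((analyticAt_const.add analyticAt_snd).mul (analyticAt_translate (hB.analyticAt l)))

theorem HasBlow.analyticAt_blowB (hB : HasBlow B n β q) (l : ℂ) :
    AnalyticAt ℂ (blowB β l) 0 :=
  analyticAt_fst.mul (analyticAt_translate (hB.analyticAt l))

theorem HasBlow.blowA_fst_zero (hA : HasBlow A n α p) (hB : HasBlow B n β q) (l s : ℂ) :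
    blowA α β l (0, s) = (p + Polynomial.X * q).eval (l + s) := by
  simp [blowA, hA.eval, hB.eval]

/-- This is σ*ω = x ^ n (`blowA` dx + `blowB` dt), restricted to the graph of s. -/
theorem blow_identity (hA : HasBlow A n α p) (hB : HasBlow B n β q) {l : ℂ} {s : ℂ → ℂ}
    (hs : AnalyticAt ℂ s 0) (hs0 : s 0 = 0) :
    ∀ᶠ x in 𝓝 (0 : ℂ), A (x, (l + s x) * x) +
      B (x, (l + s x) * x) * deriv (fun x => (l + s x) * x) x =
        x ^ n * (blowA α β l (x, s x) + blowB β l (x, s x) * deriv s x) := by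
  have ht := tendsto_graph (c := (0, l)) (y := fun x => l + s x) analyticAt_id
    (analyticAt_const.add hs) (by simp [hs0])
  filter_upwards [ht.eventually (hA.eq l), ht.eventually (hB.eq l),
    hs.eventually_analyticAt] with x h1 h2 h3
  have hd : deriv (fun x => (l + s x) * x) x = deriv s x * x + (l + s x) := by
    have := ((h3.differentiableAt.hasDerivAt).const_add l).fun_mul (hasDerivAt_id' x)
    simpa using this.deriv
  simp only [blowUp₁, id] at h1 h2
  rw [h1, h2, hd]
  simp only [blowA, blowB]
  ring

theorem IsSol.of_blow (hA : HasBlow A n α p) (hB : HasBlow B n β q) {l : ℂ} {s : ℂ → ℂ}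
    (h : IsSol (blowA α β l) (blowB β l) s) : IsSol A B fun x => (l + s x) * x := by
  refine ⟨(analyticAt_const.add h.1).mul analyticAt_id, by simp, ?_⟩
  filter_upwards [blow_identity hA hB h.1 h.2.1, h.2.2] with x h1 h2
  rw [h1, h2, mul_zero]

/-- Guarantees that distinct solutions at one point of the divisor, or solutions at distinct points,
stay distinct after blowing down. -/
theorem eq_of_blow_eq {l m : ℂ} {s t : ℂ → ℂ} (hs : AnalyticAt ℂ s 0) (ht : AnalyticAt ℂ t 0)
    (hs0 : s 0 = 0) (ht0 : t 0 = 0)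
    (h : (fun x => (l + s x) * x) =ᶠ[𝓝 0] fun x => (m + t x) * x) : l = m ∧ s =ᶠ[𝓝 0] t := by
  have h1 : ∀ᶠ x in 𝓝 (0 : ℂ), (l + s x) - (m + t x) = 0 := by
    refine eventually_of_punctured ?_ ?_
    · exact ((analyticAt_const.add hs).sub (analyticAt_const.add ht)).continuousAt
    · filter_upwards [h.filter_mono nhdsWithin_le_nhds, self_mem_nhdsWithin] with x hx hx0
      exact sub_eq_zero.2 (mul_right_cancel₀ hx0 hx)
  have h2 : l = m := by
    have := h1.self_of_nhds
    rwa [hs0, ht0, add_zero, add_zero, sub_eq_zero] at this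
  refine ⟨h2, h1.mono fun x hx => ?_⟩
  rw [h2] at hx
  linear_combination hx

theorem ManySols.of_blow (hA : HasBlow A n α p) (hB : HasBlow B n β q) {l : ℂ}
    (h : ManySols (blowA α β l) (blowB β l)) : ManySols A B := by
  obtain ⟨s, hs, hne⟩ := h
  exact ⟨_, fun i => (hs i).of_blow hA hB, fun i j hij he =>
    hne i j hij (eq_of_blow_eq (hs i).1 (hs j).1 (hs i).2.1 (hs j).2.1 he).2⟩

theorem exists_blow_of_analyticAt {y : ℂ → ℂ} (hy : AnalyticAt ℂ y 0) (hy0 : y 0 = 0) :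
    ∃ (l : ℂ) (s : ℂ → ℂ), AnalyticAt ℂ s 0 ∧ s 0 = 0 ∧ y =ᶠ[𝓝 0] fun x => (l + s x) * x := by
  have h1 : ((1 : ℕ) : ℕ∞) ≤ analyticOrderAt y 0 := by
    rw [Nat.cast_one]
    exact Order.one_le_iff_ne_zero.2 (hy.analyticOrderAt_ne_zero.2 hy0)
  obtain ⟨g, hg, he⟩ := (natCast_le_analyticOrderAt hy).1 h1
  refine ⟨g 0, fun x => g x - g 0, hg.sub analyticAt_const, sub_self _, ?_⟩
  filter_upwards [he] with x hx
  rw [hx]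
  simp only [sub_zero, pow_one, smul_eq_mul]
  ring

theorem isSol_congr {y z : ℂ → ℂ} (h : IsSol A B y) (hyz : y =ᶠ[𝓝 0] z) : IsSol A B z := by
  refine ⟨h.1.congr hyz, hyz.self_of_nhds ▸ h.2.1, ?_⟩
  filter_upwards [h.2.2, hyz, hyz.deriv] with x h1 h2 h3
  rwa [← h2, ← h3]

/-- The number l is the slope of y at the origin. The factor x ^ n of `blow_identity` is cancelled
off 0. -/
theorem IsSol.exists_blow (hA : HasBlow A n α p) (hB : HasBlow B n β q) {y : ℂ → ℂ}
    (h : IsSol A B y) :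
    ∃ (l : ℂ) (s : ℂ → ℂ), IsSol (blowA α β l) (blowB β l) s ∧
      y =ᶠ[𝓝 0] fun x => (l + s x) * x := by
  obtain ⟨l, s, hs, hs0, he⟩ := exists_blow_of_analyticAt h.1 h.2.1
  refine ⟨l, s, ⟨hs, hs0, eventually_of_punctured ?_ ?_⟩, he⟩
  · have hc : ((0 : ℂ), s 0) = 0 := by rw [hs0]; rfl
    exact ((analyticAt_comp_graph (hA.analyticAt_blowA hB l) analyticAt_id hs hc).add
      ((analyticAt_comp_graph (hB.analyticAt_blowB l) analyticAt_id hs hc).mul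
        hs.deriv)).continuousAt
  · filter_upwards [(blow_identity hA hB (l := l) hs hs0).filter_mono nhdsWithin_le_nhds,
      (isSol_congr h he).2.2.filter_mono nhdsWithin_le_nhds, self_mem_nhdsWithin] with x h1 h2 h3
    rw [h1] at h2
    exact (mul_eq_zero.1 h2).resolve_left (pow_ne_zero _ h3)

/-- A dicritical blow-up produces infinitely many solutions. -/
theorem manySols_of_dicritical (hA : HasBlow A n α p) (hB : HasBlow B n β q) (hq : q ≠ 0)
    (hpq : p + Polynomial.X * q = 0) : ManySols A B := by
  have hinf : {l : ℂ | q.eval l ≠ 0}.Infinite := by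
    have : {l : ℂ | q.eval l = 0}.Finite := Polynomial.finite_setOfPred_isRoot hq
    exact this.infinite_compl
  have key (l : ℂ) (hl : q.eval l ≠ 0) : ∃ s, IsSol (blowA α β l) (blowB β l) s := by
    have ha := hA.analyticAt_blowA hB l
    -- As the tangent cone is zero, x divides both coefficients. The quotient equation g + β s' = 0
    -- can be solved for s' at l, where β does not vanish.
    obtain ⟨g, hg, hag⟩ := exists_eq_add_fst_mul ha
    have hb := analyticAt_translate (hB.analyticAt l)
    have hb0 : (fun z : ℂ × ℂ => β (z.1, l + z.2)) 0 ≠ 0 := by simpa [hB.eval] using hl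
    obtain ⟨s, hs, hs0, hode⟩ := exists_solution_explicit (hg.neg.div hb hb0)
    refine ⟨s, hs, hs0, ?_⟩
    have ht := tendsto_graph (c := 0) analyticAt_id hs (by simp [hs0])
    filter_upwards [hode, ht.eventually hag, ht.eventually (hb.continuousAt.eventually_ne hb0)]
      with x h1 h2 h3
    simp only [hA.blowA_fst_zero hB, hpq, Polynomial.eval_zero, zero_add, id] at h2 h3
    simp only [h1, h2, blowB, Pi.div_apply, Pi.neg_apply]
    field_simp
    ring
  choose! s hs using key
  let e := hinf.natEmbedding
  refine ⟨fun i x => (e i + s (e i) x) * x, fun i => (hs _ (e i).2).of_blow hA hB,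
    fun i j hij he => hij ?_⟩
  have := (eq_of_blow_eq (hs _ (e i).2).1 (hs _ (e j).2).1 (hs _ (e i).2).2.1 (hs _ (e j).2).2.1 he).1
  exact e.injective (Subtype.ext this)

end

/-! ### Counting the smooth solutions. -/

theorem analyticOrderAt_eval_add {q : Polynomial ℂ} (hq : q ≠ 0) (l : ℂ) :
    analyticOrderAt (fun s : ℂ => q.eval (l + s)) 0 = q.rootMultiplicity l := by
  obtain ⟨r, hr, hdvd⟩ := Polynomial.exists_eq_pow_rootMultiplicity_mul_and_not_dvd q hq l
  have han (r : Polynomial ℂ) : AnalyticAt ℂ (fun s : ℂ => r.eval (l + s)) 0 :=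
    AnalyticAt.aeval_polynomial (analyticAt_const.add analyticAt_id) r
  refine ((han q).analyticOrderAt_eq_natCast).2 ⟨fun s => r.eval (l + s), han r, ?_, ?_⟩
  · simpa [Polynomial.dvd_iff_isRoot] using hdvd
  · refine Eventually.of_forall fun s => ?_
    conv_lhs => rw [hr]
    simp

theorem sum_rootMultiplicity_le (q : Polynomial ℂ) (S : Finset ℂ) :
    ∑ l ∈ S, q.rootMultiplicity l ≤ q.natDegree := by
  simp only [← Polynomial.count_roots]
  refine le_trans ?_ q.card_roots'
  rw [← Multiset.toFinset_sum_count_eq, ← Finset.sum_filter_of_ne (p := (· ∈ q.roots.toFinset))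
    (fun l _ hl => Multiset.mem_toFinset.2 (Multiset.count_ne_zero.1 hl))]
  exact Finset.sum_le_sum_of_subset fun l hl => (Finset.mem_filter.1 hl).2

/-- The number of solutions is bounded by the order of `A (0, ·)`, unless it is infinite. -/
theorem manySols_or_card_le {ι : Type*} (K : ℕ) : ∀ {A B : ℂ × ℂ → ℂ}, AnalyticAt ℂ A 0 →
    AnalyticAt ℂ B 0 → (∀ᶠ y in 𝓝 (0 : ℂ), B (0, y) = 0) → ∀ (T : Finset ι) (y : ι → ℂ → ℂ),
    (∀ i ∈ T, IsSol A B (y i)) →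
    (∀ i ∈ T, ∀ j ∈ T, i ≠ j → analyticOrderAt (fun x => y i x - y j x) 0 ≤ K) →
    ManySols A B ∨ (T.card : ℕ∞) ≤ analyticOrderAt (fun y => A (0, y)) 0 := by
  classical
  induction K with
  | zero =>
    intro A B hA hB hB0 T y hy hT
    right
    -- All solutions vanish at 0, so two of them always have contact at least 1. A single one forces
    -- A (0, 0) = 0, as B (0, 0) = 0.
    have hcard : T.card ≤ 1 := Finset.card_le_one.2 fun i hi j hj => by
      by_contra hij
      have h := hT i hi j hj hij
      rw [Nat.cast_zero, nonpos_iff_eq_zero,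
        ((hy i hi).1.fun_sub (hy j hj).1).analyticOrderAt_eq_zero] at h
      exact h (by simp [(hy i hi).2.1, (hy j hj).2.1])
    rcases T.eq_empty_or_nonempty with rfl | ⟨i, hi⟩
    · simp
    have h := (hy i hi).2.2.self_of_nhds
    rw [(hy i hi).2.1, hB0.self_of_nhds, zero_mul, add_zero] at h
    have hA' : AnalyticAt ℂ (fun y => A (0, y)) 0 :=
      analyticAt_comp_graph hA analyticAt_const analyticAt_id rfl
    refine (Nat.cast_le.2 hcard).trans ?_
    rw [Nat.cast_one]
    exact Order.one_le_iff_ne_zero.2 (hA'.analyticOrderAt_ne_zero.2 h)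
  | succ K ih =>
    intro A B hA hB hB0 T y hy hT
    by_cases hz : ∀ᶠ z in 𝓝 (0 : ℂ × ℂ), A z = 0
    · right
      have ht := tendsto_graph (c := 0) (y := fun y => y) (analyticAt_const (v := 0))
        analyticAt_id rfl
      rw [analyticOrderAt_eq_top.2 (ht.eventually hz)]
      exact le_top
    obtain ⟨n, a, b, ha, hb, hab⟩ := exists_homogRep hA hB fun h => hz h.1
    set p := leadPoly n a
    set q := leadPoly n b
    obtain ⟨α, hA'⟩ : ∃ α, HasBlow A n α p := ⟨_, ha.hasBlow⟩
    obtain ⟨β, hB'⟩ : ∃ β, HasBlow B n β q := ⟨_, hb.hasBlow⟩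
    by_cases hpq : p + Polynomial.X * q = 0
    · left
      refine manySols_of_dicritical hA' hB' (fun hq => ?_) hpq
      rw [hq, mul_zero, add_zero] at hpq
      exact hab.elim (fun h => h hpq) fun h => h hq
    -- B vanishes on the axis x = 0, so its leading form has no term y ^ n. This lowers the degree
    -- bound of the tangent cone from n + 1 to n, which the count below needs.
    have hqn : q.coeff n = 0 := by
      rw [coeff_leadPoly, if_pos le_rfl]
      have h1 : ∀ᶠ y in 𝓝 (0 : ℂ), b n (0, y) = 0 := by
        refine eventually_of_punctured (analyticAt_comp_graph (hb.1 n) analyticAt_const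
          analyticAt_id rfl).continuousAt ?_
        filter_upwards [hb.eventually_fst_zero.filter_mono nhdsWithin_le_nhds,
          hB0.filter_mono nhdsWithin_le_nhds, self_mem_nhdsWithin] with y h1 h2 h3
        rw [h2, eq_comm] at h1
        exact (mul_eq_zero.1 h1).resolve_left (pow_ne_zero _ h3)
      exact h1.self_of_nhds
    have hdeg : (p + Polynomial.X * q).natDegree ≤ n := by
      refine Polynomial.natDegree_le_iff_coeff_eq_zero.2 fun i hi => ?_
      obtain ⟨j, rfl⟩ := Nat.exists_eq_add_of_lt hi
      rw [Polynomial.coeff_add, Polynomial.coeff_X_mul,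
        Polynomial.coeff_eq_zero_of_natDegree_lt (hA'.natDegree_le.trans_lt hi), zero_add]
      rcases Nat.eq_zero_or_pos j with rfl | hj
      · exact hqn
      · exact Polynomial.coeff_eq_zero_of_natDegree_lt (hB'.natDegree_le.trans_lt (by omega))
    have hord : (n : ℕ∞) ≤ analyticOrderAt (fun y => A (0, y)) 0 :=
      (natCast_le_analyticOrderAt
        (analyticAt_comp_graph hA analyticAt_const analyticAt_id rfl)).2
        ⟨fun y => a n (0, y), analyticAt_comp_graph (ha.1 n) analyticAt_const analyticAt_id rfl, by
          simpa using ha.eventually_fst_zero⟩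
    by_cases hmany : ManySols A B
    · exact Or.inl hmany
    right
    have hex (i : ι) : ∃ (l : ℂ) (s : ℂ → ℂ), i ∈ T → IsSol (blowA α β l) (blowB β l) s ∧
        y i =ᶠ[𝓝 0] fun x => (l + s x) * x := by
      by_cases hi : i ∈ T
      · obtain ⟨l, s, h⟩ := (hy i hi).exists_blow hA' hB'
        exact ⟨l, s, fun _ => h⟩
      · exact ⟨0, 0, fun h => absurd h hi⟩
    choose l s hs using hex
    -- Solutions of common slope m lose one order of contact after the blow-up. The new equation
    -- again has B zero on the vertical axis, and its A has order there the multiplicity of the root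
    -- m.
    have hloc (m : ℂ) : {i ∈ T | l i = m}.card ≤ (p + Polynomial.X * q).rootMultiplicity m := by
      have h := ih (hA'.analyticAt_blowA hB' m) (hB'.analyticAt_blowB m)
        (Eventually.of_forall fun y => by simp [blowB]) {i ∈ T | l i = m} s ?_ ?_
      · have h := h.resolve_left fun h => hmany (h.of_blow hA' hB')
        simp only [hA'.blowA_fst_zero hB', analyticOrderAt_eval_add hpq] at h
        exact_mod_cast h
      · intro i hi
        obtain ⟨hi, hi'⟩ := Finset.mem_filter.1 hi
        exact hi' ▸ (hs i hi).1
      · intro i hi j hj hij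
        obtain ⟨hi, hi'⟩ := Finset.mem_filter.1 hi
        obtain ⟨hj, hj'⟩ := Finset.mem_filter.1 hj
        have h := hT i hi j hj hij
        have he : (fun x => y i x - y j x) =ᶠ[𝓝 0] id * fun x => s i x - s j x := by
          filter_upwards [(hs i hi).2, (hs j hj).2] with x h1 h2
          rw [h1, h2, hi', hj']
          simp only [Pi.mul_apply, id]
          ring
        rw [analyticOrderAt_congr he, analyticOrderAt_mul analyticAt_id
          ((hs i hi).1.1.fun_sub (hs j hj).1.1), analyticOrderAt_id, Nat.cast_add, Nat.cast_one,
          add_comm] at h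
        exact (ENat.add_le_add_iff_right (by simp)).1 h
    calc (T.card : ℕ∞) = ((∑ m ∈ T.image l, {i ∈ T | l i = m}.card : ℕ) : ℕ∞) := by
          rw [← Finset.card_eq_sum_card_image]
      _ ≤ n := by
          refine Nat.cast_le.2 ((Finset.sum_le_sum fun m _ => hloc m).trans ?_)
          exact (sum_rootMultiplicity_le _ _).trans hdeg
      _ ≤ _ := hord

/-! ### Puiseux's theorem -/

theorem eventually_curry {P : ℂ × ℂ → Prop} (h : ∀ᶠ z in 𝓝 (0 : ℂ × ℂ), P z) :
    ∀ᶠ x in 𝓝 (0 : ℂ), ∀ᶠ y in 𝓝 (0 : ℂ), P (x, y) := by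
  have h' : ∀ᶠ z in 𝓝 (0 : ℂ) ×ˢ 𝓝 (0 : ℂ), P z := by rwa [← nhds_prod_eq]
  exact h'.curry

theorem eventually_fst {P : ℂ → Prop} (h : ∀ᶠ x in 𝓝 (0 : ℂ), P x) :
    ∀ᶠ z in 𝓝 (0 : ℂ × ℂ), P z.1 :=
  (Continuous.tendsto' (by fun_prop) (0 : ℂ × ℂ) (0 : ℂ) rfl :
    Tendsto Prod.fst (𝓝 (0 : ℂ × ℂ)) (𝓝 (0 : ℂ))).eventually h

theorem eventually_snd_axis {P : ℂ × ℂ → Prop} (h : ∀ᶠ z in 𝓝 (0 : ℂ × ℂ), P z) :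
    ∀ᶠ y in 𝓝 (0 : ℂ), P (0, y) :=
  (Continuous.tendsto' (by fun_prop) (0 : ℂ) (0 : ℂ × ℂ) rfl :
    Tendsto (fun y : ℂ => ((0 : ℂ), y)) (𝓝 0) (𝓝 0)).eventually h

theorem analyticAt_fst_comp {h : ℂ → ℂ} (hh : AnalyticAt ℂ h 0) :
    AnalyticAt ℂ (fun z : ℂ × ℂ => h z.1) 0 :=
  AnalyticAt.fun_comp (f := fun z : ℂ × ℂ => z.1) hh analyticAt_fst

theorem analyticAt_snd_axis {f : ℂ × ℂ → ℂ} (hf : AnalyticAt ℂ f 0) :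
    AnalyticAt ℂ (fun y => f (0, y)) 0 :=
  analyticAt_comp_graph hf analyticAt_const analyticAt_id rfl

/-- Recentering along the graph of `φ`. -/
theorem analyticAt_shear {f : ℂ × ℂ → ℂ} (hf : AnalyticAt ℂ f 0) {φ : ℂ → ℂ}
    (hφ : AnalyticAt ℂ φ 0) (hφ0 : φ 0 = 0) :
    AnalyticAt ℂ (fun z : ℂ × ℂ => f (z.1, φ z.1 + z.2)) 0 := by
  refine AnalyticAt.fun_comp (f := fun z : ℂ × ℂ => (z.1, φ z.1 + z.2)) ?_
    (analyticAt_fst.prod ((analyticAt_fst_comp hφ).add analyticAt_snd))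
  have h0 : ((0 : ℂ × ℂ).1, φ (0 : ℂ × ℂ).1 + (0 : ℂ × ℂ).2) = 0 := by ext <;> simp [hφ0]
  rwa [h0]

theorem tendsto_shear {φ : ℂ → ℂ} (hφ : AnalyticAt ℂ φ 0) (hφ0 : φ 0 = 0) :
    Tendsto (fun z : ℂ × ℂ => (z.1, φ z.1 + z.2)) (𝓝 0) (𝓝 0) := by
  have h := (analyticAt_fst.prod ((analyticAt_fst_comp hφ).add
    (analyticAt_snd (p := (0 : ℂ × ℂ))))).continuousAt.tendsto
  have h0 : ((0 : ℂ × ℂ).1, φ (0 : ℂ × ℂ).1 + (0 : ℂ × ℂ).2) = 0 := by ext <;> simp [hφ0]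
  exact Eq.subst (motive := fun p => Tendsto (fun z : ℂ × ℂ => (z.1, φ z.1 + z.2)) (𝓝 0) (𝓝 p)) h0 h

/-- Ramification of the first coordinate. -/
theorem analyticAt_ramify {f : ℂ × ℂ → ℂ} (hf : AnalyticAt ℂ f 0) {N : ℕ} (hN : N ≠ 0) :
    AnalyticAt ℂ (fun z : ℂ × ℂ => f (z.1 ^ N, z.2)) 0 := by
  refine AnalyticAt.fun_comp (f := fun z : ℂ × ℂ => (z.1 ^ N, z.2)) ?_
    ((analyticAt_fst.pow N).prod analyticAt_snd)
  have h0 : ((0 : ℂ × ℂ).1 ^ N, (0 : ℂ × ℂ).2) = 0 := by ext <;> simp [hN]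
  rwa [h0]

theorem tendsto_ramify {N : ℕ} (hN : N ≠ 0) :
    Tendsto (fun z : ℂ × ℂ => (z.1 ^ N, z.2)) (𝓝 0) (𝓝 0) :=
  Continuous.tendsto' (by fun_prop) _ _ (by simp [hN])

theorem tendsto_pow_zero {N : ℕ} (hN : N ≠ 0) : Tendsto (fun u : ℂ => u ^ N) (𝓝 0) (𝓝 0) :=
  Continuous.tendsto' (by fun_prop) _ _ (by simp [hN])

theorem analyticAt_comp_pow {h : ℂ → ℂ} (hh : AnalyticAt ℂ h 0) {N : ℕ} (hN : N ≠ 0) :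
    AnalyticAt ℂ (fun u => h (u ^ N)) 0 :=
  AnalyticAt.fun_comp (f := fun u : ℂ => u ^ N) (by simpa [hN] using hh) (analyticAt_id.pow N)

/-- A function vanishing along the graph of `φ` is divisible by `y - φ x`. -/
theorem exists_eq_sub_mul {f : ℂ × ℂ → ℂ} (hf : AnalyticAt ℂ f 0) {φ : ℂ → ℂ}
    (hφ : AnalyticAt ℂ φ 0) (hφ0 : φ 0 = 0) (h : ∀ᶠ x in 𝓝 (0 : ℂ), f (x, φ x) = 0) :
    ∃ g : ℂ × ℂ → ℂ, AnalyticAt ℂ g 0 ∧ ∀ᶠ z in 𝓝 (0 : ℂ × ℂ), f z = (z.2 - φ z.1) * g z := by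
  obtain ⟨g, hg, hfg⟩ := exists_eq_add_snd_mul (analyticAt_shear hf hφ hφ0)
  have hn0 : -φ 0 = 0 := by rw [hφ0, neg_zero]
  refine ⟨_, analyticAt_shear hg hφ.fun_neg hn0, ?_⟩
  filter_upwards [(tendsto_shear hφ.fun_neg hn0).eventually hfg, eventually_fst h] with z h1 h2
  simp only [add_zero, h2, zero_add, add_neg_cancel_left] at h1
  rw [h1]
  ring

/-- Iterated Hadamard division by y: the coefficients depend on x alone, only the remainder on both
variables. -/
theorem exists_taylor {f : ℂ × ℂ → ℂ} (hf : AnalyticAt ℂ f 0) (n : ℕ) :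
    ∃ (c : ℕ → ℂ → ℂ) (r : ℂ × ℂ → ℂ), (∀ j, AnalyticAt ℂ (c j) 0) ∧ AnalyticAt ℂ r 0 ∧
      ∀ᶠ z in 𝓝 (0 : ℂ × ℂ), f z = ∑ j ∈ Finset.range n, c j z.1 * z.2 ^ j + z.2 ^ n * r z := by
  induction n with
  | zero => exact ⟨fun _ _ => 0, f, fun _ => analyticAt_const, hf, by simp⟩
  | succ n ih =>
    obtain ⟨c, r, hc, hr, h⟩ := ih
    obtain ⟨g, hg, hrg⟩ := exists_eq_add_snd_mul hr
    have hr0 : AnalyticAt ℂ (fun x => r (x, 0)) 0 :=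
      analyticAt_comp_graph hr analyticAt_id analyticAt_const rfl
    refine ⟨Function.update c n fun x => r (x, 0), g, fun j => ?_, hg, ?_⟩
    · rcases eq_or_ne j n with rfl | hj
      · simpa using hr0
      · simpa [hj] using hc j
    · filter_upwards [h, hrg] with z h1 h2
      rw [h1, h2, Finset.sum_range_succ, Function.update_self]
      have : ∑ j ∈ Finset.range n, Function.update c n (fun x => r (x, 0)) j z.1 * z.2 ^ j =
          ∑ j ∈ Finset.range n, c j z.1 * z.2 ^ j :=
        Finset.sum_congr rfl fun j hj => by
          rw [Function.update_of_ne (Finset.mem_range.1 hj).ne]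
      rw [this]
      ring

/-- The derivative in the direction of the second coordinate. -/
noncomputable def pderiv₂ (f : ℂ × ℂ → ℂ) (z : ℂ × ℂ) : ℂ := fderiv ℂ f z (0, 1)

/-- The derivative in the direction of the first coordinate. -/
noncomputable def pderiv₁ (f : ℂ × ℂ → ℂ) (z : ℂ × ℂ) : ℂ := fderiv ℂ f z (1, 0)

theorem analyticAt_pderiv₂ {f : ℂ × ℂ → ℂ} {z : ℂ × ℂ} (hf : AnalyticAt ℂ f z) :
    AnalyticAt ℂ (pderiv₂ f) z :=
  ((ContinuousLinearMap.apply ℂ ℂ ((0, 1) : ℂ × ℂ)).analyticAt _).comp hf.fderiv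

theorem analyticAt_pderiv₁ {f : ℂ × ℂ → ℂ} {z : ℂ × ℂ} (hf : AnalyticAt ℂ f z) :
    AnalyticAt ℂ (pderiv₁ f) z :=
  ((ContinuousLinearMap.apply ℂ ℂ ((1, 0) : ℂ × ℂ)).analyticAt _).comp hf.fderiv

theorem analyticAt_iterate_pderiv₂ {f : ℂ × ℂ → ℂ} {z : ℂ × ℂ} (hf : AnalyticAt ℂ f z) (k : ℕ) :
    AnalyticAt ℂ (pderiv₂^[k] f) z := by
  induction k with
  | zero => exact hf
  | succ k ih =>
    rw [Function.iterate_succ_apply']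
    exact analyticAt_pderiv₂ ih

/-- The chain rule along a curve. -/
theorem hasDerivAt_comp_curve {f : ℂ × ℂ → ℂ} {u v : ℂ → ℂ} {u' v' s : ℂ}
    (hf : AnalyticAt ℂ f (u s, v s)) (hu : HasDerivAt u u' s) (hv : HasDerivAt v v' s) :
    HasDerivAt (fun s => f (u s, v s)) (u' * pderiv₁ f (u s, v s) + v' * pderiv₂ f (u s, v s)) s := by
  have h := hf.differentiableAt.hasFDerivAt.comp_hasDerivAt s (hu.prodMk hv)
  have h1 : ((u', v') : ℂ × ℂ) = u' • (1, 0) + v' • (0, 1) := by simp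
  rw [h1, map_add, map_smul, map_smul] at h
  exact h

theorem iteratedDeriv_eq_pderiv₂ (k : ℕ) : ∀ {f : ℂ × ℂ → ℂ} {x y : ℂ}, AnalyticAt ℂ f (x, y) →
    iteratedDeriv k (fun s => f (x, s)) y = pderiv₂^[k] f (x, y) := by
  induction k with
  | zero => intro f x y _; simp
  | succ k ih =>
    intro f x y hf
    rw [iteratedDeriv_succ', Function.iterate_succ_apply, ← ih (analyticAt_pderiv₂ hf)]
    refine Filter.EventuallyEq.iteratedDeriv_eq k ?_
    have ht : Tendsto (fun s : ℂ => (x, s)) (𝓝 y) (𝓝 (x, y)) :=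
      Continuous.tendsto' (by fun_prop) _ _ rfl
    filter_upwards [ht.eventually hf.eventually_analyticAt] with s hs
    have := hasDerivAt_comp_curve (u := fun _ => x) (v := fun s => s) hs (hasDerivAt_const s x)
      (hasDerivAt_id' s)
    simpa using this.deriv

/-- The implicit function theorem for one holomorphic equation. -/
theorem exists_implicit {g : ℂ × ℂ → ℂ} (hg : AnalyticAt ℂ g 0) (hg0 : g 0 = 0)
    (hg' : pderiv₂ g 0 ≠ 0) :
    ∃ φ : ℂ → ℂ, AnalyticAt ℂ φ 0 ∧ φ 0 = 0 ∧ ∀ᶠ x in 𝓝 (0 : ℂ), g (x, φ x) = 0 := by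
  have hc : ContDiffAt ℂ ⊤ g 0 := hg.contDiffAt
  have hinv : (fderiv ℂ g 0 ∘SL ContinuousLinearMap.inr ℂ ℂ ℂ).IsInvertible := by
    refine ⟨ContinuousLinearEquiv.unitsEquivAut ℂ (Units.mk0 _ hg'), ?_⟩
    ext
    simp [pderiv₂]
  refine ⟨hc.implicitFunction (by simp) hinv, ?_, hc.implicitFunction_apply_self (by simp) hinv, ?_⟩
  · exact (hc.contDiffAt_implicitFunction (by simp) hinv).analyticAt
  · have := hc.eventually_apply_implicitFunction (by simp) hinv
    rwa [hg0] at this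

theorem iteratedDeriv_taylor {k n : ℕ} (hk : k < n) (c : ℕ → ℂ) {r : ℂ → ℂ}
    (hr : AnalyticAt ℂ r 0) :
    iteratedDeriv k (fun s => ∑ j ∈ Finset.range n, c j * s ^ j + s ^ n * r s) 0 =
      k.factorial * c k := by
  have h1 (S : Finset ℕ) : iteratedDeriv k (fun s : ℂ => ∑ j ∈ S, c j * s ^ j) 0 =
      if k ∈ S then k.factorial * c k else 0 := by
    induction S using Finset.induction_on with
    | empty => simp
    | insert j S hj ih =>
      have : (fun s : ℂ => ∑ j ∈ insert j S, c j * s ^ j) =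
          fun s => c j * s ^ j + ∑ j ∈ S, c j * s ^ j := by
        funext s
        rw [Finset.sum_insert hj]
      rw [this, iteratedDeriv_fun_add (by fun_prop) (by fun_prop), ih,
        iteratedDeriv_const_mul_field, iteratedDeriv_fun_pow_zero]
      rcases eq_or_ne k j with rfl | hkj
      · simp [hj, mul_comm]
      · simp [hkj]
  have hP : AnalyticAt ℂ (fun s : ℂ => s ^ n * r s) 0 := (analyticAt_id.pow n).mul hr
  have h2 : iteratedDeriv k (fun s : ℂ => s ^ n * r s) 0 = 0 :=
    (natCast_le_analyticOrderAt_iff_iteratedDeriv_eq_zero hP).1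
      ((natCast_le_analyticOrderAt hP).2 ⟨r, hr, by simp⟩) k hk
  rw [iteratedDeriv_fun_add (by fun_prop) hP.contDiffAt, h1, h2,
    if_pos (Finset.mem_range.2 hk), add_zero]

/-- A polynomial of degree `n ≥ 2` without term of degree `n - 1` which is not a monomial has no
root of multiplicity `n`. -/
theorem rootMultiplicity_lt {P : Polynomial ℂ} {n j : ℕ} (hn : 2 ≤ n) (hdeg : P.natDegree = n)
    (hP : P.coeff (n - 1) = 0) (hj : j < n) (hPj : P.coeff j ≠ 0) (l : ℂ) :
    P.rootMultiplicity l < n := by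
  have hP0 : P ≠ 0 := fun h => hPj (by simp [h])
  by_contra! hcon
  obtain ⟨Q, hQ⟩ := (Polynomial.le_rootMultiplicity_iff hP0).1 hcon
  have hQ0 : Q ≠ 0 := fun h => hP0 (by rw [hQ, h, mul_zero])
  have hX : (Polynomial.X - Polynomial.C l) ^ n ≠ 0 := pow_ne_zero _ (Polynomial.X_sub_C_ne_zero l)
  have hQd : Q.natDegree = 0 := by
    have := congrArg Polynomial.natDegree hQ
    rw [Polynomial.natDegree_mul hX hQ0, Polynomial.natDegree_pow, Polynomial.natDegree_X_sub_C,
      hdeg] at this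
    omega
  rw [Polynomial.eq_C_of_natDegree_eq_zero hQd, sub_eq_add_neg, ← Polynomial.C_neg] at hQ
  have hc : Q.coeff 0 ≠ 0 := fun h => hP0 (by rw [hQ, h, Polynomial.C_0, mul_zero])
  have hn1 : n - (n - 1) = 1 := by omega
  -- Here P = c (X - l) ^ n, whose coefficient of degree n - 1 is -n l c. Once l = 0, P is a
  -- monomial and has no coefficient of degree j < n.
  have hl : l = 0 := by
    rw [hQ, Polynomial.coeff_mul_C, Polynomial.coeff_X_add_C_pow, hn1, pow_one,
      Nat.choose_symm (by omega : 1 ≤ n), Nat.choose_one_right] at hP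
    have hn0 : (n : ℂ) ≠ 0 := Nat.cast_ne_zero.2 (by omega)
    simpa [hc, hn0] using hP
  refine hPj ?_
  rw [hQ, Polynomial.coeff_mul_C, Polynomial.coeff_X_add_C_pow, hl, neg_zero,
    zero_pow (by omega), zero_mul, zero_mul]

/-- The order at the origin of a function composed with `u ↦ u ^ N`. -/
theorem analyticOrderAt_comp_pow {h : ℂ → ℂ} (hh : AnalyticAt ℂ h 0) {N : ℕ} (hN : N ≠ 0) :
    analyticOrderAt (fun u => h (u ^ N)) 0 = analyticOrderAt h 0 * N := by
  have h0 : (0 : ℂ) ^ N = 0 := zero_pow hN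
  have h1 : AnalyticAt ℂ h ((fun u : ℂ => u ^ N) 0) := by simpa [h0] using hh
  have := h1.analyticOrderAt_comp (g := fun u : ℂ => u ^ N) (analyticAt_id.pow N)
  rw [Function.comp_def] at this
  rw [this]
  have h2 : analyticOrderAt (fun u : ℂ => u ^ N - 0 ^ N) 0 = N := by
    have := analyticOrderAt_centeredMonomial (𝕜 := ℂ) (z₀ := 0) (n := N)
    simp only [sub_zero] at this
    rw [h0]
    simp only [sub_zero]
    exact this
  rw [h2]
  simp [h0]

/-- The least slope of a Newton polygon, after a ramification that makes it an integer. -/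
theorem exists_slope {n : ℕ} {d : ℕ → ℂ → ℂ} (hd : ∀ j, AnalyticAt ℂ (d j) 0)
    (hdvd : ∀ j < n, ∃ k : ℕ∞, analyticOrderAt (d j) 0 = k * ((n - j : ℕ) : ℕ∞))
    (hpos : ∀ j < n, d j 0 = 0) (hn : 0 < n) (h0 : analyticOrderAt (d 0) 0 ≠ ⊤) :
    ∃ (p : ℕ) (g : ℕ → ℂ → ℂ), p ≠ 0 ∧ (∀ j, AnalyticAt ℂ (g j) 0) ∧
      (∀ j < n, ∀ᶠ u in 𝓝 (0 : ℂ), d j u = u ^ (p * (n - j)) * g j u) ∧ ∃ j < n, g j 0 ≠ 0 := by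
  choose! k hk using hdvd
  have hS : (Finset.range n).Nonempty := ⟨0, Finset.mem_range.2 hn⟩
  -- The slope p is the least `k j`. A zero coefficient may have `k j = ⊤`, but the minimum is
  -- finite since `d 0` is not zero.
  obtain ⟨j₀, hj₀, hmin⟩ := Finset.exists_min_image (Finset.range n) k hS
  have hj₀' := Finset.mem_range.1 hj₀
  have hk0 : k j₀ ≠ ⊤ := fun h => by
    have h1 : k 0 = ⊤ := top_le_iff.1 (h ▸ hmin 0 (Finset.mem_range.2 hn))
    refine h0 ?_
    rw [hk 0 hn, h1, ENat.top_mul]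
    simp [hn.ne']
  obtain ⟨p, hp⟩ := ENat.ne_top_iff_exists.1 hk0
  have hle (j : ℕ) (hj : j < n) : ((p * (n - j) : ℕ) : ℕ∞) ≤ analyticOrderAt (d j) 0 := by
    rw [hk j hj, Nat.cast_mul]
    exact mul_le_mul_left (hp ▸ hmin j (Finset.mem_range.2 hj)) _
  have hg (j : ℕ) : ∃ g : ℂ → ℂ, AnalyticAt ℂ g 0 ∧
      (j < n → ∀ᶠ u in 𝓝 (0 : ℂ), d j u = u ^ (p * (n - j)) * g u) := by
    by_cases hj : j < n
    · obtain ⟨g, hg, h⟩ := (natCast_le_analyticOrderAt (hd j)).1 (hle j hj)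
      exact ⟨g, hg, fun _ => by simpa using h⟩
    · exact ⟨0, analyticAt_const, fun h => absurd h hj⟩
  choose g hg hdg using hg
  refine ⟨p, g, fun h => ?_, hg, hdg, j₀, hj₀', fun h => ?_⟩
  · have h1 := hk j₀ hj₀'
    rw [← hp, h, Nat.cast_zero, zero_mul, (hd j₀).analyticOrderAt_eq_zero] at h1
    exact h1 (hpos j₀ hj₀')
  · have h1 : analyticOrderAt (d j₀) 0 = ((p * (n - j₀) : ℕ) : ℕ∞) := by
      rw [hk j₀ hj₀', ← hp, Nat.cast_mul]
    have h2 : analyticOrderAt (d j₀) 0 =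
        ((p * (n - j₀) : ℕ) : ℕ∞) + analyticOrderAt (g j₀) 0 := by
      have hm := analyticOrderAt_mul (f := fun u : ℂ => u ^ (p * (n - j₀))) (g := g j₀)
        (analyticAt_id.pow _) (hg j₀)
      have hc := analyticOrderAt_centeredMonomial (𝕜 := ℂ) (z₀ := 0) (n := p * (n - j₀))
      simp only [sub_zero] at hc
      have hc' : analyticOrderAt (fun u : ℂ => u ^ (p * (n - j₀))) 0 = (p * (n - j₀) : ℕ) := hc
      rw [analyticOrderAt_congr (hdg j₀ hj₀'), ← hc', ← hm]
      rfl
    rw [h1] at h2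
    have h3 : analyticOrderAt (g j₀) 0 = 0 := by
      refine (ENat.add_right_injective_of_ne_top (ENat.natCast_ne_top (p * (n - j₀)))) ?_
      simpa using h2.symm
    exact ((hg j₀).analyticOrderAt_eq_zero.1 h3) h

/-- Coefficients of the Taylor expansion of a function of given order on the second axis. -/
theorem taylor_coeff_zero {f r : ℂ × ℂ → ℂ} {c : ℕ → ℂ → ℂ} {n : ℕ} (hf : AnalyticAt ℂ f 0)
    (hr : AnalyticAt ℂ r 0)
    (h : ∀ᶠ z in 𝓝 (0 : ℂ × ℂ), f z = ∑ j ∈ Finset.range n, c j z.1 * z.2 ^ j + z.2 ^ n * r z)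
    (hn : analyticOrderAt (fun y => f (0, y)) 0 = n) : (∀ j < n, c j 0 = 0) ∧ r 0 ≠ 0 := by
  have hf0 := analyticAt_snd_axis hf
  have hr0 := analyticAt_snd_axis hr
  have he : (fun y => f (0, y)) =ᶠ[𝓝 0]
      fun y => ∑ j ∈ Finset.range n, c j 0 * y ^ j + y ^ n * r (0, y) :=
    eventually_snd_axis h
  have hc : ∀ j < n, c j 0 = 0 := fun j hj => by
    have h1 := (natCast_le_analyticOrderAt_iff_iteratedDeriv_eq_zero hf0).1 hn.ge j hj
    rw [he.iteratedDeriv_eq, iteratedDeriv_taylor hj (fun j => c j 0) hr0] at h1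
    exact (mul_eq_zero.1 h1).resolve_left (Nat.cast_ne_zero.2 (Nat.factorial_ne_zero j))
  refine ⟨hc, fun h0 => ?_⟩
  obtain ⟨g, hg, hg0, hgf⟩ := hf0.analyticOrderAt_eq_natCast.1 hn
  have h1 : ∀ᶠ y in 𝓝 (0 : ℂ), r (0, y) - g y = 0 := by
    refine eventually_of_punctured (hr0.sub hg).continuousAt ?_
    filter_upwards [he.filter_mono nhdsWithin_le_nhds, hgf.filter_mono nhdsWithin_le_nhds,
      self_mem_nhdsWithin] with y h1 h2 h3
    rw [h2, Finset.sum_eq_zero fun j hj => by rw [hc j (Finset.mem_range.1 hj), zero_mul],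
      zero_add, sub_zero, smul_eq_mul] at h1
    rw [mul_left_cancel₀ (pow_ne_zero _ h3) h1, sub_self]
  have h2 := h1.self_of_nhds
  have h3 : r (0, 0) = 0 := h0
  rw [h3, zero_sub, neg_eq_zero] at h2
  exact hg0 h2

/-- Existence of a branch, after recentering on the vanishing of the coefficient of order
`n - 1`. -/
theorem exists_branch_step {f : ℂ × ℂ → ℂ} (hf : AnalyticAt ℂ f 0) {n : ℕ} (hn : n ≠ 0)
    (hord : analyticOrderAt (fun y => f (0, y)) 0 = n)
    (hcen : ∀ᶠ x in 𝓝 (0 : ℂ), pderiv₂^[n - 1] f (x, 0) = 0)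
    (ih : ∀ m < n, m ≠ 0 → ∀ F : ℂ × ℂ → ℂ, AnalyticAt ℂ F 0 →
      analyticOrderAt (fun y => F (0, y)) 0 = m → ∃ (N : ℕ) (z : ℂ → ℂ), N ≠ 0 ∧
        AnalyticAt ℂ z 0 ∧ z 0 = 0 ∧ ∀ᶠ u in 𝓝 (0 : ℂ), F (u ^ N, z u) = 0) :
    ∃ (N : ℕ) (z : ℂ → ℂ), N ≠ 0 ∧ AnalyticAt ℂ z 0 ∧ z 0 = 0 ∧
      ∀ᶠ u in 𝓝 (0 : ℂ), f (u ^ N, z u) = 0 := by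
  obtain ⟨c, r, hc, hr, hT⟩ := exists_taylor hf n
  obtain ⟨hc0, hr0⟩ := taylor_coeff_zero hf hr hT hord
  have hlast : ∀ᶠ x in 𝓝 (0 : ℂ), c (n - 1) x = 0 := by
    have han : ∀ᶠ x in 𝓝 (0 : ℂ), AnalyticAt ℂ r (x, 0) ∧ AnalyticAt ℂ f (x, 0) :=
      (tendsto_graph (c := 0) (y := fun _ => 0) analyticAt_id analyticAt_const rfl).eventually
        (hr.eventually_analyticAt.and hf.eventually_analyticAt)
    filter_upwards [hcen, eventually_curry hT, han] with x h1 h2 h3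
    have hrx : AnalyticAt ℂ (fun y => r (x, y)) 0 :=
      analyticAt_comp_graph h3.1 analyticAt_const analyticAt_id rfl
    have h2' : (fun y => f (x, y)) =ᶠ[𝓝 0]
      fun y => ∑ j ∈ Finset.range n, c j x * y ^ j + y ^ n * r (x, y) := h2
    rw [← iteratedDeriv_eq_pderiv₂ _ h3.2, h2'.iteratedDeriv_eq,
      iteratedDeriv_taylor (by omega) (fun j => c j x) hrx] at h1
    exact (mul_eq_zero.1 h1).resolve_left (Nat.cast_ne_zero.2 (Nat.factorial_ne_zero _))
  -- If c₀ = 0, the axis y = 0 is a branch. This also settles n = 1, where c₀ is the coefficient of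
  -- degree n - 1.
  by_cases hz : ∀ᶠ x in 𝓝 (0 : ℂ), c 0 x = 0
  · refine ⟨1, fun _ => 0, one_ne_zero, analyticAt_const, rfl, ?_⟩
    have ht : Tendsto (fun x : ℂ => (x, (0 : ℂ))) (𝓝 0) (𝓝 0) :=
      Continuous.tendsto' (by fun_prop) _ _ rfl
    filter_upwards [hz, ht.eventually hT] with x h1 h2
    obtain ⟨k, rfl⟩ := Nat.exists_eq_succ_of_ne_zero hn
    rw [pow_one, h2, Finset.sum_range_succ', h1]
    simp
  have hn2 : 2 ≤ n := by
    by_contra hlt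
    have : n = 1 := by omega
    subst this
    exact hz hlast
  -- Every n - j divides n!, so the ramification x = u ^ M makes all the slopes ord cⱼ / (n - j)
  -- integers.
  set M := n.factorial with hM
  have hM0 : M ≠ 0 := Nat.factorial_ne_zero n
  obtain ⟨p, g, hp, hg, hdg, j₀, hj₀, hgj₀⟩ := exists_slope (n := n) (d := fun j u => c j (u ^ M))
    (fun j => analyticAt_comp_pow (hc j) hM0)
    (fun j hj => by
      obtain ⟨k, hk⟩ := Nat.dvd_factorial (by omega : 0 < n - j) (Nat.sub_le n j)
      refine ⟨analyticOrderAt (c j) 0 * k, ?_⟩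
      rw [analyticOrderAt_comp_pow (hc j) hM0, hM, hk, Nat.cast_mul, mul_assoc,
        mul_comm (k : ℕ∞)])
    (fun j hj => by simp [hM0, hc0 j hj]) (by omega)
    (by
      rw [analyticOrderAt_comp_pow (hc 0) hM0]
      exact WithTop.mul_ne_top (fun h => hz (analyticOrderAt_eq_top.1 h)) (ENat.natCast_ne_top _))
  -- Under x = u ^ M, y = u ^ p t, the function f acquires the exact factor u ^ (p n); the quotient
  -- G restricts on u = 0 to a polynomial P of degree n.
  let φ : ℂ × ℂ → ℂ × ℂ := fun z => (z.1 ^ M, z.1 ^ p * z.2)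
  have hφ (t : ℂ) : Tendsto φ (𝓝 (0, t)) (𝓝 0) :=
    Continuous.tendsto' (by fun_prop) _ _ (by simp [φ, hM0, hp])
  let G : ℂ × ℂ → ℂ := fun z => ∑ j ∈ Finset.range n, g j z.1 * z.2 ^ j + z.2 ^ n * r (φ z)
  have hfst (t : ℂ) : Tendsto Prod.fst (𝓝 ((0 : ℂ), t)) (𝓝 (0 : ℂ)) :=
    Continuous.tendsto' (by fun_prop) _ _ rfl
  have hG (t : ℂ) : AnalyticAt ℂ G (0, t) := by
    refine AnalyticAt.add (Finset.analyticAt_fun_sum _ fun j _ => ?_) ?_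
    · refine AnalyticAt.mul (AnalyticAt.fun_comp (f := fun z : ℂ × ℂ => z.1) (hg j) analyticAt_fst)
        (analyticAt_snd.pow j)
    · refine (analyticAt_snd.pow n).mul (AnalyticAt.fun_comp (f := φ) ?_
        ((analyticAt_fst.pow M).prod ((analyticAt_fst.pow p).mul analyticAt_snd)))
      have : φ (0, t) = 0 := by simp [φ, hM0, hp]
      rwa [this]
  have hfG (t : ℂ) : ∀ᶠ z in 𝓝 ((0 : ℂ), t), f (φ z) = z.1 ^ (p * n) * G z := by
    have hall : ∀ᶠ z in 𝓝 ((0 : ℂ), t), ∀ j ∈ Finset.range n,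
        c j (z.1 ^ M) = z.1 ^ (p * (n - j)) * g j z.1 :=
      (Finset.eventually_all _).2 fun j hj =>
        (hfst t).eventually (hdg j (Finset.mem_range.1 hj))
    filter_upwards [(hφ t).eventually hT, hall] with z h1 h2
    rw [h1]
    simp only [G, mul_add, Finset.mul_sum]
    congr 1
    · refine Finset.sum_congr rfl fun j hj => ?_
      have : z.1 ^ (p * n) = z.1 ^ (p * (n - j)) * z.1 ^ (p * j) := by
        rw [← pow_add, ← mul_add, Nat.sub_add_cancel (Finset.mem_range.1 hj).le]
      rw [h2 j hj, this, mul_pow, ← pow_mul]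
      ring
    · simp only [φ, mul_pow, ← pow_mul]
      ring
  let P : Polynomial ℂ :=
    ∑ j ∈ Finset.range n, Polynomial.monomial j (g j 0) + Polynomial.monomial n (r 0)
  have hGP (t : ℂ) : G (0, t) = P.eval t := by
    have : φ (0, t) = 0 := by simp [φ, hM0, hp]
    simp only [G, P, this, Polynomial.eval_add, Polynomial.eval_finsetSum,
      Polynomial.eval_monomial, mul_comm]
  have hcoeff (j : ℕ) (hj : j < n) : P.coeff j = g j 0 := by
    simp [P, Polynomial.coeff_monomial, hj, hj.ne']
  have hcoeffn : P.coeff n = r 0 := by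
    simp [P, Polynomial.coeff_monomial]
  have hdeg : P.natDegree = n := by
    refine Polynomial.natDegree_eq_of_le_of_coeff_ne_zero ?_ (by rwa [hcoeffn])
    refine Polynomial.natDegree_add_le_of_degree_le
      (Polynomial.natDegree_sum_le_of_forall_le _ _ fun j hj => ?_)
      (Polynomial.natDegree_monomial_le _)
    exact (Polynomial.natDegree_monomial_le _).trans (Finset.mem_range.1 hj).le
  have hP0 : P ≠ 0 := fun h => by rw [h, Polynomial.natDegree_zero] at hdeg; omega
  have hPn : P.coeff (n - 1) = 0 := by
    rw [hcoeff _ (by omega)]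
    have h1 : ∀ᶠ u in 𝓝 (0 : ℂ), g (n - 1) u = 0 := by
      refine eventually_of_punctured (hg _).continuousAt ?_
      filter_upwards [(hdg (n - 1) (by omega)).filter_mono nhdsWithin_le_nhds,
        ((tendsto_pow_zero hM0).eventually hlast).filter_mono nhdsWithin_le_nhds,
        self_mem_nhdsWithin] with u h1 h2 h3
      rw [h2, eq_comm] at h1
      exact (mul_eq_zero.1 h1).resolve_left (pow_ne_zero _ h3)
    exact h1.self_of_nhds
  obtain ⟨l, hl⟩ := IsAlgClosed.exists_root P
    (Polynomial.natDegree_pos_iff_degree_pos.1 (by omega)).ne'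
  -- P has no term of degree n - 1 and a nonzero coefficient of degree j₀ < n, so its roots have
  -- multiplicity less than n and the induction hypothesis applies at any of them.
  obtain ⟨N, τ, hN, hτ, hτ0, hGτ⟩ := ih (P.rootMultiplicity l)
    (rootMultiplicity_lt hn2 hdeg hPn hj₀ (by rwa [hcoeff _ hj₀]) l)
    ((Polynomial.rootMultiplicity_pos hP0).2 hl).ne' _ (analyticAt_translate (hG l))
    (by simp only [hGP]; exact analyticOrderAt_eval_add hP0 l)
  refine ⟨N * M, fun u => (u ^ N) ^ p * (l + τ u), mul_ne_zero hN hM0,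
    ((analyticAt_id.pow N).pow p).mul (analyticAt_const.add hτ), by simp [hN, hp], ?_⟩
  have ht := tendsto_graph (c := (0, l)) (u := fun u => u ^ N) (y := fun u => l + τ u)
    (analyticAt_id.pow N) (analyticAt_const.add hτ) (by simp [hN, hτ0])
  filter_upwards [hGτ, ht.eventually (hfG l)] with u h1 h2
  simp only [φ] at h2
  rw [pow_mul, h2, h1, mul_zero]

/-- **Puiseux's theorem**: a function of order `n ≥ 1` on the second axis vanishes along a
branch. -/
theorem exists_branch (n : ℕ) : n ≠ 0 → ∀ f : ℂ × ℂ → ℂ, AnalyticAt ℂ f 0 →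
    analyticOrderAt (fun y => f (0, y)) 0 = n → ∃ (N : ℕ) (z : ℂ → ℂ), N ≠ 0 ∧
      AnalyticAt ℂ z 0 ∧ z 0 = 0 ∧ ∀ᶠ u in 𝓝 (0 : ℂ), f (u ^ N, z u) = 0 := by
  induction n using Nat.strong_induction_on with
  | _ n ih =>
  intro hn f hf hord
  have hf0 := analyticAt_snd_axis hf
  obtain ⟨hlt, hne⟩ := (analyticOrderAt_eq_nat_iff_iteratedDeriv_eq_zero hf0).1 hord
  have hD (k : ℕ) : iteratedDeriv k (fun y => f (0, y)) 0 = pderiv₂^[k] f 0 :=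
    iteratedDeriv_eq_pderiv₂ k hf
  -- Tschirnhaus transformation: the derivative of order n - 1 in y has a simple zero in y at the
  -- origin, and its zero curve becomes the new axis.
  obtain ⟨φ, hφ, hφ0, hgφ⟩ := exists_implicit (analyticAt_iterate_pderiv₂ hf (n - 1))
    (by rw [← hD]; exact hlt _ (by omega))
    (by rw [← Function.iterate_succ_apply' pderiv₂, ← hD, Nat.succ_eq_add_one,
          Nat.sub_add_cancel (by omega)]; exact hne)
  have hF := analyticAt_shear hf hφ hφ0
  have hcen : ∀ᶠ x in 𝓝 (0 : ℂ),
      pderiv₂^[n - 1] (fun z : ℂ × ℂ => f (z.1, φ z.1 + z.2)) (x, 0) = 0 := by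
    have ht : Tendsto (fun x : ℂ => (x, (0 : ℂ))) (𝓝 0) (𝓝 0) :=
      Continuous.tendsto' (by fun_prop) _ _ rfl
    have ht' := tendsto_graph (c := 0) (y := φ) analyticAt_id hφ (by simp [hφ0])
    filter_upwards [hgφ, ht.eventually hF.eventually_analyticAt,
      ht'.eventually hf.eventually_analyticAt] with x h1 h2 h3
    rw [← iteratedDeriv_eq_pderiv₂ _ h2, iteratedDeriv_comp_const_add (n - 1)
      (fun y => f (x, y)) (φ x)]
    simp only [add_zero]
    rwa [iteratedDeriv_eq_pderiv₂ (x := x) _ h3]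
  obtain ⟨N, z, hN, hz, hz0, h⟩ := exists_branch_step hF hn (by simpa [hφ0] using hord) hcen ih
  refine ⟨N, fun u => φ (u ^ N) + z u, hN, (analyticAt_comp_pow hφ hN).add hz,
    by simp [hN, hφ0, hz0], h⟩

theorem analyticOrderAt_snd_mul {f g : ℂ × ℂ → ℂ} (hg : AnalyticAt ℂ g 0) {φ : ℂ → ℂ}
    (hφ0 : φ 0 = 0) (h : ∀ᶠ z in 𝓝 (0 : ℂ × ℂ), f z = (z.2 - φ z.1) * g z) :
    analyticOrderAt (fun y => f (0, y)) 0 = analyticOrderAt (fun y => g (0, y)) 0 + 1 := by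
  have he : (fun y => f (0, y)) =ᶠ[𝓝 0] id * fun y => g (0, y) := by
    filter_upwards [eventually_snd_axis h] with y hy
    simp [hy, hφ0]
  rw [analyticOrderAt_congr he, analyticOrderAt_mul analyticAt_id (analyticAt_snd_axis hg),
    analyticOrderAt_id, add_comm]

/-- Puiseux factorization. -/
theorem exists_factorization (n : ℕ) : ∀ f : ℂ × ℂ → ℂ, AnalyticAt ℂ f 0 →
    analyticOrderAt (fun y => f (0, y)) 0 = n → ∃ (N : ℕ) (τ : ℕ → ℂ → ℂ) (v : ℂ × ℂ → ℂ),
      N ≠ 0 ∧ (∀ i, AnalyticAt ℂ (τ i) 0) ∧ (∀ i, τ i 0 = 0) ∧ AnalyticAt ℂ v 0 ∧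
      ∀ᶠ z in 𝓝 (0 : ℂ × ℂ), f (z.1 ^ N, z.2) =
        (∏ i ∈ Finset.range n, (z.2 - τ i z.1)) * v z := by
  induction n with
  | zero =>
    intro f hf _
    exact ⟨1, fun _ _ => 0, f, one_ne_zero, fun _ => analyticAt_const, fun _ => rfl, hf, by simp⟩
  | succ n ih =>
    intro f hf hord
    obtain ⟨N, z, hN, hz, hz0, hfz⟩ := exists_branch (n + 1) n.succ_ne_zero f hf hord
    obtain ⟨g, hg, hfg⟩ := exists_eq_sub_mul (analyticAt_ramify hf hN) hz hz0 hfz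
    have h1 := analyticOrderAt_snd_mul hg hz0 hfg
    have h2 : analyticOrderAt (fun y => g (0, y)) 0 = n := by
      simp only [zero_pow hN] at h1
      rw [hord, Nat.cast_add, Nat.cast_one] at h1
      exact (ENat.add_left_injective_of_ne_top ENat.one_ne_top h1).symm
    obtain ⟨N', τ, v, hN', hτ, hτ0, hv, hgv⟩ := ih g hg h2
    -- The factorization of the quotient needs a further ramification of order N', which the root
    -- already found must undergo too.
    refine ⟨N' * N, fun i => if i = n then fun u => z (u ^ N') else τ i, v, mul_ne_zero hN' hN,
      fun i => ?_, fun i => ?_, hv, ?_⟩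
    · dsimp only
      split_ifs
      exacts [analyticAt_comp_pow hz hN', hτ i]
    · dsimp only
      split_ifs
      exacts [by simp [hN', hz0], hτ0 i]
    · filter_upwards [hgv, (tendsto_ramify hN').eventually hfg] with w h3 h4
      rw [pow_mul, h4, h3, Finset.prod_range_succ, if_pos rfl]
      have : ∏ i ∈ Finset.range n, (w.2 - (if i = n then fun u => z (u ^ N') else τ i) w.1) =
          ∏ i ∈ Finset.range n, (w.2 - τ i w.1) :=
        Finset.prod_congr rfl fun i hi => by rw [if_neg (Finset.mem_range.1 hi).ne]
      rw [this]
      ring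

/-! ### The equation of a branch -/

theorem eventually_eq_zero_or_of_mul_one {f g : ℂ → ℂ} (hf : AnalyticAt ℂ f 0)
    (hg : AnalyticAt ℂ g 0) (h : ∀ᶠ x in 𝓝 (0 : ℂ), f x * g x = 0) :
    (∀ᶠ x in 𝓝 (0 : ℂ), f x = 0) ∨ ∀ᶠ x in 𝓝 (0 : ℂ), g x = 0 := by
  have h1 : analyticOrderAt (f * g) 0 = ⊤ := analyticOrderAt_eq_top.2 h
  rw [analyticOrderAt_mul hf hg] at h1
  rcases WithTop.add_eq_top.1 h1 with h2 | h2
  exacts [Or.inl (analyticOrderAt_eq_top.1 h2), Or.inr (analyticOrderAt_eq_top.1 h2)]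

/-- Division by the equations of finitely many distinct smooth branches. -/
theorem exists_eq_prod_mul {ι : Type*} [DecidableEq ι] {h : ℂ × ℂ → ℂ} (hh : AnalyticAt ℂ h 0)
    {z : ι → ℂ → ℂ} (T : Finset ι) (hz : ∀ i ∈ T, AnalyticAt ℂ (z i) 0) (hz0 : ∀ i ∈ T, z i 0 = 0)
    (hne : ∀ i ∈ T, ∀ j ∈ T, i ≠ j → ¬ z i =ᶠ[𝓝 0] z j)
    (hv : ∀ i ∈ T, ∀ᶠ u in 𝓝 (0 : ℂ), h (u, z i u) = 0) :
    ∃ Q : ℂ × ℂ → ℂ, AnalyticAt ℂ Q 0 ∧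
      ∀ᶠ w in 𝓝 (0 : ℂ × ℂ), h w = (∏ i ∈ T, (w.2 - z i w.1)) * Q w := by
  induction T using Finset.induction_on with
  | empty => exact ⟨h, hh, by simp⟩
  | insert k T hk ih =>
    have hkm := Finset.mem_insert_self k T
    obtain ⟨Q, hQ, hQh⟩ := ih (fun i hi => hz i (Finset.mem_insert_of_mem hi))
      (fun i hi => hz0 i (Finset.mem_insert_of_mem hi))
      (fun i hi j hj => hne i (Finset.mem_insert_of_mem hi) j (Finset.mem_insert_of_mem hj))
      (fun i hi => hv i (Finset.mem_insert_of_mem hi))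
    have hkz : ((0 : ℂ), z k 0) = 0 := by rw [hz0 k hkm]; rfl
    have ht := tendsto_graph (u := fun u => u) analyticAt_id (hz k hkm) hkz
    have hQk : ∀ᶠ u in 𝓝 (0 : ℂ), Q (u, z k u) = 0 := by
      have h1 : ∀ᶠ u in 𝓝 (0 : ℂ), (∏ i ∈ T, (z k u - z i u)) * Q (u, z k u) = 0 := by
        filter_upwards [ht.eventually hQh, hv k hkm] with u h1 h2
        rw [← h1, h2]
      -- The branches being distinct, the product of the z k - z i is not the zero germ, so it is Q
      -- that vanishes along the branch z k.
      have hprod : ∀ S ⊆ T, ¬ ∀ᶠ u in 𝓝 (0 : ℂ), ∏ i ∈ S, (z k u - z i u) = 0 := by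
        intro S hS
        induction S using Finset.induction_on with
        | empty => exact fun h => by simpa using h.self_of_nhds
        | insert l S hl ihS =>
          intro h0
          have hlT : l ∈ T := hS (Finset.mem_insert_self l S)
          have hST : S ⊆ T := fun i hi => hS (Finset.mem_insert_of_mem hi)
          simp only [Finset.prod_insert hl] at h0
          rcases eventually_eq_zero_or_of_mul_one
            ((hz k hkm).fun_sub (hz l (Finset.mem_insert_of_mem hlT)))
            (Finset.analyticAt_fun_prod _ fun i hi =>
              (hz k hkm).fun_sub (hz i (Finset.mem_insert_of_mem (hST hi)))) h0 with h2 | h2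
          · refine hne k hkm l (Finset.mem_insert_of_mem hlT) (fun h => hk (h ▸ hlT)) ?_
            exact h2.mono fun u hu => sub_eq_zero.1 hu
          · exact ihS hST h2
      refine (eventually_eq_zero_or_of_mul_one (Finset.analyticAt_fun_prod _ fun i hi =>
        (hz k hkm).fun_sub (hz i (Finset.mem_insert_of_mem hi)))
        (analyticAt_comp_graph hQ analyticAt_id (hz k hkm) hkz) h1).resolve_left
          (hprod T subset_rfl)
    obtain ⟨R, hR, hRQ⟩ := exists_eq_sub_mul hQ (hz k hkm) (hz0 k hkm) hQk
    refine ⟨R, hR, ?_⟩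
    filter_upwards [hQh, hRQ] with w h1 h2
    rw [h1, h2, Finset.prod_insert hk]
    ring

/-- Every point close to 0 is the d-th power of a point close to 0. -/
theorem eventually_of_eventually_pow {d : ℕ} (hd : d ≠ 0) {P : ℂ → Prop}
    (h : ∀ᶠ u in 𝓝 (0 : ℂ), P (u ^ d)) : ∀ᶠ v in 𝓝 (0 : ℂ), P v := by
  obtain ⟨ε, hε, H⟩ := Metric.eventually_nhds_iff.1 h
  filter_upwards [Metric.ball_mem_nhds (0 : ℂ) (pow_pos hε d)] with v hv
  obtain ⟨u, rfl⟩ := IsAlgClosed.exists_pow_nat_eq v (Nat.pos_of_ne_zero hd)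
  refine H ?_
  rw [mem_ball_zero_iff, norm_pow] at hv
  rw [dist_zero_right]
  exact lt_of_pow_lt_pow_left₀ d hε.le hv

theorem eventually_of_eventually_ramify {d : ℕ} (hd : d ≠ 0) {P : ℂ × ℂ → Prop}
    (h : ∀ᶠ w in 𝓝 (0 : ℂ × ℂ), P (w.1 ^ d, w.2)) : ∀ᶠ w in 𝓝 (0 : ℂ × ℂ), P w := by
  obtain ⟨ε, hε, H⟩ := Metric.eventually_nhds_iff.1 h
  filter_upwards [Metric.ball_mem_nhds (0 : ℂ × ℂ) (lt_min (pow_pos hε d) hε)] with w hw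
  obtain ⟨u, hu⟩ := IsAlgClosed.exists_pow_nat_eq w.1 (Nat.pos_of_ne_zero hd)
  rw [mem_ball_zero_iff, Prod.norm_def, max_lt_iff] at hw
  have h1 : ‖u‖ < ε := by
    have := hw.1.trans_le (min_le_left _ _)
    rw [← hu, norm_pow] at this
    exact lt_of_pow_lt_pow_left₀ d hε.le this
  have h2 : ‖w.2‖ < ε := hw.2.trans_le (min_le_right _ _)
  have := @H (u, w.2) (by rw [dist_zero_right, Prod.norm_def]; exact max_lt h1 h2)
  simpa [hu] using this

theorem tendsto_const_mul (c : ℂ) : Tendsto (fun u : ℂ => c * u) (𝓝 0) (𝓝 0) :=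
  Continuous.tendsto' (by fun_prop) _ _ (by simp)

theorem analyticAt_comp_const_mul {z : ℂ → ℂ} (hz : AnalyticAt ℂ z 0) (c : ℂ) :
    AnalyticAt ℂ (fun u => z (c * u)) 0 :=
  AnalyticAt.fun_comp (f := fun u : ℂ => c * u) (by simpa using hz)
    (analyticAt_const.mul analyticAt_id)

/-- The parametrization `u ↦ (u ^ N, z u)` is injective. -/
def IsPrimitiveArc (N : ℕ) (z : ℂ → ℂ) : Prop :=
  ∀ ξ : ℂ, ξ ^ N = 1 → (fun u => z (ξ * u)) =ᶠ[𝓝 0] z → ξ = 1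

/-- Every parametrized branch is a reparametrization of an injective one. -/
theorem exists_primitiveArc (N : ℕ) : N ≠ 0 → ∀ z : ℂ → ℂ, AnalyticAt ℂ z 0 → z 0 = 0 →
    ∃ (M d : ℕ) (y : ℂ → ℂ), M ≠ 0 ∧ d ≠ 0 ∧ N = d * M ∧ AnalyticAt ℂ y 0 ∧ y 0 = 0 ∧
      (∀ᶠ u in 𝓝 (0 : ℂ), z u = y (u ^ d)) ∧ IsPrimitiveArc M y := by
  induction N using Nat.strong_induction_on with
  | _ N ih =>
  intro hN z hz hz0
  by_cases hprim : IsPrimitiveArc N z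
  · exact ⟨N, 1, z, hN, one_ne_zero, (one_mul N).symm, hz, hz0, by simp, hprim⟩
  unfold IsPrimitiveArc at hprim
  push Not at hprim
  obtain ⟨ξ, hξN, hξ, hξ1⟩ := hprim
  -- A rotation of order d fixing z makes z a function of u ^ d; the induction continues with the
  -- smaller exponent N / d.
  set d := orderOf ξ
  have hfin : IsOfFinOrder ξ := isOfFinOrder_iff_pow_eq_one.2 ⟨N, Nat.pos_of_ne_zero hN, hξN⟩
  have hd0 : d ≠ 0 := hfin.orderOf_pos.ne'
  have hprim : IsPrimitiveRoot ξ d := IsPrimitiveRoot.orderOf ξ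
  obtain ⟨M, hM⟩ := orderOf_dvd_of_pow_eq_one hξN
  have hM0 : M ≠ 0 := fun h => hN (by rw [hM, h, mul_zero])
  have hlt : M < N := by
    have : d ≠ 1 := fun h => hξ1 (orderOf_eq_one_iff.1 h)
    rw [hM]
    exact (Nat.lt_mul_iff_one_lt_left (Nat.pos_of_ne_zero hM0)).2 (by omega)
  have hrot (k : ℕ) : ∀ᶠ u in 𝓝 (0 : ℂ), z (ξ ^ k * u) = z u := by
    induction k with
    | zero => simp
    | succ k ihk =>
      filter_upwards [hξ, (tendsto_const_mul ξ).eventually ihk] with u h1 h2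
      rw [pow_succ, mul_assoc, h2]
      exact h1
  obtain ⟨g, hg, hzg⟩ := exists_descent hd0 hprim (analyticAt_fst_comp hz)
    fun k => eventually_fst (hrot k)
  have hy : AnalyticAt ℂ (fun v => g (v, 0)) 0 :=
    analyticAt_comp_graph hg analyticAt_id analyticAt_const rfl
  have hzy : ∀ᶠ u in 𝓝 (0 : ℂ), z u = g (u ^ d, 0) :=
    (Continuous.tendsto' (by fun_prop) (0 : ℂ) (0 : ℂ × ℂ) rfl :
      Tendsto (fun u : ℂ => (u, (0 : ℂ))) (𝓝 0) (𝓝 0)).eventually hzg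
  have hy0 : g (0, 0) = 0 := by
    have := hzy.self_of_nhds
    rw [hz0, zero_pow hd0] at this
    exact this.symm
  obtain ⟨M', d', y, hM', hd', hMd, hyan, hy0', he, hp⟩ := ih M hlt hM0 _ hy hy0
  refine ⟨M', d * d', y, hM', mul_ne_zero hd0 hd', by rw [hM, hMd, mul_assoc], hyan, hy0', ?_, hp⟩
  filter_upwards [hzy, (tendsto_pow_zero hd0).eventually he] with u h1 h2
  rw [h1, h2, pow_mul]

/-- `G` generates the ideal of the branch parametrized by `u ↦ (u ^ N, z u)`. -/
structure IsBranchEquation (N : ℕ) (z : ℂ → ℂ) (G : ℂ × ℂ → ℂ) : Prop where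
  analyticAt : AnalyticAt ℂ G 0
  exists_order : ∃ M : ℕ, M ≠ 0 ∧ analyticOrderAt (fun s => G (0, s)) 0 = M
  vanish_iff : ∀ H : ℂ × ℂ → ℂ, AnalyticAt ℂ H 0 → ((∀ᶠ u in 𝓝 (0 : ℂ), H (u ^ N, z u) = 0) ↔
    ∃ Q : ℂ × ℂ → ℂ, AnalyticAt ℂ Q 0 ∧ ∀ᶠ w in 𝓝 (0 : ℂ × ℂ), H w = G w * Q w)

/-- G is the norm of y - z(u): the product W of the y - z(ξu) over the N-th roots of unity is
invariant under the rotations of u, hence a function of (u ^ N, y). A function vanishing on the arc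
vanishes on all the conjugates, which are distinct by primitivity, so its ramification is divisible
by W; the quotient descends as well. -/
theorem IsPrimitiveArc.exists_branchEquation {N : ℕ} {z : ℂ → ℂ} (hp : IsPrimitiveArc N z)
    (hN : N ≠ 0) (hz : AnalyticAt ℂ z 0) (hz0 : z 0 = 0) : ∃ G, IsBranchEquation N z G := by
  set T := Polynomial.nthRootsFinset N (1 : ℂ)
  have hT (ξ : ℂ) : ξ ∈ T ↔ ξ ^ N = 1 := Polynomial.mem_nthRootsFinset (Nat.pos_of_ne_zero hN) _
  let W : ℂ × ℂ → ℂ := fun w => ∏ ξ ∈ T, (w.2 - z (ξ * w.1))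
  have hzξ (ξ : ℂ) : AnalyticAt ℂ (fun u => z (ξ * u)) 0 := analyticAt_comp_const_mul hz ξ
  have hW : AnalyticAt ℂ W 0 :=
    Finset.analyticAt_fun_prod _ fun ξ _ => analyticAt_snd.sub (analyticAt_fst_comp (hzξ ξ))
  have hWrot (η : ℂ) (hη : η ^ N = 1) (w : ℂ × ℂ) : W (η * w.1, w.2) = W w := by
    have hη0 : η ≠ 0 := fun h => by rw [h, zero_pow hN] at hη; exact zero_ne_one hη
    refine Finset.prod_bij (fun ξ _ => ξ * η) (fun ξ hξ => ?_) (fun a _ b _ h => ?_)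
      (fun ξ hξ => ⟨ξ * η⁻¹, ?_, ?_⟩) (fun ξ _ => ?_)
    · rw [hT, mul_pow, (hT ξ).1 hξ, hη, one_mul]
    · exact mul_right_cancel₀ hη0 h
    · rw [hT, mul_pow, inv_pow, (hT ξ).1 hξ, hη, inv_one, one_mul]
    · rw [inv_mul_cancel_right₀ hη0]
    · rw [mul_assoc]
  set ζ := Complex.exp (2 * Real.pi * Complex.I / N)
  have hζ : IsPrimitiveRoot ζ N := Complex.isPrimitiveRoot_exp N hN
  have hζk (k : ℕ) : (ζ ^ k) ^ N = 1 := by rw [pow_right_comm, hζ.pow_eq_one, one_pow]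
  obtain ⟨G, hG, hWG⟩ := exists_descent hN hζ hW fun k => Eventually.of_forall (hWrot _ (hζk k))
  have hG0 : (fun s => G (0, s)) =ᶠ[𝓝 0] fun s => s ^ T.card := by
    filter_upwards [eventually_snd_axis hWG] with s hs
    rw [zero_pow hN] at hs
    rw [← hs]
    simp [W, hz0]
  have hTc : T.card ≠ 0 := Finset.card_ne_zero.2 ⟨1, (hT 1).2 (one_pow N)⟩
  have hord : analyticOrderAt (fun s => G (0, s)) 0 = T.card := by
    have hc := analyticOrderAt_centeredMonomial (𝕜 := ℂ) (z₀ := 0) (n := T.card)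
    simp only [sub_zero] at hc
    rw [analyticOrderAt_congr hG0]
    exact hc
  refine ⟨G, hG, ⟨T.card, hTc, hord⟩, fun H hH => ⟨fun hv => ?_, ?_⟩⟩
  · have hdist : ∀ ξ ∈ T, ∀ η ∈ T, ξ ≠ η → ¬ (fun u => z (ξ * u)) =ᶠ[𝓝 0] fun u => z (η * u) := by
      intro ξ hξ η hη hne he
      refine hne ?_
      have hη0 : η ≠ 0 := fun h => by
        have := (hT η).1 hη
        rw [h, zero_pow hN] at this
        exact zero_ne_one this
      have h1 := hp (ξ * η⁻¹) (by rw [mul_pow, inv_pow, (hT ξ).1 hξ, (hT η).1 hη, inv_one, one_mul])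
        (by
          filter_upwards [(tendsto_const_mul η⁻¹).eventually he] with u hu
          rw [mul_inv_cancel_left₀ hη0] at hu
          rw [← hu, mul_assoc])
      rw [← mul_one ξ, ← inv_mul_cancel₀ hη0, ← mul_assoc, h1, one_mul]
    have hvan : ∀ ξ ∈ T, ∀ᶠ u in 𝓝 (0 : ℂ), H (u ^ N, z (ξ * u)) = 0 := by
      intro ξ hξ
      filter_upwards [(tendsto_const_mul ξ).eventually hv] with u hu
      rwa [mul_pow, (hT ξ).1 hξ, one_mul] at hu
    obtain ⟨Q, hQ, hHQ⟩ := exists_eq_prod_mul (analyticAt_ramify hH hN)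
      (z := fun ξ u => z (ξ * u)) T (fun ξ _ => hzξ ξ) (fun ξ _ => by simp [hz0]) hdist hvan
    have hW0 : ¬ ∀ᶠ w in 𝓝 (0 : ℂ × ℂ), W w = 0 := fun h => by
      have h1 : ∀ᶠ s in 𝓝 (0 : ℂ), G (0, s) = 0 := by
        filter_upwards [eventually_snd_axis h, eventually_snd_axis hWG] with s h1 h2
        rw [zero_pow hN] at h2
        rw [← h2, h1]
      rw [analyticOrderAt_eq_top.2 h1] at hord
      exact ENat.top_ne_natCast _ hord
    -- Both W and W Q are invariant under the rotation, and W is not zero; germs form a domain, so Q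
    -- is invariant.
    have hQrot (k : ℕ) : ∀ᶠ w in 𝓝 (0 : ℂ × ℂ), Q (ζ ^ k * w.1, w.2) = Q w := by
      have ht : Tendsto (fun w : ℂ × ℂ => (ζ ^ k * w.1, w.2)) (𝓝 0) (𝓝 0) :=
        Continuous.tendsto' (by fun_prop) _ _ (by simp)
      have hQ' : AnalyticAt ℂ (fun w : ℂ × ℂ => Q (ζ ^ k * w.1, w.2)) 0 := by
        refine AnalyticAt.fun_comp (f := fun w : ℂ × ℂ => (ζ ^ k * w.1, w.2)) ?_
          ((analyticAt_const.mul analyticAt_fst).prod analyticAt_snd)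
        have : ((ζ ^ k * (0 : ℂ × ℂ).1, (0 : ℂ × ℂ).2) : ℂ × ℂ) = 0 := by ext <;> simp
        rwa [this]
      have h1 := (eventually_eq_zero_or_of_mul hW (hQ'.fun_sub hQ) ?_).resolve_left hW0
      · exact h1.mono fun w hw => sub_eq_zero.1 hw
      · filter_upwards [hHQ, ht.eventually hHQ] with w h1 h2
        have h3 : ∏ ξ ∈ T, (w.2 - z (ξ * (ζ ^ k * w.1))) = W w := hWrot _ (hζk k) w
        have h4 : ∏ ξ ∈ T, (w.2 - z (ξ * w.1)) = W w := rfl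
        rw [mul_pow, hζk, one_mul, h1, h3, h4] at h2
        rw [mul_sub, ← h2, sub_self]
    obtain ⟨R, hR, hQR⟩ := exists_descent hN hζ hQ hQrot
    refine ⟨R, hR, eventually_of_eventually_ramify hN ?_⟩
    filter_upwards [hHQ, hQR, hWG] with w h1 h2 h3
    rw [h1, ← h2, ← h3]
  · rintro ⟨Q, -, hQ⟩
    have ht := tendsto_graph (c := 0) (u := fun u => u ^ N) (analyticAt_id.pow N) hz
      (by simp [hN, hz0])
    have ht' := tendsto_graph (c := 0) (u := fun u => u) analyticAt_id hz (by simp [hz0])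
    filter_upwards [ht.eventually hQ, ht'.eventually hWG] with u h1 h2
    have h3 : W (u, z u) = 0 := Finset.prod_eq_zero ((hT 1).2 (one_pow N)) (by simp)
    rw [h1, ← h2, h3, zero_mul]

/-- Every parametrized branch has an equation. -/
theorem exists_branchEquation {N : ℕ} {z : ℂ → ℂ} (hN : N ≠ 0) (hz : AnalyticAt ℂ z 0)
    (hz0 : z 0 = 0) : ∃ G, IsBranchEquation N z G := by
  obtain ⟨M, d, y, hM, hd, hNM, hy, hy0, hzy, hp⟩ := exists_primitiveArc N hN z hz hz0
  obtain ⟨G, hG⟩ := hp.exists_branchEquation hM hy hy0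
  -- The arc and its primitive reparametrization have the same vanishing functions, since u ↦ u ^ d
  -- is onto near 0.
  refine ⟨G, hG.analyticAt, hG.exists_order, fun H hH => Iff.trans ⟨fun h => ?_, fun h => ?_⟩
    (hG.vanish_iff H hH)⟩
  · refine eventually_of_eventually_pow hd ?_
    filter_upwards [h, hzy] with u h1 h2
    rwa [h2, hNM, pow_mul] at h1
  · filter_upwards [(tendsto_pow_zero hd).eventually h, hzy] with u h1 h2
    rwa [h2, hNM, pow_mul]

section

variable {N : ℕ} {z : ℂ → ℂ} {G : ℂ × ℂ → ℂ}

theorem IsBranchEquation.apply_zero (hG : IsBranchEquation N z G) : G 0 = 0 := by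
  obtain ⟨M, hM, hord⟩ := hG.exists_order
  refine apply_eq_zero_of_analyticOrderAt_ne_zero (f := fun s => G (0, s)) (z₀ := 0) ?_
  rw [hord]
  exact_mod_cast hM

theorem IsBranchEquation.vanish (hG : IsBranchEquation N z G) :
    ∀ᶠ u in 𝓝 (0 : ℂ), G (u ^ N, z u) = 0 :=
  (hG.vanish_iff G hG.analyticAt).2 ⟨fun _ => 1, analyticAt_const, by simp⟩

theorem IsBranchEquation.not_eventually_zero (hG : IsBranchEquation N z G) :
    ¬ ∀ᶠ w in 𝓝 (0 : ℂ × ℂ), G w = 0 := fun h => by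
  obtain ⟨M, -, hord⟩ := hG.exists_order
  rw [analyticOrderAt_eq_top.2 (eventually_snd_axis h)] at hord
  exact ENat.top_ne_natCast _ hord

theorem pderiv₂_mul {f g : ℂ × ℂ → ℂ} {w : ℂ × ℂ} (hf : AnalyticAt ℂ f w) (hg : AnalyticAt ℂ g w) :
    pderiv₂ (fun w => f w * g w) w = pderiv₂ f w * g w + f w * pderiv₂ g w := by
  simp only [pderiv₂]
  rw [fderiv_fun_mul hf.differentiableAt hg.differentiableAt]
  simp
  ring

theorem pderiv₁_mul {f g : ℂ × ℂ → ℂ} {w : ℂ × ℂ} (hf : AnalyticAt ℂ f w) (hg : AnalyticAt ℂ g w) :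
    pderiv₁ (fun w => f w * g w) w = pderiv₁ f w * g w + f w * pderiv₁ g w := by
  simp only [pderiv₁]
  rw [fderiv_fun_mul hf.differentiableAt hg.differentiableAt]
  simp
  ring

theorem eventually_pderiv₂_eq {f g : ℂ × ℂ → ℂ} {p : ℂ × ℂ} (h : ∀ᶠ w in 𝓝 p, f w = g w) :
    ∀ᶠ w in 𝓝 p, pderiv₂ f w = pderiv₂ g w :=
  (EventuallyEq.fderiv (𝕜 := ℂ) h).mono fun w hw => by simp only [pderiv₂, hw]

/-- Otherwise G would divide its own derivative in y; on the axis x = 0 the orders are M and M - 1,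
a contradiction. -/
theorem IsBranchEquation.pderiv₂_not_vanish (hG : IsBranchEquation N z G) :
    ¬ ∀ᶠ u in 𝓝 (0 : ℂ), pderiv₂ G (u ^ N, z u) = 0 := fun h => by
  obtain ⟨Q, hQ, hGQ⟩ := (hG.vanish_iff _ (analyticAt_pderiv₂ hG.analyticAt)).1 h
  obtain ⟨M, hM, hord⟩ := hG.exists_order
  have hG0 := analyticAt_snd_axis hG.analyticAt
  have h1 := hG0.analyticOrderAt_deriv_add_one
  have h0 : G (0, 0) = 0 := hG.apply_zero
  simp only [h0, sub_zero, hord] at h1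
  have h2 : deriv (fun s => G (0, s)) =ᶠ[𝓝 0] (fun s => G (0, s)) * fun s => Q (0, s) := by
    filter_upwards [eventually_snd_axis hGQ,
      eventually_snd_axis hG.analyticAt.eventually_analyticAt] with s h1 h2
    have := hasDerivAt_comp_curve (u := fun _ => 0) (v := fun s => s) h2 (hasDerivAt_const s 0)
      (hasDerivAt_id' s)
    rw [this.deriv, h1]
    simp
  rw [analyticOrderAt_congr h2, analyticOrderAt_mul hG0 (analyticAt_snd_axis hQ), hord] at h1
  cases h3 : analyticOrderAt (fun s => Q (0, s)) 0 with
  | top => simp [h3] at h1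
  | coe k =>
    rw [h3] at h1
    have : M + k + 1 = M := by exact_mod_cast h1
    omega

/-- A function which vanishes along a branch together with its derivative is divisible by the
square of the equation of the branch. -/
theorem IsBranchEquation.sq_dvd (hG : IsBranchEquation N z G) (hN : N ≠ 0) (hz : AnalyticAt ℂ z 0)
    (hz0 : z 0 = 0) {f : ℂ × ℂ → ℂ} (hf : AnalyticAt ℂ f 0)
    (h1 : ∀ᶠ u in 𝓝 (0 : ℂ), f (u ^ N, z u) = 0)
    (h2 : ∀ᶠ u in 𝓝 (0 : ℂ), pderiv₂ f (u ^ N, z u) = 0) :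
    ∃ Q : ℂ × ℂ → ℂ, AnalyticAt ℂ Q 0 ∧ ∀ᶠ w in 𝓝 (0 : ℂ × ℂ), f w = G w * G w * Q w := by
  obtain ⟨Q, hQ, hfQ⟩ := (hG.vanish_iff f hf).1 h1
  have hc : ((0 : ℂ) ^ N, z 0) = 0 := by simp [hN, hz0]
  have ht := tendsto_graph (u := fun u => u ^ N) (analyticAt_id.pow N) hz hc
  -- On the branch G = 0, so the Leibniz rule for f = G Q leaves only this term.
  have h3 : ∀ᶠ u in 𝓝 (0 : ℂ), pderiv₂ G (u ^ N, z u) * Q (u ^ N, z u) = 0 := by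
    filter_upwards [h2, ht.eventually (eventually_pderiv₂_eq hfQ), hG.vanish,
      ht.eventually (hG.analyticAt.eventually_analyticAt.and hQ.eventually_analyticAt)]
      with u h2 h4 h5 h6
    rw [h2, pderiv₂_mul h6.1 h6.2, h5, zero_mul, add_zero] at h4
    exact h4.symm
  have h4 := (eventually_eq_zero_or_of_mul_one
    (analyticAt_comp_graph (analyticAt_pderiv₂ hG.analyticAt) (analyticAt_id.pow N) hz hc)
    (analyticAt_comp_graph hQ (analyticAt_id.pow N) hz hc) h3).resolve_left hG.pderiv₂_not_vanish
  obtain ⟨R, hR, hQR⟩ := (hG.vanish_iff Q hQ).1 h4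
  refine ⟨R, hR, ?_⟩
  filter_upwards [hfQ, hQR] with w h5 h6
  rw [h5, h6, mul_assoc]

end

/-! ### Germs -/

section

variable {p : ℂ × ℂ}

theorem exists_germOf (g : HolGerm p) : ∃ (f : ℂ × ℂ → ℂ) (hf : AnalyticAt ℂ f p), g = germOf f hf := by
  obtain ⟨_, f, hf, rfl⟩ := g
  exact ⟨f, hf, rfl⟩

theorem germOf_eq_iff {f g : ℂ × ℂ → ℂ} (hf : AnalyticAt ℂ f p) (hg : AnalyticAt ℂ g p) :
    germOf f hf = germOf g hg ↔ ∀ᶠ z in 𝓝 p, f z = g z :=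
  Subtype.ext_iff.trans Germ.coe_eq

theorem germOf_mul {f g : ℂ × ℂ → ℂ} (hf : AnalyticAt ℂ f p) (hg : AnalyticAt ℂ g p) :
    germOf f hf * germOf g hg = germOf (fun z => f z * g z) (hf.fun_mul hg) := rfl

theorem germOf_eq_zero_iff {f : ℂ × ℂ → ℂ} (hf : AnalyticAt ℂ f p) :
    germOf f hf = 0 ↔ ∀ᶠ z in 𝓝 p, f z = 0 :=
  germOf_eq_iff hf analyticAt_const

theorem germOf_dvd_iff {f g : ℂ × ℂ → ℂ} (hf : AnalyticAt ℂ f p) (hg : AnalyticAt ℂ g p) :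
    germOf f hf ∣ germOf g hg ↔
      ∃ k : ℂ × ℂ → ℂ, AnalyticAt ℂ k p ∧ ∀ᶠ z in 𝓝 p, g z = f z * k z := by
  constructor
  · rintro ⟨c, hc⟩
    obtain ⟨k, hk, rfl⟩ := exists_germOf c
    exact ⟨k, hk, (germOf_eq_iff hg (hf.fun_mul hk)).1 hc⟩
  · rintro ⟨k, hk, h⟩
    exact ⟨germOf k hk, (germOf_eq_iff hg (hf.fun_mul hk)).2 h⟩

theorem isUnit_germOf_iff {f : ℂ × ℂ → ℂ} (hf : AnalyticAt ℂ f p) :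
    IsUnit (germOf f hf) ↔ f p ≠ 0 := by
  rw [isUnit_iff_dvd_one]
  have h1 : (1 : HolGerm p) = germOf (fun _ => 1) analyticAt_const := rfl
  rw [h1, germOf_dvd_iff]
  constructor
  · rintro ⟨k, -, h⟩ h0
    have := h.self_of_nhds
    rw [h0, zero_mul] at this
    exact one_ne_zero this
  · intro h
    refine ⟨fun z => (f z)⁻¹, hf.inv h, ?_⟩
    filter_upwards [hf.continuousAt.eventually_ne h] with z hz
    rw [mul_inv_cancel₀ hz]

theorem translate_analyticAt {f : ℂ × ℂ → ℂ} (hf : AnalyticAt ℂ f p) :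
    AnalyticAt ℂ (fun z => f (p + z)) 0 :=
  AnalyticAt.fun_comp (f := fun z => p + z) (by simpa using hf) (analyticAt_const.add analyticAt_id)

theorem eventually_translate_iff {P : ℂ × ℂ → Prop} :
    (∀ᶠ z in 𝓝 (0 : ℂ × ℂ), P (p + z)) ↔ ∀ᶠ z in 𝓝 p, P z := by
  have := map_add_left_nhds_zero p
  rw [← this, eventually_map]

instance : IsDomain (HolGerm p) := by
  have : Nontrivial (HolGerm p) := ⟨0, 1, fun h => by
    have h1 := (germOf_eq_iff (p := p) (f := fun _ => 0) (g := fun _ => 1) analyticAt_const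
      analyticAt_const).1 h
    exact zero_ne_one h1.self_of_nhds⟩
  have : NoZeroDivisors (HolGerm p) := ⟨fun {a b} h => by
    obtain ⟨f, hf, rfl⟩ := exists_germOf a
    obtain ⟨g, hg, rfl⟩ := exists_germOf b
    rw [germOf_mul, germOf_eq_zero_iff] at h
    rw [germOf_eq_zero_iff, germOf_eq_zero_iff, ← eventually_translate_iff,
      ← eventually_translate_iff (P := fun z => g z = 0)]
    exact eventually_eq_zero_or_of_mul (translate_analyticAt hf) (translate_analyticAt hg)
      (eventually_translate_iff.2 h)⟩
  exact NoZeroDivisors.to_isDomain _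

end

/-- A squarefree germ does not vanish to second order along a branch. -/
theorem not_squarefree_of_branch {f : ℂ × ℂ → ℂ} (hf : AnalyticAt ℂ f 0) {N : ℕ} (hN : N ≠ 0)
    {z : ℂ → ℂ} (hz : AnalyticAt ℂ z 0) (hz0 : z 0 = 0)
    (h1 : ∀ᶠ u in 𝓝 (0 : ℂ), f (u ^ N, z u) = 0)
    (h2 : ∀ᶠ u in 𝓝 (0 : ℂ), pderiv₂ f (u ^ N, z u) = 0) : ¬ Squarefree (germOf f hf) := by
  intro hsq
  obtain ⟨G, hG⟩ := exists_branchEquation hN hz hz0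
  have h3 := hsq (germOf G hG.analyticAt)
    ((germOf_dvd_iff (hG.analyticAt.fun_mul hG.analyticAt) hf).2 (hG.sq_dvd hN hz hz0 hf h1 h2))
  exact (isUnit_germOf_iff _).1 h3 hG.apply_zero

/-- Divisibility by G means vanishing along the arc, and germs of functions of the parameter u form
a domain. -/
theorem IsBranchEquation.prime {N : ℕ} {z : ℂ → ℂ} {G : ℂ × ℂ → ℂ} (hG : IsBranchEquation N z G)
    (hN : N ≠ 0) (hz : AnalyticAt ℂ z 0) (hz0 : z 0 = 0) : Prime (germOf G hG.analyticAt) := by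
  have hc : ((0 : ℂ) ^ N, z 0) = 0 := by simp [hN, hz0]
  have hdvd {H : ℂ × ℂ → ℂ} (hH : AnalyticAt ℂ H 0) :
      germOf G hG.analyticAt ∣ germOf H hH ↔ ∀ᶠ u in 𝓝 (0 : ℂ), H (u ^ N, z u) = 0 :=
    (germOf_dvd_iff _ hH).trans (hG.vanish_iff H hH).symm
  refine ⟨fun h => hG.not_eventually_zero ((germOf_eq_zero_iff _).1 h),
    fun h => (isUnit_germOf_iff _).1 h hG.apply_zero, fun a b hab => ?_⟩
  obtain ⟨f, hf, rfl⟩ := exists_germOf a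
  obtain ⟨g, hg, rfl⟩ := exists_germOf b
  rw [germOf_mul, hdvd] at hab
  rw [hdvd, hdvd]
  exact eventually_eq_zero_or_of_mul_one (analyticAt_comp_graph hf (analyticAt_id.pow N) hz hc)
    (analyticAt_comp_graph hg (analyticAt_id.pow N) hz hc) hab

/-- The branch parametrized by `u ↦ (u ^ N, z u)` is tangent to `A dx + B dy`. -/
def IsTangentArc (A B : ℂ × ℂ → ℂ) (N : ℕ) (z : ℂ → ℂ) : Prop :=
  ∀ᶠ u in 𝓝 (0 : ℂ), A (u ^ N, z u) * (N * u ^ (N - 1)) + B (u ^ N, z u) * deriv z u = 0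

/-- Along the arc, both dG and ω annihilate the velocity (N u ^ (N - 1), z'), which is nonzero for u
≠ 0; so dG ∧ ω vanishes there, and G divides it. -/
theorem IsBranchEquation.isInvariant {N : ℕ} {z : ℂ → ℂ} {G A B : ℂ × ℂ → ℂ}
    (hG : IsBranchEquation N z G) (hN : N ≠ 0) (hz : AnalyticAt ℂ z 0) (hz0 : z 0 = 0)
    (hA : AnalyticAt ℂ A 0) (hB : AnalyticAt ℂ B 0) (h : IsTangentArc A B N z) :
    IsInvariant ⟨germOf A hA, germOf B hB⟩ (germOf G hG.analyticAt) := by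
  have hc : ((0 : ℂ) ^ N, z 0) = 0 := by simp [hN, hz0]
  have ht := tendsto_graph (u := fun u => u ^ N) (analyticAt_id.pow N) hz hc
  have han {H : ℂ × ℂ → ℂ} (hH : AnalyticAt ℂ H 0) : AnalyticAt ℂ (fun u => H (u ^ N, z u)) 0 :=
    analyticAt_comp_graph hH (analyticAt_id.pow N) hz hc
  have h1 := analyticAt_pderiv₁ hG.analyticAt
  have h2 := analyticAt_pderiv₂ hG.analyticAt
  have h0 := (h1.fun_mul hB).fun_sub (h2.fun_mul hA)
  refine (germOf_dvd_iff hG.analyticAt h0).2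
    ((hG.vanish_iff _ h0).1 (eventually_of_punctured ?_ ?_))
  · exact (((han h1).mul (han hB)).sub ((han h2).mul (han hA))).continuousAt
  · have hd : ∀ᶠ u in 𝓝 (0 : ℂ), deriv (fun u => G (u ^ N, z u)) u = 0 := by
      have := EventuallyEq.deriv (𝕜 := ℂ) (f := fun _ => (0 : ℂ)) hG.vanish
      filter_upwards [this] with u hu
      rw [hu]
      simp
    filter_upwards [h.filter_mono nhdsWithin_le_nhds, hd.filter_mono nhdsWithin_le_nhds,
      (ht.eventually hG.analyticAt.eventually_analyticAt).filter_mono nhdsWithin_le_nhds,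
      hz.eventually_analyticAt.filter_mono nhdsWithin_le_nhds, self_mem_nhdsWithin] with u h3 h4 h5 h6 h7
    rw [(hasDerivAt_comp_curve (u := fun u => u ^ N) h5 (hasDerivAt_pow N u) h6.differentiableAt.hasDerivAt).deriv] at h4
    have h8 : (N : ℂ) * u ^ (N - 1) ≠ 0 := mul_ne_zero (Nat.cast_ne_zero.2 hN) (pow_ne_zero _ h7)
    refine (mul_eq_zero.1 ?_).resolve_left h8
    linear_combination B (u ^ N, z u) * h4 - pderiv₂ G (u ^ N, z u) * h3

/-- Infinitely many tangent branches make a foliation dicritical. -/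
theorem not_nonDicritical_of_arcs {A B : ℂ × ℂ → ℂ} (hA : AnalyticAt ℂ A 0)
    (hB : AnalyticAt ℂ B 0) {N : ℕ} (hN : N ≠ 0) {z : ℕ → ℂ → ℂ} (hz : ∀ i, AnalyticAt ℂ (z i) 0)
    (hz0 : ∀ i, z i 0 = 0) (hne : ∀ i j, i ≠ j → ¬ z i =ᶠ[𝓝 0] z j)
    (htan : ∀ i, IsTangentArc A B N (z i)) :
    ¬ NonDicritical (⟨germOf A hA, germOf B hB⟩ : OneForm 0) := by
  classical
  intro hfin
  choose G hG using fun i => exists_branchEquation hN (hz i) (hz0 i)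
  have hmem (i : ℕ) : Ideal.span {germOf (G i) (hG i).analyticAt} ∈
      separatrices (⟨germOf A hA, germOf B hB⟩ : OneForm 0) :=
    ⟨_, ((hG i).prime hN (hz i) (hz0 i)).irreducible,
      (hG i).isInvariant hN (hz i) (hz0 i) hA hB (htan i), rfl⟩
  have : Finite (separatrices (⟨germOf A hA, germOf B hB⟩ : OneForm 0)) := hfin
  -- With finitely many separatrices, infinitely many arcs share one ideal. Its generator G i₀ would
  -- be divisible, after ramification, by M + 1 distinct y - z i, although its order on x = 0 is M.
  obtain ⟨⟨I, hI⟩, hinf⟩ := Finite.exists_infinite_fiber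
    fun i : ℕ => (⟨_, hmem i⟩ : separatrices (⟨germOf A hA, germOf B hB⟩ : OneForm 0))
  have hS := Set.infinite_coe_iff.1 hinf
  obtain ⟨i₀, hi₀⟩ := hS.nonempty
  obtain ⟨M, -, hord⟩ := (hG i₀).exists_order
  obtain ⟨T, hTS, hT⟩ := hS.exists_subset_card_eq (M + 1)
  have hv : ∀ i ∈ T, ∀ᶠ u in 𝓝 (0 : ℂ), G i₀ (u ^ N, z i u) = 0 := fun i hi => by
    refine ((hG i).vanish_iff _ (hG i₀).analyticAt).2 ?_
    rw [← germOf_dvd_iff (hG i).analyticAt, ← Ideal.mem_span_singleton]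
    have h1 : Ideal.span {germOf (G i) (hG i).analyticAt} = I := congrArg Subtype.val (hTS hi)
    have h2 : Ideal.span {germOf (G i₀) (hG i₀).analyticAt} = I := congrArg Subtype.val hi₀
    rw [h1, ← h2]
    exact Ideal.mem_span_singleton_self _
  obtain ⟨Q, hQ, hGQ⟩ := exists_eq_prod_mul (analyticAt_ramify (hG i₀).analyticAt hN) T
    (fun i _ => hz i) (fun i _ => hz0 i) (fun i _ j _ => hne i j) hv
  have h1 : ((M + 1 : ℕ) : ℕ∞) ≤ analyticOrderAt (fun s => G i₀ (0, s)) 0 := by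
    refine (natCast_le_analyticOrderAt (analyticAt_snd_axis (hG i₀).analyticAt)).2
      ⟨fun s => Q (0, s), analyticAt_snd_axis hQ, ?_⟩
    filter_upwards [eventually_snd_axis hGQ] with s hs
    simpa [hN, hz0, hT] using hs
  rw [hord] at h1
  have : M + 1 ≤ M := by exact_mod_cast h1
  omega

/-! ### Branches of the strict transform -/

theorem hasDerivAt_snd {F : ℂ × ℂ → ℂ} {x y : ℂ} (hF : AnalyticAt ℂ F (x, y)) :
    HasDerivAt (fun s => F (x, s)) (pderiv₂ F (x, y)) y := by
  simpa using hasDerivAt_comp_curve (u := fun _ => x) (v := fun s => s) hF (hasDerivAt_const y x)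
    (hasDerivAt_id' y)

theorem hasDerivAt_fst {F : ℂ × ℂ → ℂ} {x y : ℂ} (hF : AnalyticAt ℂ F (x, y)) :
    HasDerivAt (fun s => F (s, y)) (pderiv₁ F (x, y)) x := by
  simpa using hasDerivAt_comp_curve (u := fun s => s) (v := fun _ => y) hF (hasDerivAt_id' x)
    (hasDerivAt_const x y)

theorem eventually_eventually_snd {P : ℂ × ℂ → Prop} {p : ℂ × ℂ} (h : ∀ᶠ z in 𝓝 p, P z) :
    ∀ᶠ z in 𝓝 p, ∀ᶠ s in 𝓝 z.2, P (z.1, s) := by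
  filter_upwards [h.eventually_nhds] with z hz
  exact (Continuous.tendsto' (by fun_prop) z.2 z rfl :
    Tendsto (fun s => (z.1, s)) (𝓝 z.2) (𝓝 z)).eventually hz

theorem eventually_eventually_fst {P : ℂ × ℂ → Prop} {p : ℂ × ℂ} (h : ∀ᶠ z in 𝓝 p, P z) :
    ∀ᶠ z in 𝓝 p, ∀ᶠ s in 𝓝 z.1, P (s, z.2) := by
  filter_upwards [h.eventually_nhds] with z hz
  exact (Continuous.tendsto' (by fun_prop) z.1 z rfl :
    Tendsto (fun s => (s, z.2)) (𝓝 z.1) (𝓝 z)).eventually hz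

section

variable {f φ : ℂ × ℂ → ℂ} {m : ℕ} {p : Polynomial ℂ}

/-- Differentiate f (x, s x) = x ^ m φ (x, s) with respect to s. -/
theorem HasBlow.pderiv₂_eq (hf : AnalyticAt ℂ f 0) (h : HasBlow f m φ p) (l : ℂ) :
    ∀ᶠ z in 𝓝 ((0 : ℂ), l), z.1 * pderiv₂ f (blowUp₁ z) = z.1 ^ m * pderiv₂ φ z := by
  filter_upwards [eventually_eventually_snd (h.eq l), (h.analyticAt l).eventually_analyticAt,
    (tendsto_blowUp₁ l).eventually hf.eventually_analyticAt] with z h1 h2 h3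
  have h4 := hasDerivAt_comp_curve (f := f) (u := fun _ => z.1) (v := fun s => s * z.1) (s := z.2) h3
    (hasDerivAt_const _ _) (hasDerivAt_mul_const z.1)
  have h5 : HasDerivAt (fun s => z.1 ^ m * φ (z.1, s)) (z.1 ^ m * pderiv₂ φ z) z.2 :=
    (hasDerivAt_snd h2).const_mul _
  have h6 : (fun s => f (z.1, s * z.1)) =ᶠ[𝓝 z.2] fun s => z.1 ^ m * φ (z.1, s) := h1
  have h7 := h4.unique (h5.congr_of_eventuallyEq h6)
  rw [zero_mul, zero_add] at h7
  exact h7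

/-- Differentiate f (s, t s) = s ^ m φ (s, t) with respect to s; the extra factor x avoids the
exponent m - 1, which is truncated at m = 0. -/
theorem HasBlow.pderiv₁_eq (hf : AnalyticAt ℂ f 0) (h : HasBlow f m φ p) (l : ℂ) :
    ∀ᶠ z in 𝓝 ((0 : ℂ), l), z.1 * (pderiv₁ f (blowUp₁ z) + z.2 * pderiv₂ f (blowUp₁ z)) =
      m * z.1 ^ m * φ z + z.1 ^ (m + 1) * pderiv₁ φ z := by
  filter_upwards [eventually_eventually_fst (h.eq l), (h.analyticAt l).eventually_analyticAt,
    (tendsto_blowUp₁ l).eventually hf.eventually_analyticAt] with z h1 h2 h3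
  have h4 := hasDerivAt_comp_curve (f := f) (u := fun s => s) (v := fun s => z.2 * s) (s := z.1) h3
    (hasDerivAt_id' _) (hasDerivAt_const_mul z.2)
  have h5 : HasDerivAt (fun s => s ^ m * φ (s, z.2))
      (m * z.1 ^ (m - 1) * φ z + z.1 ^ m * pderiv₁ φ z) z.1 :=
    (hasDerivAt_pow m z.1).mul (hasDerivAt_fst h2)
  have h6 : (fun s => f (s, z.2 * s)) =ᶠ[𝓝 z.1] fun s => s ^ m * φ (s, z.2) := h1
  have h7 := h4.unique (h5.congr_of_eventuallyEq h6)
  rw [one_mul] at h7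
  have h8 : z.1 * (m * z.1 ^ (m - 1)) = m * z.1 ^ m := by
    rcases Nat.eq_zero_or_pos m with rfl | hm
    · simp
    · rw [mul_left_comm, ← pow_succ', Nat.sub_add_cancel hm]
  have h9 : z.1 * (pderiv₁ f (blowUp₁ z) + z.2 * pderiv₂ f (blowUp₁ z)) =
      z.1 * (m * z.1 ^ (m - 1) * φ z + z.1 ^ m * pderiv₁ φ z) := congrArg (z.1 * ·) h7
  rw [h9, mul_add, ← mul_assoc, h8, pow_succ]
  ring

/-- The image of a branch at `(0, l)` under the blow-up. -/
def blowArc (N : ℕ) (l : ℂ) (s : ℂ → ℂ) (u : ℂ) : ℂ := (l + s u) * u ^ N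

theorem analyticAt_blowArc (N : ℕ) (l : ℂ) {s : ℂ → ℂ} (hs : AnalyticAt ℂ s 0) :
    AnalyticAt ℂ (blowArc N l s) 0 :=
  (analyticAt_const.add hs).mul (analyticAt_id.pow N)

theorem blowArc_zero {N : ℕ} (hN : N ≠ 0) (l : ℂ) (s : ℂ → ℂ) : blowArc N l s 0 = 0 := by
  simp [blowArc, hN]

theorem tendsto_arc {N : ℕ} (hN : N ≠ 0) {l : ℂ} {s : ℂ → ℂ} (hs : AnalyticAt ℂ s 0)
    (hs0 : s 0 = 0) : Tendsto (fun u => (u ^ N, l + s u)) (𝓝 0) (𝓝 (0, l)) :=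
  tendsto_graph (u := fun u => u ^ N) (y := fun u => l + s u) (analyticAt_id.pow N)
    (analyticAt_const.add hs) (by simp [hN, hs0])

/-- The strict transform of a reduced curve is reduced: it has no double branch. -/
theorem HasBlow.not_double_branch (hf : AnalyticAt ℂ f 0) (hsq : Squarefree (germOf f hf))
    (h : HasBlow f m φ p) {N : ℕ} (hN : N ≠ 0) {l : ℂ} {s : ℂ → ℂ} (hs : AnalyticAt ℂ s 0)
    (hs0 : s 0 = 0) (h1 : ∀ᶠ u in 𝓝 (0 : ℂ), φ (u ^ N, l + s u) = 0)
    (h2 : ∀ᶠ u in 𝓝 (0 : ℂ), pderiv₂ φ (u ^ N, l + s u) = 0) : False := by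
  have ht := tendsto_arc hN (l := l) hs hs0
  have hz := analyticAt_blowArc N l hs
  -- Blowing down, f and its derivative in y vanish along the image arc, so f is divisible by the
  -- square of the equation of that arc.
  refine not_squarefree_of_branch hf hN hz (blowArc_zero hN l s) ?_ (eventually_of_punctured ?_ ?_)
    hsq
  · filter_upwards [h1, ht.eventually (h.eq l)] with u h3 h4
    rw [h3, mul_zero] at h4
    exact h4
  · exact (analyticAt_comp_graph (analyticAt_pderiv₂ hf) (analyticAt_id.pow N) hz
      (by simp [blowArc_zero hN l s, hN])).continuousAt
  · filter_upwards [h2.filter_mono nhdsWithin_le_nhds,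
      (ht.eventually (h.pderiv₂_eq hf l)).filter_mono nhdsWithin_le_nhds,
      self_mem_nhdsWithin] with u h3 h4 h5
    rw [h3, mul_zero] at h4
    exact (mul_eq_zero.1 h4).resolve_left (pow_ne_zero _ h5)

/-- Puiseux roots of the strict transform are pairwise distinct. -/
theorem HasBlow.exists_roots (hf : AnalyticAt ℂ f 0) (hsq : Squarefree (germOf f hf))
    (h : HasBlow f m φ p) (hp : p ≠ 0) (l : ℂ) :
    ∃ (N : ℕ) (τ : ℕ → ℂ → ℂ), N ≠ 0 ∧ (∀ i, AnalyticAt ℂ (τ i) 0) ∧ (∀ i, τ i 0 = 0) ∧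
      (∀ i < p.rootMultiplicity l, ∀ᶠ u in 𝓝 (0 : ℂ), φ (u ^ N, l + τ i u) = 0) ∧
      ∀ i < p.rootMultiplicity l, ∀ j < p.rootMultiplicity l, i ≠ j → ¬ τ i =ᶠ[𝓝 0] τ j := by
  have hφ := analyticAt_translate (h.analyticAt l)
  obtain ⟨N, τ, v, hN, hτ, hτ0, hv, hF⟩ := exists_factorization (p.rootMultiplicity l) _ hφ
    (by simp only [h.eval]; exact analyticOrderAt_eval_add hp l)
  have ht (i : ℕ) := tendsto_graph (c := 0) (u := fun u => u) analyticAt_id (hτ i) (by simp [hτ0])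
  have hvan (i : ℕ) (hi : i < p.rootMultiplicity l) :
      ∀ᶠ u in 𝓝 (0 : ℂ), φ (u ^ N, l + τ i u) = 0 := by
    filter_upwards [(ht i).eventually hF] with u hu
    rw [hu, Finset.prod_eq_zero (Finset.mem_range.2 hi) (by simp), zero_mul]
  refine ⟨N, τ, hN, hτ, hτ0, hvan, fun i hi j hj hij he => ?_⟩
  refine h.not_double_branch hf hsq hN (hτ i) (hτ0 i) (hvan i hi) ?_
  filter_upwards [(ht i).eventually (eventually_eventually_snd hF), he,
    (ht i).eventually hv.eventually_analyticAt,
    (tendsto_arc hN (hτ i) (hτ0 i)).eventually (h.analyticAt l).eventually_analyticAt]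
    with u h1 h2 h3 h4
  have hd : HasDerivAt (fun s => φ (u ^ N, l + s)) (pderiv₂ φ (u ^ N, l + τ i u)) (τ i u) :=
    HasDerivAt.comp_const_add l (τ i u) (hasDerivAt_snd h4)
  -- If two roots coincide, φ (u ^ N, l + s) = (s - τ i u)² R s, and the derivative in the second
  -- variable vanishes along the branch too.
  let R : ℂ → ℂ := fun s =>
    (∏ k ∈ ((Finset.range (p.rootMultiplicity l)).erase i).erase j, (s - τ k u)) * v (u, s)
  have hR : DifferentiableAt ℂ R (τ i u) := by
    refine DifferentiableAt.mul (by fun_prop) (hasDerivAt_snd h3).differentiableAt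
  have he' : (fun s => φ (u ^ N, l + s)) =ᶠ[𝓝 (τ i u)]
      fun s => (s - τ i u) * ((s - τ i u) * R s) := by
    filter_upwards [h1] with s hs
    have hs' : φ (u ^ N, l + s) =
        (∏ k ∈ Finset.range (p.rootMultiplicity l), (s - τ k u)) * v (u, s) := hs
    rw [hs', ← Finset.mul_prod_erase _ _ (Finset.mem_range.2 hi),
      ← Finset.mul_prod_erase _ _ (Finset.mem_erase.2 ⟨hij.symm, Finset.mem_range.2 hj⟩), h2]
    simp only [R]
    ring
  have hd' := ((hasDerivAt_id' (τ i u)).sub_const (τ i u)).mul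
    (((hasDerivAt_id' (τ i u)).sub_const (τ i u)).mul hR.hasDerivAt)
  have := (hd'.congr_of_eventuallyEq he').unique hd
  simpa using this.symm

end

/-! ### The ramified blow-up and arcs tangent to the foliation. -/

section

variable {A B α β : ℂ × ℂ → ℂ} {n N : ℕ} {p q : Polynomial ℂ}

/-- The coefficient of `du` in the ramified blow-up. -/
def ramA (α β : ℂ × ℂ → ℂ) (l : ℂ) (N : ℕ) (z : ℂ × ℂ) : ℂ := N * blowA α β l (z.1 ^ N, z.2)

/-- The coefficient of `dt` in the ramified blow-up. -/
def ramB (β : ℂ × ℂ → ℂ) (l : ℂ) (N : ℕ) (z : ℂ × ℂ) : ℂ := z.1 * β (z.1 ^ N, l + z.2)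

/-- With x = u ^ N and dx = N u ^ (N - 1) du, the blown-up form is u ^ (N n + N - 1) times `ramA` du
+ `ramB` dt. One factor u remains in `ramB`, so the divisor u = 0 stays invariant. -/
theorem tangentArc_identity (hA : HasBlow A n α p) (hB : HasBlow B n β q) (hN : N ≠ 0) {l : ℂ}
    {s : ℂ → ℂ} (hs : AnalyticAt ℂ s 0) (hs0 : s 0 = 0) :
    ∀ᶠ u in 𝓝 (0 : ℂ), A (u ^ N, blowArc N l s u) * (N * u ^ (N - 1)) +
      B (u ^ N, blowArc N l s u) * deriv (blowArc N l s) u =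
        u ^ (N * n + (N - 1)) * (ramA α β l N (u, s u) + ramB β l N (u, s u) * deriv s u) := by
  have ht := tendsto_arc hN (l := l) hs hs0
  filter_upwards [ht.eventually (hA.eq l), ht.eventually (hB.eq l), hs.eventually_analyticAt]
    with u h1 h2 h3
  have hd : deriv (blowArc N l s) u = deriv s u * u ^ N + (l + s u) * (N * u ^ (N - 1)) := by
    have h4 := (h3.differentiableAt.hasDerivAt.const_add l).mul (hasDerivAt_pow N u)
    exact h4.deriv
  have h1' : A (u ^ N, blowArc N l s u) = (u ^ N) ^ n * α (u ^ N, l + s u) := h1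
  have h2' : B (u ^ N, blowArc N l s u) = (u ^ N) ^ n * β (u ^ N, l + s u) := h2
  have h5 : u ^ N = u * u ^ (N - 1) := by
    rw [← pow_succ', Nat.sub_add_cancel (Nat.pos_of_ne_zero hN)]
  rw [hd, h1', h2', pow_add, pow_mul]
  simp only [ramA, ramB, blowA]
  linear_combination (u ^ N) ^ n * β (u ^ N, l + s u) * deriv s u * h5

theorem isSol_ram_of_tangentArc (hA : HasBlow A n α p) (hB : HasBlow B n β q) (hN : N ≠ 0) {l : ℂ}
    {s : ℂ → ℂ} (hs : AnalyticAt ℂ s 0) (hs0 : s 0 = 0)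
    (hra : AnalyticAt ℂ (ramA α β l N) 0) (hrb : AnalyticAt ℂ (ramB β l N) 0)
    (h : IsTangentArc A B N (blowArc N l s)) : IsSol (ramA α β l N) (ramB β l N) s := by
  refine ⟨hs, hs0, eventually_of_punctured ?_ ?_⟩
  · have hc : ((0 : ℂ), s 0) = 0 := by rw [hs0]; rfl
    exact ((analyticAt_comp_graph hra analyticAt_id hs hc).add
      ((analyticAt_comp_graph hrb analyticAt_id hs hc).mul hs.deriv)).continuousAt
  · filter_upwards [(tangentArc_identity hA hB hN (l := l) hs hs0).filter_mono nhdsWithin_le_nhds,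
      h.filter_mono nhdsWithin_le_nhds, self_mem_nhdsWithin] with u h1 h2 h3
    rw [h1] at h2
    exact (mul_eq_zero.1 h2).resolve_left (pow_ne_zero _ h3)

theorem not_nonDicritical_of_ram (hAan : AnalyticAt ℂ A 0) (hBan : AnalyticAt ℂ B 0)
    (hA : HasBlow A n α p) (hB : HasBlow B n β q) (hN : N ≠ 0) {l : ℂ}
    (h : ManySols (ramA α β l N) (ramB β l N)) :
    ¬ NonDicritical (⟨germOf A hAan, germOf B hBan⟩ : OneForm 0) := by
  obtain ⟨s, hs, hne⟩ := h
  refine not_nonDicritical_of_arcs hAan hBan hN (z := fun i => blowArc N l (s i))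
    (fun i => analyticAt_blowArc N l (hs i).1) (fun i => blowArc_zero hN l _)
    (fun i j hij he => hne i j hij ?_) fun i => ?_
  · have h1 : ∀ᶠ u in 𝓝 (0 : ℂ), s i u - s j u = 0 := by
      refine eventually_of_punctured ((hs i).1.sub (hs j).1).continuousAt ?_
      filter_upwards [he.filter_mono nhdsWithin_le_nhds, self_mem_nhdsWithin] with u h1 h2
      have := mul_right_cancel₀ (pow_ne_zero N h2) h1
      linear_combination this
    exact h1.mono fun u hu => sub_eq_zero.1 hu
  · filter_upwards [tangentArc_identity hA hB hN (l := l) (hs i).1 (hs i).2.1, (hs i).2.2]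
      with u h1 h2
    rw [h1, h2, mul_zero]

theorem not_nonDicritical_of_manySols (hA : AnalyticAt ℂ A 0) (hB : AnalyticAt ℂ B 0)
    (h : ManySols A B) : ¬ NonDicritical (⟨germOf A hA, germOf B hB⟩ : OneForm 0) := by
  obtain ⟨y, hy, hne⟩ := h
  refine not_nonDicritical_of_arcs hA hB one_ne_zero (fun i => (hy i).1) (fun i => (hy i).2.1) hne
    fun i => ?_
  filter_upwards [(hy i).2.2] with u hu
  simpa using hu

/-- For the zero form every line is a solution; this excludes ω = 0 when the foliation is
non-dicritical. -/
theorem manySols_of_eventually_zero (hA : ∀ᶠ z in 𝓝 (0 : ℂ × ℂ), A z = 0)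
    (hB : ∀ᶠ z in 𝓝 (0 : ℂ × ℂ), B z = 0) : ManySols A B := by
  refine ⟨fun i x => i * x, fun i => ⟨analyticAt_const.mul analyticAt_id, by simp, ?_⟩,
    fun i j hij he => hij ?_⟩
  · have ht := tendsto_graph (c := 0) (u := fun u => u) (y := fun u : ℂ => (i : ℂ) * u) analyticAt_id
      (analyticAt_const.mul analyticAt_id) (by simp)
    filter_upwards [ht.eventually hA, ht.eventually hB] with u h1 h2
    rw [h1, h2, zero_mul, add_zero]
  · obtain ⟨x, hx, hx0⟩ := ((he.filter_mono nhdsWithin_le_nhds).and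
      (self_mem_nhdsWithin : {(0 : ℂ)}ᶜ ∈ 𝓝[≠] (0 : ℂ))).exists
    exact_mod_cast mul_right_cancel₀ hx0 hx

end

/-- Along a branch of an invariant reduced curve, the foliation is tangent. -/
theorem isTangentArc_of_invariant {f A B : ℂ × ℂ → ℂ} (hf : AnalyticAt ℂ f 0)
    (hA : AnalyticAt ℂ A 0) (hB : AnalyticAt ℂ B 0) (hsq : Squarefree (germOf f hf))
    (hinv : IsInvariant ⟨germOf A hA, germOf B hB⟩ (germOf f hf)) {N : ℕ} (hN : N ≠ 0) {z : ℂ → ℂ}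
    (hz : AnalyticAt ℂ z 0) (hz0 : z 0 = 0) (hfz : ∀ᶠ u in 𝓝 (0 : ℂ), f (u ^ N, z u) = 0) :
    IsTangentArc A B N z := by
  have hc : ((0 : ℂ) ^ N, z 0) = 0 := by simp [hN, hz0]
  have ht := tendsto_graph (u := fun u => u ^ N) (analyticAt_id.pow N) hz hc
  have han {H : ℂ × ℂ → ℂ} (hH : AnalyticAt ℂ H 0) : AnalyticAt ℂ (fun u => H (u ^ N, z u)) 0 :=
    analyticAt_comp_graph hH (analyticAt_id.pow N) hz hc
  have h1 := analyticAt_pderiv₁ hf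
  have h2 := analyticAt_pderiv₂ hf
  obtain ⟨H, -, hH⟩ := (germOf_dvd_iff hf ((h1.fun_mul hB).fun_sub (h2.fun_mul hA))).1 hinv
  have hd : ∀ᶠ u in 𝓝 (0 : ℂ), deriv (fun u => f (u ^ N, z u)) u = 0 := by
    have := EventuallyEq.deriv (𝕜 := ℂ) (f := fun _ => (0 : ℂ)) hfz
    filter_upwards [this] with u hu
    rw [hu]
    simp
  -- The product of the y-derivative of f and the restriction of ω to the arc is zero, by the chain
  -- rule and invariance. The first factor is not zero because f is squarefree.
  refine (eventually_eq_zero_or_of_mul_one (han h2)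
    (((han hA).mul (analyticAt_const.mul (analyticAt_id.pow (N - 1)))).add
      ((han hB).mul hz.deriv)) ?_).resolve_left
    fun h => not_squarefree_of_branch hf hN hz hz0 hfz h hsq
  filter_upwards [ht.eventually hH, hd, hfz, ht.eventually hf.eventually_analyticAt,
    hz.eventually_analyticAt] with u h3 h4 h5 h6 h7
  rw [(hasDerivAt_comp_curve (u := fun u => u ^ N) h6 (hasDerivAt_pow N u)
    h7.differentiableAt.hasDerivAt).deriv] at h4
  rw [h5, zero_mul] at h3
  simp only [Pi.mul_apply, Pi.add_apply, Pi.pow_apply, id]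
  linear_combination B (u ^ N, z u) * h4 - (N * u ^ (N - 1)) * h3

/-- For a non-dicritical foliation, the order of contact of an invariant curve with the exceptional
divisor is bounded by the order of vanishing of the foliation along it. -/
theorem rootMultiplicity_le {f φ A B α β : ℂ × ℂ → ℂ} {m n : ℕ} {r p q : Polynomial ℂ}
    (hf : AnalyticAt ℂ f 0) (hA : AnalyticAt ℂ A 0) (hB : AnalyticAt ℂ B 0)
    (hsq : Squarefree (germOf f hf))
    (hnd : NonDicritical (⟨germOf A hA, germOf B hB⟩ : OneForm 0))
    (hinv : IsInvariant ⟨germOf A hA, germOf B hB⟩ (germOf f hf))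
    (hfφ : HasBlow f m φ r) (hAα : HasBlow A n α p) (hBβ : HasBlow B n β q) (hr : r ≠ 0)
    (hpq : p + Polynomial.X * q ≠ 0) (l : ℂ) :
    r.rootMultiplicity l ≤ (p + Polynomial.X * q).rootMultiplicity l := by
  obtain ⟨N, τ, hN, hτ, hτ0, hφτ, hne⟩ := hfφ.exists_roots hf hsq hr l
  have hra : AnalyticAt ℂ (ramA α β l N) 0 :=
    analyticAt_const.mul (analyticAt_ramify (hAα.analyticAt_blowA hBβ l) hN)
  have hrb : AnalyticAt ℂ (ramB β l N) 0 :=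
    analyticAt_fst.mul (analyticAt_ramify (analyticAt_translate (hBβ.analyticAt l)) hN)
  -- A common bound for the contact orders, finite because the roots are distinct; the diagonal
  -- terms are `⊤.toNat = 0`.
  let K : ℕ := ∑ i ∈ Finset.range (r.rootMultiplicity l), ∑ j ∈ Finset.range (r.rootMultiplicity l),
    (analyticOrderAt (fun x => τ i x - τ j x) 0).toNat
  have h := manySols_or_card_le K hra hrb (Eventually.of_forall fun y => by simp [ramB])
    (Finset.range (r.rootMultiplicity l)) τ (fun i hi => ?_) (fun i hi j hj hij => ?_)
  · have h := h.resolve_left fun h => not_nonDicritical_of_ram hA hB hAα hBβ hN h hnd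
    rw [Finset.card_range] at h
    -- On u = 0 the ramification only contributes the constant N, so the order there is the
    -- multiplicity of l in the tangent cone.
    have h1 : (fun y => ramA α β l N (0, y)) =
        (fun _ => (N : ℂ)) * fun y => (p + Polynomial.X * q).eval (l + y) := by
      funext y
      simp only [ramA, zero_pow hN, hAα.blowA_fst_zero hBβ, Pi.mul_apply]
    have h2 : analyticOrderAt (fun _ : ℂ => (N : ℂ)) 0 = 0 :=
      analyticAt_const.analyticOrderAt_eq_zero.2 (Nat.cast_ne_zero.2 hN)
    rw [h1, analyticOrderAt_mul analyticAt_const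
      (AnalyticAt.aeval_polynomial (analyticAt_const.add analyticAt_id) _), h2, zero_add,
      analyticOrderAt_eval_add hpq] at h
    exact_mod_cast h
  · refine isSol_ram_of_tangentArc hAα hBβ hN (hτ i) (hτ0 i) hra hrb
      (isTangentArc_of_invariant hf hA hB hsq hinv hN (analyticAt_blowArc N l (hτ i))
        (blowArc_zero hN l _) ?_)
    filter_upwards [hφτ i (Finset.mem_range.1 hi),
      (tendsto_arc hN (hτ i) (hτ0 i)).eventually (hfφ.eq l)] with u h1 h2
    rw [h1, mul_zero] at h2
    exact h2
  · have htop : analyticOrderAt (fun x => τ i x - τ j x) 0 ≠ ⊤ := fun h =>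
      hne i (Finset.mem_range.1 hi) j (Finset.mem_range.1 hj) hij
        ((analyticOrderAt_eq_top.1 h).mono fun x hx => sub_eq_zero.1 hx)
    rw [← ENat.natCast_toNat htop]
    refine Nat.cast_le.2 (le_trans ?_ (Finset.single_le_sum (fun _ _ => Nat.zero_le _) hi))
    exact Finset.single_le_sum (f := fun j => (analyticOrderAt (fun x => τ i x - τ j x) 0).toNat)
      (fun _ _ => Nat.zero_le _) hj

/-! ### Logarithmic forms -/

section

variable {p : ℂ × ℂ}

theorem d₁_mul (a b : HolGerm p) : d₁ (a * b) = d₁ a * b + a * d₁ b := by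
  obtain ⟨f, hf, rfl⟩ := exists_germOf a
  obtain ⟨g, hg, rfl⟩ := exists_germOf b
  refine (germOf_eq_iff (analyticAt_pderiv₁ (hf.fun_mul hg)) (((analyticAt_pderiv₁ hf).fun_mul
    hg).fun_add (hf.fun_mul (analyticAt_pderiv₁ hg)))).2 ?_
  filter_upwards [hf.eventually_analyticAt, hg.eventually_analyticAt] with z h1 h2
  exact pderiv₁_mul h1 h2

theorem d₂_mul (a b : HolGerm p) : d₂ (a * b) = d₂ a * b + a * d₂ b := by
  obtain ⟨f, hf, rfl⟩ := exists_germOf a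
  obtain ⟨g, hg, rfl⟩ := exists_germOf b
  refine (germOf_eq_iff (analyticAt_pderiv₂ (hf.fun_mul hg)) (((analyticAt_pderiv₂ hf).fun_mul
    hg).fun_add (hf.fun_mul (analyticAt_pderiv₂ hg)))).2 ?_
  filter_upwards [hf.eventually_analyticAt, hg.eventually_analyticAt] with z h1 h2
  exact pderiv₂_mul h1 h2

/-- If `η / g = ζ / h` with `h = 0` reduced and invariant by `ζ`, then `η / g` is logarithmic. -/
theorem isLogarithmic_of_invariant {η ζ : OneForm p} {g h : HolGerm p} (hg : g ≠ 0)
    (hh : Squarefree h) (hA : h * η.A = g * ζ.A) (hB : h * η.B = g * ζ.B)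
    (hinv : IsInvariant ζ h) : IsLogarithmic η g := by
  refine ⟨hg, h, hh, ⟨_, hA⟩, ⟨_, hB⟩, ?_⟩
  obtain ⟨W, hW⟩ := hinv
  have h1 := congrArg d₁ hB
  have h2 := congrArg d₂ hA
  rw [d₁_mul, d₁_mul] at h1
  rw [d₂_mul, d₂_mul] at h2
  -- The witness is h d(η/g) = h d(ζ/h) = dζ - W.
  refine ⟨extDeriv ζ - W, mul_left_cancel₀ hh.ne_zero ?_⟩
  simp only [extDeriv, dWedge] at hW ⊢
  linear_combination h * g * h1 - h * g * h2 - g ^ 2 * hW +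
    (h * d₂ g + g * d₂ h) * hA - (h * d₁ g + g * d₁ h) * hB

end

/-! ### The exceptional divisor and the total transform in the first chart. -/

section

variable {l : ℂ}

/-- The germ of the first coordinate at the point `(0, l)` of the exceptional divisor. -/
noncomputable def excGerm (l : ℂ) : HolGerm ((0 : ℂ), l) := germOf Prod.fst analyticAt_fst

/-- The germ of the second coordinate at the point `(0, l)` of the exceptional divisor. -/
noncomputable def coordGerm (l : ℂ) : HolGerm ((0 : ℂ), l) := germOf Prod.snd analyticAt_snd

theorem d₁_fst {p : ℂ × ℂ} : d₁ (germOf Prod.fst analyticAt_fst : HolGerm p) = 1 := by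
  refine (germOf_eq_iff (analyticAt_pderiv₁ analyticAt_fst) (g := fun _ => 1) analyticAt_const).2
    (Eventually.of_forall fun z => ?_)
  change fderiv ℂ Prod.fst z _ = _
  rw [fderiv_fst]
  rfl

theorem d₂_fst {p : ℂ × ℂ} : d₂ (germOf Prod.fst analyticAt_fst : HolGerm p) = 0 := by
  refine (germOf_eq_iff (analyticAt_pderiv₂ analyticAt_fst) (g := fun _ => 0) analyticAt_const).2
    (Eventually.of_forall fun z => ?_)
  change fderiv ℂ Prod.fst z _ = _
  rw [fderiv_fst]
  rfl

theorem d₁_snd {p : ℂ × ℂ} : d₁ (germOf Prod.snd analyticAt_snd : HolGerm p) = 0 := by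
  refine (germOf_eq_iff (analyticAt_pderiv₁ analyticAt_snd) (g := fun _ => 0) analyticAt_const).2
    (Eventually.of_forall fun z => ?_)
  change fderiv ℂ Prod.snd z _ = _
  rw [fderiv_snd]
  rfl

theorem d₂_snd {p : ℂ × ℂ} : d₂ (germOf Prod.snd analyticAt_snd : HolGerm p) = 1 := by
  refine (germOf_eq_iff (analyticAt_pderiv₂ analyticAt_snd) (g := fun _ => 1) analyticAt_const).2
    (Eventually.of_forall fun z => ?_)
  change fderiv ℂ Prod.snd z _ = _
  rw [fderiv_snd]
  rfl

theorem excGerm_dvd_iff {f : ℂ × ℂ → ℂ} (hf : AnalyticAt ℂ f (0, l)) :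
    excGerm l ∣ germOf f hf ↔ ∀ᶠ s in 𝓝 (0 : ℂ), f (0, l + s) = 0 := by
  rw [excGerm, germOf_dvd_iff analyticAt_fst hf]
  constructor
  · rintro ⟨k, -, h⟩
    have := eventually_snd_axis (eventually_translate_iff.2 h)
    filter_upwards [this] with s hs
    simpa using hs
  · intro h
    obtain ⟨k, hk, hfk⟩ := exists_eq_add_fst_mul (translate_analyticAt hf)
    refine ⟨fun z => k (z - (0, l)), AnalyticAt.fun_comp (f := fun z : ℂ × ℂ => z - (0, l))
      (by rwa [sub_self]) (analyticAt_id.sub analyticAt_const), ?_⟩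
    refine eventually_translate_iff.1 ?_
    have ht : Tendsto Prod.snd (𝓝 (0 : ℂ × ℂ)) (𝓝 0) := Continuous.tendsto' continuous_snd _ _ rfl
    filter_upwards [hfk, ht.eventually h] with z h1 h2
    rw [h1]
    simp [h2]

theorem prime_excGerm (l : ℂ) : Prime (excGerm l) := by
  refine ⟨fun h => ?_, fun h => (isUnit_germOf_iff _).1 h rfl, fun a b hab => ?_⟩
  · have := congrArg d₁ h
    rw [excGerm, d₁_fst] at this
    have h0 : d₁ (0 : HolGerm ((0 : ℂ), l)) = 0 := by
      simpa using d₁_mul (0 : HolGerm ((0 : ℂ), l)) 0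
    exact one_ne_zero (this.trans h0)
  · obtain ⟨f, hf, rfl⟩ := exists_germOf a
    obtain ⟨g, hg, rfl⟩ := exists_germOf b
    rw [germOf_mul, excGerm_dvd_iff] at hab
    rw [excGerm_dvd_iff, excGerm_dvd_iff]
    have han {f : ℂ × ℂ → ℂ} (hf : AnalyticAt ℂ f (0, l)) :
        AnalyticAt ℂ (fun s => f (0, l + s)) 0 :=
      analyticAt_comp_graph hf analyticAt_const (analyticAt_const.add analyticAt_id) (by simp)
    exact eventually_eq_zero_or_of_mul_one (han hf) (han hg) hab

/-- On the exceptional divisor φ restricts to the nonzero polynomial r: the power x ^ m extracted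
from f is the exact one. -/
theorem HasBlow.not_excGerm_dvd {f φ : ℂ × ℂ → ℂ} {m : ℕ} {r : Polynomial ℂ} (h : HasBlow f m φ r)
    (hr : r ≠ 0) : ¬ excGerm l ∣ germOf φ (h.analyticAt l) := by
  rw [excGerm_dvd_iff]
  simp only [h.eval]
  intro h0
  have h1 := analyticOrderAt_eval_add hr l
  rw [analyticOrderAt_eq_top.2 h0] at h1
  exact ENat.top_ne_natCast _ h1

/-- The total transform of a reduced curve, with its reduced structure. -/
theorem HasBlow.squarefree {f φ : ℂ × ℂ → ℂ} {m : ℕ} {r : Polynomial ℂ} (hf : AnalyticAt ℂ f 0)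
    (hsq : Squarefree (germOf f hf)) (h : HasBlow f m φ r) (hr : r ≠ 0) :
    Squarefree (excGerm l * germOf φ (h.analyticAt l)) := by
  have hφ := h.analyticAt l
  rintro x ⟨κ, hκ⟩
  by_contra hx
  by_cases hX : excGerm l ∣ x
  · obtain ⟨c, rfl⟩ := hX
    refine h.not_excGerm_dvd hr (l := l) ⟨c * c * κ, mul_left_cancel₀ (prime_excGerm l).ne_zero ?_⟩
    linear_combination hκ
  · have hd : x ∣ excGerm l * d₂ (germOf φ hφ) := by
      -- The exceptional coordinate does not depend on t, so a square factor x of xφ also divides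
      -- its product with the t-derivative of φ.
      have h1 := congrArg d₂ hκ
      rw [d₂_mul, excGerm, d₂_fst, d₂_mul, d₂_mul] at h1
      exact ⟨2 * d₂ x * κ + x * d₂ κ, by rw [excGerm]; linear_combination h1⟩
    have hd' : x ∣ excGerm l * germOf φ hφ := ⟨x * κ, by rw [hκ, mul_assoc]⟩
    obtain ⟨γ, hγ, rfl⟩ := exists_germOf x
    rw [isUnit_germOf_iff, not_not] at hx
    obtain ⟨k₁, -, hk₁⟩ := (germOf_dvd_iff hγ (analyticAt_fst.fun_mul hφ)).1 hd'
    obtain ⟨k₂, -, hk₂⟩ :=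
      (germOf_dvd_iff hγ (analyticAt_fst.fun_mul (analyticAt_pderiv₂ hφ))).1 hd
    have hΓ := translate_analyticAt hγ
    have hΓ1 : (fun s => γ (((0 : ℂ), l) + (0, s))) = fun s => γ (0, l + s) := by
      funext s
      simp
    have htop : analyticOrderAt (fun s => γ (((0 : ℂ), l) + (0, s))) 0 ≠ ⊤ := by
      rw [hΓ1]
      exact fun h => hX ((excGerm_dvd_iff hγ).2 (analyticOrderAt_eq_top.1 h))
    obtain ⟨n, hn⟩ := ENat.ne_top_iff_exists.1 htop
    have hn0 : n ≠ 0 := by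
      rintro rfl
      refine ((analyticAt_snd_axis hΓ).analyticOrderAt_eq_zero.1 hn.symm) ?_
      simpa using hx
    -- The factor vanishes at the point but not identically on the divisor, so Puiseux gives it a
    -- branch; φ and its t-derivative both vanish along it.
    obtain ⟨N, τ, hN, hτ, hτ0, hγτ⟩ := exists_branch n hn0 _ hΓ hn.symm
    have ht := tendsto_arc hN (l := l) hτ hτ0
    have hγτ' : ∀ᶠ u in 𝓝 (0 : ℂ), γ (u ^ N, l + τ u) = 0 := by
      filter_upwards [hγτ] with u hu
      simpa using hu
    have hvan {ψ k : ℂ × ℂ → ℂ} (hψ : AnalyticAt ℂ ψ (0, l))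
        (hk : ∀ᶠ z in 𝓝 ((0 : ℂ), l), z.1 * ψ z = γ z * k z) :
        ∀ᶠ u in 𝓝 (0 : ℂ), ψ (u ^ N, l + τ u) = 0 := by
      refine eventually_of_punctured (analyticAt_comp_graph hψ (analyticAt_id.pow N)
        (analyticAt_const.add hτ) (by simp [hN, hτ0])).continuousAt ?_
      filter_upwards [hγτ'.filter_mono nhdsWithin_le_nhds,
        (ht.eventually hk).filter_mono nhdsWithin_le_nhds, self_mem_nhdsWithin] with u h1 h2 h3
      rw [h1, zero_mul] at h2
      exact (mul_eq_zero.1 h2).resolve_left (pow_ne_zero _ h3)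
    exact h.not_double_branch hf hsq hN hτ hτ0 (hvan hφ hk₁) (hvan (analyticAt_pderiv₂ hφ) hk₂)

/-- In the first chart, the pullback of `ω / f` is logarithmic as soon as the order of `f` is at most
one more than that of `ω`. -/
theorem isLogarithmic_blowUp₁ {f φ A B α β : ℂ × ℂ → ℂ} {m n : ℕ} {r p q : Polynomial ℂ}
    (hf : AnalyticAt ℂ f 0) (hA : AnalyticAt ℂ A 0) (hB : AnalyticAt ℂ B 0)
    (hsq : Squarefree (germOf f hf))
    (hinv : IsInvariant ⟨germOf A hA, germOf B hB⟩ (germOf f hf))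
    (hfφ : HasBlow f m φ r) (hAα : HasBlow A n α p) (hBβ : HasBlow B n β q) (hr : r ≠ 0)
    (hmn : m ≤ n + 1) (l : ℂ) :
    IsLogarithmic
      ((⟨germOf A hA, germOf B hB⟩ : OneForm 0).pullback blowUp₁ (analyticAt_blowUp₁ (0, l))
        (blowUp₁_exceptional l))
      (pullback blowUp₁ (analyticAt_blowUp₁ (0, l)) (blowUp₁_exceptional l) (germOf f hf)) := by
  set X := excGerm l with hX
  set T := coordGerm l with hT
  set F := germOf φ (hfφ.analyticAt l) with hF
  set a := germOf α (hAα.analyticAt l) with ha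
  set b := germOf β (hBβ.analyticAt l) with hb
  let P (g : HolGerm 0) : HolGerm ((0 : ℂ), l) :=
    pullback blowUp₁ (analyticAt_blowUp₁ (0, l)) (blowUp₁_exceptional l) g
  have hPmul (g₁ g₂ : HolGerm 0) : P (g₁ * g₂) = P g₁ * P g₂ := by
    obtain ⟨f₁, hf₁, rfl⟩ := exists_germOf g₁
    obtain ⟨f₂, hf₂, rfl⟩ := exists_germOf g₂
    rfl
  have hPsub (g₁ g₂ : HolGerm 0) : P (g₁ - g₂) = P g₁ - P g₂ := by
    obtain ⟨f₁, hf₁, rfl⟩ := exists_germOf g₁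
    obtain ⟨f₂, hf₂, rfl⟩ := exists_germOf g₂
    rfl
  have hPan {g : ℂ × ℂ → ℂ} (hg : AnalyticAt ℂ g 0) : AnalyticAt ℂ (fun z => g (blowUp₁ z)) (0, l) :=
    AnalyticAt.fun_comp (by rwa [blowUp₁_exceptional]) (analyticAt_blowUp₁ (0, l))
  have hPA : P (germOf A hA) = X ^ n * a :=
    (germOf_eq_iff (hPan hA) ((analyticAt_fst.pow n).mul (hAα.analyticAt l))).2 (hAα.eq l)
  have hPB : P (germOf B hB) = X ^ n * b :=
    (germOf_eq_iff (hPan hB) ((analyticAt_fst.pow n).mul (hBβ.analyticAt l))).2 (hBβ.eq l)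
  have hPf : P (germOf f hf) = X ^ m * F :=
    (germOf_eq_iff (hPan hf) ((analyticAt_fst.pow m).mul (hfφ.analyticAt l))).2 (hfφ.eq l)
  have h2 : X * P (d₂ (germOf f hf)) = X ^ m * d₂ F :=
    (germOf_eq_iff (analyticAt_fst.fun_mul (hPan (analyticAt_pderiv₂ hf)))
      ((analyticAt_fst.pow m).mul (analyticAt_pderiv₂ (hfφ.analyticAt l)))).2 (hfφ.pderiv₂_eq hf l)
  have h1 : X * (P (d₁ (germOf f hf)) + T * P (d₂ (germOf f hf))) =
      m * X ^ m * F + X ^ (m + 1) * d₁ F :=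
    (germOf_eq_iff (analyticAt_fst.fun_mul ((hPan (analyticAt_pderiv₁ hf)).fun_add
      (analyticAt_snd.fun_mul (hPan (analyticAt_pderiv₂ hf)))))
      (((analyticAt_const.fun_mul (analyticAt_fst.fun_pow m)).fun_mul (hfφ.analyticAt l)).fun_add
        ((analyticAt_fst.fun_pow (m + 1)).fun_mul (analyticAt_pderiv₁ (hfφ.analyticAt l))))).2
      (hfφ.pderiv₁_eq hf l)
  have hX0 : X ≠ 0 := (prime_excGerm l).ne_zero
  have hdX : d₁ X = 1 := d₁_fst
  have hdX' : d₂ X = 0 := d₂_fst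
  have hφ₂ : (germOf (fun z => (blowUp₁ z).2) (analyticAt_snd.comp (analyticAt_blowUp₁ (0, l))) :
      HolGerm ((0 : ℂ), l)) = T * X := rfl
  have hφ₁ : (germOf (fun z => (blowUp₁ z).1) (analyticAt_fst.comp (analyticAt_blowUp₁ (0, l))) :
      HolGerm ((0 : ℂ), l)) = X := rfl
  -- Invariance of the strict transform: pull back f ∣ df ∧ ω, cancel X ^ m, then cancel X ^ n,
  -- which is possible because the prime X does not divide F.
  have hD : F ∣ m * F * b + X * d₁ F * b - d₂ F * (a + T * b) := by
    obtain ⟨H, hH⟩ := hinv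
    have h3 := congrArg P hH
    simp only [dWedge] at h3
    rw [hPsub, hPmul, hPmul, hPmul, hPA, hPB, hPf] at h3
    have h4 : X ^ n * (m * F * b + X * d₁ F * b - d₂ F * (a + T * b)) = F * (X * P H) := by
      refine mul_left_cancel₀ (pow_ne_zero m hX0) ?_
      linear_combination X * h3 - X ^ n * b * h1 + (X ^ n * (a + T * b)) * h2
    obtain ⟨c, hc⟩ := (prime_excGerm l).pow_dvd_of_dvd_mul_left n (hfφ.not_excGerm_dvd hr (l := l))
      ⟨_, h4.symm⟩
    refine ⟨c, mul_left_cancel₀ (pow_ne_zero n hX0) ?_⟩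
    rw [h4, hc]
    ring
  obtain ⟨c, hc⟩ := hD
  have hFne : F ≠ 0 := fun h => hfφ.not_excGerm_dvd hr (l := l) (by rw [← hF, h]; exact dvd_zero _)
  have hk : X ^ m * X ^ (n + 1 - m) = X ^ (n + 1) := by rw [← pow_add, Nat.add_sub_cancel' hmn]
  -- The total transform has equation X ^ m F, and m ≤ n + 1 is what makes X ^ (n + 1) / X ^ m
  -- holomorphic.
  refine isLogarithmic_of_invariant (ζ := ⟨X ^ (n + 1 - m) * (a + T * b), X ^ (n + 1 - m) * (X * b)⟩)
    (h := X * F) ?_ (hfφ.squarefree hf hsq hr) ?_ ?_ ?_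
  · change P (germOf f hf) ≠ 0
    rw [hPf]
    exact mul_ne_zero (pow_ne_zero _ hX0) hFne
  · change X * F * (P (germOf A hA) * d₁ X + P (germOf B hB) * d₁ (T * X)) = P (germOf f hf) * _
    have hT1 : d₁ T = 0 := d₁_snd
    rw [hPf, hPA, hPB, d₁_mul, hdX, hT1]
    linear_combination -F * (a + T * b) * hk
  · change X * F * (P (germOf A hA) * d₂ X + P (germOf B hB) * d₂ (T * X)) = P (germOf f hf) * _
    have hT2 : d₂ T = 1 := d₂_snd
    rw [hPf, hPA, hPB, d₂_mul, hdX', hT2]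
    linear_combination -F * X * b * hk
  · refine ⟨X ^ (n + 1 - m) * (b + c - m * b), ?_⟩
    simp only [dWedge]
    rw [d₁_mul, d₂_mul, hdX, hdX']
    linear_combination X ^ (n + 1 - m) * X * hc

end

/-! ### Exchanging the coordinates -/

section

variable {p q : ℂ × ℂ}

theorem analyticAt_swap (p : ℂ × ℂ) : AnalyticAt ℂ Prod.swap p := analyticAt_snd.prod analyticAt_fst

/-- Exchange of the two coordinates. -/
noncomputable def swapEquiv (h : q.swap = p) : HolGerm p ≃+* HolGerm q where
  toFun := pullback Prod.swap (analyticAt_swap q) h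
  invFun := pullback Prod.swap (analyticAt_swap p) (by rw [← h, Prod.swap_swap])
  left_inv g := by
    obtain ⟨f, hf, rfl⟩ := exists_germOf g
    rfl
  right_inv g := by
    obtain ⟨f, hf, rfl⟩ := exists_germOf g
    rfl
  map_mul' a b := by
    obtain ⟨f, hf, rfl⟩ := exists_germOf a
    obtain ⟨g, hg, rfl⟩ := exists_germOf b
    rfl
  map_add' a b := by
    obtain ⟨f, hf, rfl⟩ := exists_germOf a
    obtain ⟨g, hg, rfl⟩ := exists_germOf b
    rfl

theorem fderiv_comp_swap (f : ℂ × ℂ → ℂ) (z v : ℂ × ℂ) :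
    fderiv ℂ (f ∘ Prod.swap) z v = fderiv ℂ f z.swap v.swap := by
  have := (ContinuousLinearEquiv.prodComm ℂ ℂ ℂ).comp_right_fderiv (f := f) (x := z)
  exact congrArg (fun L => L v) this

theorem d₁_swapEquiv (h : q.swap = p) (g : HolGerm p) :
    d₁ (swapEquiv h g) = swapEquiv h (d₂ g) := by
  obtain ⟨f, hf, rfl⟩ := exists_germOf g
  exact Subtype.ext (Germ.coe_eq.2 (Eventually.of_forall fun z => fderiv_comp_swap f z (1, 0)))

theorem d₂_swapEquiv (h : q.swap = p) (g : HolGerm p) :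
    d₂ (swapEquiv h g) = swapEquiv h (d₁ g) := by
  obtain ⟨f, hf, rfl⟩ := exists_germOf g
  exact Subtype.ext (Germ.coe_eq.2 (Eventually.of_forall fun z => fderiv_comp_swap f z (0, 1)))

/-- Pullback of a `1`-form by the exchange of the coordinates. -/
noncomputable def swapForm (h : q.swap = p) (ω : OneForm p) : OneForm q :=
  ⟨swapEquiv h ω.B, swapEquiv h ω.A⟩

theorem dWedge_swap (h : q.swap = p) (g : HolGerm p) (ω : OneForm p) :
    dWedge (swapEquiv h g) (swapForm h ω) = -swapEquiv h (dWedge g ω) := by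
  simp only [dWedge, swapForm, d₁_swapEquiv, d₂_swapEquiv, map_sub, map_mul]
  ring

theorem extDeriv_swap (h : q.swap = p) (ω : OneForm p) :
    extDeriv (swapForm h ω) = -swapEquiv h (extDeriv ω) := by
  simp only [extDeriv, swapForm, d₁_swapEquiv, d₂_swapEquiv, map_sub]
  ring

theorem squarefree_swapEquiv (h : q.swap = p) {g : HolGerm p} (hg : Squarefree g) :
    Squarefree (swapEquiv h g) := by
  intro x hx
  obtain ⟨y, rfl⟩ := (swapEquiv h).surjective x
  rw [← map_mul, map_dvd_iff] at hx
  exact (hg y hx).map (swapEquiv h)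

theorem isInvariant_swap_iff (h : q.swap = p) {g : HolGerm p} {ω : OneForm p} :
    IsInvariant (swapForm h ω) (swapEquiv h g) ↔ IsInvariant ω g := by
  rw [IsInvariant, IsInvariant, dWedge_swap, dvd_neg, map_dvd_iff]

theorem NonDicritical.swap (h : q.swap = p) {ω : OneForm p} (hω : NonDicritical ω) :
    NonDicritical (swapForm h ω) := by
  refine (Set.Finite.image (Ideal.map (swapEquiv h)) hω).subset ?_
  rintro _ ⟨g, hg, hinv, rfl⟩
  obtain ⟨g, rfl⟩ := (swapEquiv h).surjective g
  refine ⟨Ideal.span {g}, ⟨g, (MulEquiv.irreducible_iff (swapEquiv h)).1 hg,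
    (isInvariant_swap_iff h).1 hinv, rfl⟩, ?_⟩
  rw [Ideal.map_span, Set.image_singleton]

theorem IsLogarithmic.swap (h : q.swap = p) {η : OneForm p} {g : HolGerm p}
    (hη : IsLogarithmic η g) : IsLogarithmic (swapForm h η) (swapEquiv h g) := by
  obtain ⟨hg, k, hk, hA, hB, hd⟩ := hη
  refine ⟨(map_ne_zero_iff _ (swapEquiv h).injective).2 hg, _, squarefree_swapEquiv h hk, ?_, ?_, ?_⟩
  · rw [swapForm, ← map_mul, map_dvd_iff]
    exact hB
  · rw [swapForm, ← map_mul, map_dvd_iff]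
    exact hA
  · have h1 := (map_dvd_iff (swapEquiv h)).2 hd
    rw [extDeriv_swap, dWedge_swap, ← dvd_neg]
    simp only [map_pow, map_mul, map_sub] at h1
    convert h1 using 1
    ring

end

/-- The second chart is the first one conjugated by the exchange of coordinates, at the source and
at the target. -/
theorem pullback_blowUp₂ (s : ℂ) (f : HolGerm 0) :
    pullback blowUp₂ (analyticAt_blowUp₂ (s, 0)) (blowUp₂_exceptional s) f =
      swapEquiv (p := (0, s)) rfl (pullback blowUp₁ (analyticAt_blowUp₁ (0, s))
        (blowUp₁_exceptional s) (swapEquiv (p := 0) rfl f)) := by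
  obtain ⟨f, hf, rfl⟩ := exists_germOf f
  rfl

theorem OneForm.pullback_blowUp₂ (s : ℂ) (ω : OneForm 0) :
    ω.pullback blowUp₂ (analyticAt_blowUp₂ (s, 0)) (blowUp₂_exceptional s) =
      swapForm (p := (0, s)) rfl ((swapForm (p := 0) rfl ω).pullback blowUp₁
        (analyticAt_blowUp₁ (0, s)) (blowUp₁_exceptional s)) := by
  simp only [OneForm.pullback, swapForm, map_add, map_mul, HolFol.pullback_blowUp₂,
    ← d₁_swapEquiv, ← d₂_swapEquiv]
  rw [OneForm.mk.injEq]
  exact ⟨add_comm _ _, add_comm _ _⟩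

/-! ### Orders of vanishing -/

open Polynomial in
/-- A polynomial of degree `≤ k` has at most `k` roots on the projective line, counted with
multiplicity; here `r` and `q` are such polynomials in two affine coordinates. -/
theorem le_of_rootMultiplicity_le {m k : ℕ} {r r' q q' : ℂ[X]} (hr : r ≠ 0) (hq : q ≠ 0)
    (hr' : ∀ i, r'.coeff i = if i ≤ m then r.coeff (m - i) else 0) (hrm : r.natDegree ≤ m)
    (hq' : ∀ i ≤ k, q'.coeff i = q.coeff (k - i)) (hqk : q.natDegree ≤ k)
    (h : ∀ l, r.rootMultiplicity l ≤ q.rootMultiplicity l)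
    (h' : r'.rootMultiplicity 0 ≤ q'.rootMultiplicity 0) : m ≤ k := by
  have hr'0 : r' ≠ 0 := by
    intro h0
    have := hr' (m - r.natDegree)
    rw [if_pos (Nat.sub_le _ _), Nat.sub_sub_self hrm, h0, coeff_zero] at this
    exact hr (leadingCoeff_eq_zero.1 this.symm)
  have h1 : r.natDegree ≤ q.natDegree := by
    refine natDegree_le_of_dvd ?_ hq
    rw [(IsAlgClosed.splits r).dvd_iff_roots_le_roots hr hq, Multiset.le_iff_count]
    simpa using h
  -- The multiplicity of r at infinity is m - deg r, read at 0 on the reversed polynomial; likewise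
  -- k - deg q for q. The finite roots account for deg r ≤ deg q.
  have h2 : m - r.natDegree ≤ q'.rootMultiplicity 0 := by
    refine le_trans ((le_rootMultiplicity_iff hr'0).2 ?_) h'
    rw [map_zero, sub_zero, X_pow_dvd_iff]
    intro d hd
    rw [hr', if_pos (by omega)]
    exact coeff_eq_zero_of_natDegree_lt (by omega)
  have h3 : q'.rootMultiplicity 0 ≤ k - q.natDegree := by
    by_contra! hlt
    have h4 := (X_pow_dvd_iff (f := q') (n := q'.rootMultiplicity 0)).1
      (by simpa using pow_rootMultiplicity_dvd q' 0) _ hlt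
    rw [hq' _ (Nat.sub_le _ _), Nat.sub_sub_self hqk] at h4
    exact hq (leadingCoeff_eq_zero.1 h4)
  omega

theorem leadPoly_natDegree_le (n : ℕ) (a : ℕ → ℂ × ℂ → ℂ) : (leadPoly n a).natDegree ≤ n :=
  Polynomial.natDegree_le_iff_coeff_eq_zero.2 fun i hi => by rw [coeff_leadPoly, if_neg (by omega)]

theorem coeff_leadPoly_swap (n : ℕ) (a : ℕ → ℂ × ℂ → ℂ) (i : ℕ) :
    (leadPoly n fun i => a (n - i) ∘ Prod.swap).coeff i =
      if i ≤ n then (leadPoly n a).coeff (n - i) else 0 := by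
  rw [coeff_leadPoly, coeff_leadPoly, if_pos (Nat.sub_le _ _)]
  rfl

theorem leadPoly_swap_ne_zero {n : ℕ} {a : ℕ → ℂ × ℂ → ℂ} (h : leadPoly n a ≠ 0) :
    (leadPoly n fun i => a (n - i) ∘ Prod.swap) ≠ 0 := by
  intro h0
  have h1 := coeff_leadPoly_swap n a (n - (leadPoly n a).natDegree)
  rw [h0, if_pos (Nat.sub_le _ _), Nat.sub_sub_self (leadPoly_natDegree_le n a),
    Polynomial.coeff_zero] at h1
  exact h (Polynomial.leadingCoeff_eq_zero.1 h1.symm)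

/-- The form xAₙ + yBₙ of degree n + 1 is unchanged when (x, A) and (y, B) are exchanged, so its
expressions in the two charts are reversals of each other. -/
theorem coeff_tangentCone_swap (n : ℕ) (a b : ℕ → ℂ × ℂ → ℂ) (i : ℕ) (hi : i ≤ n + 1) :
    ((leadPoly n fun i => b (n - i) ∘ Prod.swap) +
      Polynomial.X * leadPoly n fun i => a (n - i) ∘ Prod.swap).coeff i =
      (leadPoly n a + Polynomial.X * leadPoly n b).coeff (n + 1 - i) := by
  have h1 (c : ℕ → ℂ × ℂ → ℂ) : (leadPoly n c).coeff (n + 1) = 0 := by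
    rw [coeff_leadPoly, if_neg (by omega)]
  rw [Polynomial.coeff_add, Polynomial.coeff_add, coeff_leadPoly_swap]
  rcases i with _ | i
  · simp [h1]
  · rw [Polynomial.coeff_X_mul, coeff_leadPoly_swap, if_pos (by omega : i ≤ n)]
    rcases Nat.eq_or_lt_of_le (by omega : i ≤ n) with rfl | hlt
    · simp
    · have h2 : n + 1 - (i + 1) = (n - (i + 1)) + 1 := by omega
      have h3 : n - i = (n - (i + 1)) + 1 := by omega
      rw [if_pos (by omega), h2, Polynomial.coeff_X_mul, h3, add_comm]

section

variable {f A B : ℂ × ℂ → ℂ} (hf : AnalyticAt ℂ f 0) (hA : AnalyticAt ℂ A 0)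
  (hB : AnalyticAt ℂ B 0)

/-- The order of an invariant reduced curve of a non-dicritical foliation is at most one more than
that of the foliation. -/
theorem exists_homogRep_le (hsq : Squarefree (germOf f hf))
    (hnd : NonDicritical (⟨germOf A hA, germOf B hB⟩ : OneForm 0))
    (hinv : IsInvariant ⟨germOf A hA, germOf B hB⟩ (germOf f hf)) :
    ∃ m n c a b, HomogRep f m c ∧ HomogRep A n a ∧ HomogRep B n b ∧ leadPoly m c ≠ 0 ∧
      m ≤ n + 1 := by
  obtain ⟨m, c, hc, hc0⟩ := exists_homogRep_single hf
    fun h => hsq.ne_zero ((germOf_eq_zero_iff hf).2 h)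
  obtain ⟨n, a, b, ha, hb, hab⟩ := exists_homogRep hA hB fun h =>
    not_nonDicritical_of_manySols hA hB (manySols_of_eventually_zero h.1 h.2) hnd
  refine ⟨m, n, c, a, b, hc, ha, hb, hc0, ?_⟩
  -- A zero tangent cone would make the first blow-up dicritical; b has a nonzero leading polynomial
  -- then, since otherwise both would vanish.
  have hQ : leadPoly n a + Polynomial.X * leadPoly n b ≠ 0 := by
    intro hQ
    refine not_nonDicritical_of_manySols hA hB
      (manySols_of_dicritical ha.hasBlow hb.hasBlow (fun h => ?_) hQ) hnd
    rw [h, mul_zero, add_zero] at hQ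
    exact hab.elim (fun h1 => h1 hQ) fun h1 => h1 h
  have hQd : (leadPoly n a + Polynomial.X * leadPoly n b).natDegree ≤ n + 1 := by
    refine Polynomial.natDegree_add_le_of_degree_le
      ((leadPoly_natDegree_le n a).trans (Nat.le_succ n)) ?_
    refine Polynomial.natDegree_mul_le.trans ?_
    rw [Polynomial.natDegree_X, add_comm]
    exact Nat.succ_le_succ (leadPoly_natDegree_le n b)
  have hQ' : ((leadPoly n fun i => b (n - i) ∘ Prod.swap) +
      Polynomial.X * leadPoly n fun i => a (n - i) ∘ Prod.swap) ≠ 0 := by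
    intro h
    have h1 := coeff_tangentCone_swap n a b (n + 1 -
      (leadPoly n a + Polynomial.X * leadPoly n b).natDegree) (Nat.sub_le _ _)
    rw [h, Nat.sub_sub_self hQd, Polynomial.coeff_zero] at h1
    exact hQ (Polynomial.leadingCoeff_eq_zero.1 h1.symm)
  -- The finite directions l are treated in the first chart, the direction x = 0 as the point 0
  -- after the exchange of coordinates.
  exact le_of_rootMultiplicity_le hc0 hQ (coeff_leadPoly_swap m c) (leadPoly_natDegree_le m c)
    (coeff_tangentCone_swap n a b) hQd
    (rootMultiplicity_le hf hA hB hsq hnd hinv hc.hasBlow ha.hasBlow hb.hasBlow hc0 hQ)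
    (rootMultiplicity_le (analyticAt_comp_swap hf) (analyticAt_comp_swap hB)
      (analyticAt_comp_swap hA) (squarefree_swapEquiv (q := 0) rfl hsq) (hnd.swap (q := 0) rfl)
      ((isInvariant_swap_iff (q := 0) rfl).2 hinv) hc.swap.hasBlow hb.swap.hasBlow ha.swap.hasBlow
      (leadPoly_swap_ne_zero hc0) hQ' 0)

end

end HolFol

/-! ### The theorem: both charts from the bound on the orders. -/

theorem mainTheorem6 (ω : HolFol.OneForm 0) (f : HolFol.HolGerm 0)
    (hω : ω.HasIsolatedZero) (hnd : HolFol.NonDicritical ω)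
    (hf : HolFol.IsReducedEquation f) (hS : HolFol.IsInvariant ω f) :
    HolFol.BlowUpIsLogarithmic ω f := by
  have hsq := hf.2
  obtain ⟨A, B⟩ := ω
  obtain ⟨A, hA, rfl⟩ := HolFol.exists_germOf A
  obtain ⟨B, hB, rfl⟩ := HolFol.exists_germOf B
  obtain ⟨f, hf', rfl⟩ := HolFol.exists_germOf f
  obtain ⟨m, n, c, a, b, hc, ha, hb, hc0, hmn⟩ := HolFol.exists_homogRep_le hf' hA hB hsq hnd hS
  refine ⟨fun t => ?_, fun s => ?_⟩
  · exact HolFol.isLogarithmic_blowUp₁ hf' hA hB hsq hS hc.hasBlow ha.hasBlow hb.hasBlow hc0 hmn t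
  · rw [HolFol.OneForm.pullback_blowUp₂, HolFol.pullback_blowUp₂]
    exact HolFol.IsLogarithmic.swap _ (HolFol.isLogarithmic_blowUp₁ (HolFol.analyticAt_comp_swap hf')
      (HolFol.analyticAt_comp_swap hB) (HolFol.analyticAt_comp_swap hA)
      (HolFol.squarefree_swapEquiv (q := 0) rfl hsq)
      ((HolFol.isInvariant_swap_iff (q := 0) rfl).2 hS) hc.swap.hasBlow hb.swap.hasBlow
      ha.swap.hasBlow (HolFol.leadPoly_swap_ne_zero hc0) hmn s)
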